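/- **Definitions.** For $S\subseteq\mathbb R^2$ and $p\in\mathbb R^2$, the *curvature of locally convex type* $K_{lct}(p)\in[0,\infty]$ is the inverse of the infimum of all $r>0$ for which $\overline B(p,r)\cap S$ is disconnected (so $K_{lct}(p)=0$ if there is no such $r$), and $\Pi(S)=\{p: K_{lct}(p)>0\}$. For $p\in S$ and a unit vector $u$ let $R(p,u)$ be the supremum of all $r>0$ with $\overline B(p+ru,r)\cap S=\{p\}$. The *Divider* of $S$ is the set of all centres $p+R(p,u)\,u$ for which such radii exist and $R(p,u)<\infty$. A point $e$ of a set $X\subseteq\mathbb R^2$ is an *end point* of $X$ if some neighbourhood of $e$ in $X$ is homeomorphic to $[0,1)$ with $e$ corresponding to $0$. For a regular $C^2$ curve $\gamma$ let $k(t)\ge 0$ be the curvature of the osculating circle at $\gamma(t)$ and, where $k(t)\ne0$, let $E(t)$ be its centre; these centres form the *evolute* $E$, whose tangent at $E(t)$ is the normal of the curve at $\gamma(t)$. The *convex side* of $E$ is the set of the points $p$ such that, for some $t$ with $k(t)\neq 0$, the point of contact $E(t)$ lies strictly between $\gamma(t)$ and $p$ on this line. $E$ has a *cusp* at $E(t)$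 if $k(t)\ne0$ and the unit vectors $\frac{E(s)-E(t)}{|E(s)-E(t)|}$ converge to one and the same unit vector as $s\to t$ from either side; the cusp *corresponds to maximum curvature* if $k$ has a local maximum at $t$. **Theorem.** Let $S=\gamma((0,1))\subset\mathbb R^2$ be an unbounded curve, where $\gamma$ is a regular, twice continuously differentiable homeomorphism of $(0,1)$ onto $S$. Suppose that $S$ contains no arc of constant curvature and that $k$ has exactly one local maximum on $(0,1)$. Then: 1. the Divider of $S$ is contained in the closure of $\Pi(S)$ and in the closure of the convex side of the evolute $E$; 2. every end point of the Divider is a cusp of $E$ that corresponds to maximum curvature, and there is exactly one such cusp; 3. if moreover both ends of $S$ are unbounded (that is, $\gamma((0,t))$ and $\gamma((t,1))$ are unbounded for all $t\in(0,1)$), then $\Pi(S)$ is equal to the convex side of $E$, and the set of end points of the Divider is equal to the set of cusps of $E$ that correspond to maximum curvature. -/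

import Mathlib

open Set Filter Topology
open scoped ENNReal

noncomputable section

namespace DividerSet

/-- The Euclidean plane. -/
abbrev Plane : Type := EuclideanSpace ℝ (Fin 2)

/-! ### Notions attached to an arbitrary subset `S` of the plane -/

/-- The infimum, in `[0, ∞]`, of the radii `r > 0` of the closed disks with centre `p` whose
intersection with `S` is disconnected (the empty set is not disconnected; `inf ∅ = ∞`). -/
def lctRadius (S : Set Plane) (p : Plane) : ℝ≥0∞ :=
  sInf {ρ | ∃ r : ℝ, 0 < r ∧ ¬ IsPreconnected (Metric.closedBall p r ∩ S) ∧ ρ = ENNReal.ofReal r}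

/-- The curvature of locally convex type of `S` at `p`, with `1 / ∞ = 0` and `1 / 0 = ∞`. -/
def lctCurvature (S : Set Plane) (p : Plane) : ℝ≥0∞ := (lctRadius S p)⁻¹

/-- `Π(S)`: the points where the curvature of locally convex type is positive. -/
def piSet (S : Set Plane) : Set Plane := {p | 0 < lctCurvature S p}

/-- The radii of the closed disks that meet `S` exactly in the point `p` and whose centre lies
from `p` in the direction of the unit vector `u`. -/
def contactRadii (S : Set Plane) (p u : Plane) : Set ℝ :=
  {r | 0 < r ∧ Metric.closedBall (p + r • u) r ∩ S = {p}}

/-- The Divider of `S`: the centres of the supremum contact disks, one for each point `p` of `S`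
and each contact direction `u` at `p` in which the supremum is finite. (`IsLUB` in `ℝ` implies
that the set of radii is nonempty, so that `u` is a contact direction, and bounded above.) -/
def divider (S : Set Plane) : Set Plane :=
  {c | ∃ p ∈ S, ∃ u : Plane, ‖u‖ = 1 ∧ ∃ R : ℝ, IsLUB (contactRadii S p u) R ∧ c = p + R • u}

/-- `e` is an end point of `X`: near `e` the set `X` is a half-open arc that starts at `e`. -/
def IsEndPoint (X : Set Plane) (e : Plane) : Prop :=
  ∃ (U : Set Plane) (he : e ∈ X ∩ U), IsOpen U ∧
    ∃ φ : ↥(X ∩ U) ≃ₜ ↥(Ico (0 : ℝ) 1), (φ ⟨e, he⟩ : ℝ) = 0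

/-! ### Plane curves and their evolutes -/

/-- `γ`, restricted to `(0, 1)`, is a twice continuously differentiable regular parametrization
that is a homeomorphism of `(0, 1)` onto its image. -/
structure IsC2OpenArc (γ : ℝ → Plane) : Prop where
  contDiffOn : ContDiffOn ℝ 2 γ (Ioo 0 1)
  deriv_ne_zero : ∀ t ∈ Ioo (0 : ℝ) 1, deriv γ t ≠ 0
  isEmbedding : IsEmbedding ((Ioo (0 : ℝ) 1).domRestrict γ)

/-- The curve as a set of points. -/
def trace (γ : ℝ → Plane) : Set Plane := γ '' Ioo 0 1

/-- The determinant of two plane vectors. -/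
def cross (v w : Plane) : ℝ := v 0 * w 1 - v 1 * w 0

/-- Rotation by a right angle. -/
def rot (v : Plane) : Plane := !₂[-(v 1), v 0]

/-- The curvature of the osculating circle at parameter `t` (nonnegative). -/
def curvature (γ : ℝ → Plane) (t : ℝ) : ℝ :=
  |cross (deriv γ t) (deriv (deriv γ) t)| / ‖deriv γ t‖ ^ 3

/-- The centre of the osculating circle at parameter `t`, meaningful where the curvature is not
zero; these points form the evolute. -/
def evolute (γ : ℝ → Plane) (t : ℝ) : Plane :=
  γ t + (‖deriv γ t‖ ^ 2 / cross (deriv γ t) (deriv (deriv γ) t)) • rot (deriv γ t)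

/-- No arc of the curve has constant curvature. -/
def NoConstantCurvatureArc (γ : ℝ → Plane) : Prop :=
  ∀ a b : ℝ, 0 < a → a < b → b < 1 → ¬ ∃ k : ℝ, ∀ t ∈ Icc a b, curvature γ t = k

/-- The side to which the evolute turns its convex side: the points `p` from which there is a
tangent to the evolute, namely a normal of the curve at some `γ t`, whose point of contact with
the evolute lies strictly between `γ t` and `p`. -/
def convexSide (γ : ℝ → Plane) : Set Plane :=
  {p | ∃ t ∈ Ioo (0 : ℝ) 1, curvature γ t ≠ 0 ∧ Sbtw ℝ (γ t) (evolute γ t) p}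

/-- The evolute has a cusp at parameter `t`: the curvature is not zero there and the two branches
of the evolute leave the point `evolute γ t` with the same direction `v`. -/
def IsEvoluteCusp (γ : ℝ → Plane) (t : ℝ) : Prop :=
  curvature γ t ≠ 0 ∧ ∃ v : Plane, ‖v‖ = 1 ∧
    Tendsto (fun s => ‖evolute γ s - evolute γ t‖⁻¹ • (evolute γ s - evolute γ t))
      (𝓝[≠] t) (𝓝 v)

/-- The cusps of the evolute that correspond to maxima of the curvature. -/
def maxCurvatureCusps (γ : ℝ → Plane) : Set Plane :=
  {c | ∃ t ∈ Ioo (0 : ℝ) 1, IsLocalMax (curvature γ) t ∧ IsEvoluteCusp γ t ∧ c = evolute γ t}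

/-- Each of the two ends of the curve is unbounded. -/
def BothEndsUnbounded (γ : ℝ → Plane) : Prop :=
  ∀ t ∈ Ioo (0 : ℝ) 1,
    ¬ Bornology.IsBounded (γ '' Ioo 0 t) ∧ ¬ Bornology.IsBounded (γ '' Ioo t 1)

end DividerSet

end

/-!
A point is in `Π(S)` exactly if its distance to `γ s` exceeds, for some `s`, its values at an
earlier and at a later parameter. The distance then has a local maximum, so the point lies on a
normal, at or beyond the centre of curvature; conversely the distance of a point strictly beyond it
has a strict local maximum. This compares `Π(S)` with the convex side of the evolute.

A centre of the Divider either has two nearest points on the closure of `S`, or is the centre of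
curvature at its only nearest point. In the first case the curve runs farther away between the two
nearest points, so the centre is in `Π(S)`. Moreover, the nearest point jumps along every small arc
around the centre that joins the radii to the two nearest points, so the Divider leaves the centre
on both sides of these radii and the centre is not an end point. In the second case the curvature
has a local maximum, since by Kneser's theorem the osculating disks are nested where the curvature
is strictly monotone. This rests on the fact that the evolute moves by at most the change of the
radius of curvature, to first order along the normal; the latter also makes the two branches of the
evolute at a maximum of the curvature leave in the same direction, which is a cusp.

If both ends are unbounded, the curvature increases up to the vertex and decreases from there. The
Divider then contains the cusp, and its points near the cusp have one nearest point on each side of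
the vertex. By the monotonicity of the nearest point projection these points are determined by
their height over the tangent at the vertex, and every small height is attained because a short
parallel to the tangent is connected, so the Divider is a half-open arc there.
-/

namespace DividerSet

section FocalCurve

theorem dist_le_sub_of_forall_dist_le_one_add_mul {X : Type*} [PseudoMetricSpace X] {F : ℝ → X}
    {ρ : ℝ → ℝ} {a b C : ℝ} (hab : a ≤ b)
    (h : ∀ x ∈ Icc a b, ∀ y ∈ Icc a b, x ≤ y →
      dist (F x) (F y) ≤ (1 + C * (y - x)) * (ρ y - ρ x)) :
    dist (F a) (F b) ≤ ρ b - ρ a := by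
  have equipartition : ∀ n : ℕ, 0 < n →
      dist (F a) (F b) ≤ (1 + C * ((b - a) / n)) * (ρ b - ρ a) := by
    intro n hn
    have hn' : (0 : ℝ) < n := Nat.cast_pos.2 hn
    have hδ : 0 ≤ (b - a) / n := div_nonneg (sub_nonneg.2 hab) hn'.le
    set x : ℕ → ℝ := fun i => a + i * ((b - a) / n) with hx
    have hx0 : x 0 = a := by simp [hx]
    have hxn : x n = b := by simp only [hx]; field_simp; ring
    have hstep : ∀ i, x (i + 1) - x i = (b - a) / n := fun i => by simp only [hx]; push_cast; ring
    have hmono : Monotone x := monotone_nat_of_le_succ fun i => by linarith [hstep i]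
    have hmem : ∀ i ≤ n, x i ∈ Icc a b := fun i hi =>
      ⟨hx0.symm.le.trans (hmono i.zero_le), (hmono hi).trans hxn.le⟩
    calc dist (F a) (F b) = dist (F (x 0)) (F (x n)) := by rw [hx0, hxn]
      _ ≤ ∑ i ∈ Finset.range n, (1 + C * ((b - a) / n)) * (ρ (x (i + 1)) - ρ (x i)) :=
          dist_le_range_sum_of_dist_le (f := F ∘ x) n fun {i} hi => by
            simpa only [hstep, Function.comp_apply] using
              h _ (hmem i hi.le) _ (hmem (i + 1) hi) (hmono i.le_succ)
      _ = (1 + C * ((b - a) / n)) * (ρ b - ρ a) := by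
          rw [← Finset.mul_sum, Finset.sum_range_sub (fun i => ρ (x i)), hx0, hxn]
  have hlim : Tendsto (fun n : ℕ => (1 + C * ((b - a) / n)) * (ρ b - ρ a)) atTop
      (𝓝 ((1 + C * 0) * (ρ b - ρ a))) :=
    (((tendsto_const_div_atTop_nhds_zero_nat (b - a)).const_mul C).const_add 1).mul_const _
  rw [mul_zero, add_zero, one_mul] at hlim
  exact ge_of_tendsto hlim ((eventually_gt_atTop 0).mono equipartition)

variable {V : Type*} [NormedAddCommGroup V]

theorem tendsto_inv_norm_smul_of_tendsto_inv_smul [NormedSpace ℝ V] {ι : Type*} {l : Filter ι}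
    {w : ι → V} {r : ι → ℝ} {n : V} (hr : ∀ᶠ i in l, 0 < r i) (hn : ‖n‖ = 1)
    (h : Tendsto (fun i => (r i)⁻¹ • w i) l (𝓝 n)) :
    Tendsto (fun i => ‖w i‖⁻¹ • w i) l (𝓝 n) := by
  have hnormalized : Tendsto (fun i => ‖(r i)⁻¹ • w i‖⁻¹ • (r i)⁻¹ • w i) l (𝓝 (‖n‖⁻¹ • n)) :=
    (h.norm.inv₀ (by rw [hn]; exact one_ne_zero)).smul h
  rw [hn, inv_one, one_smul] at hnormalized
  refine hnormalized.congr' (hr.mono fun i hi => ?_)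
  rw [norm_smul, norm_inv, Real.norm_of_nonneg hi.le, mul_inv, inv_inv, smul_smul,
    mul_right_comm, mul_inv_cancel₀ hi.ne', one_mul]

variable [InnerProductSpace ℝ V]

/-- An arc with velocity `γ'` and curvature `κ > 0` with respect to the unit normal field `N`, in
the form of the Rodrigues equation `N' = -κ γ'`. It makes sense in every inner product space. -/
structure IsFramedOn (γ γ' N : ℝ → V) (κ : ℝ → ℝ) (a b : ℝ) : Prop where
  hasDerivAt : ∀ t ∈ Icc a b, HasDerivAt γ (γ' t) t
  hasDerivAt_normal : ∀ t ∈ Icc a b, HasDerivAt N (-(κ t) • γ' t) t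
  norm_normal : ∀ t ∈ Icc a b, ‖N t‖ = 1
  pos : ∀ t ∈ Icc a b, 0 < κ t
  ne_zero : ∀ t ∈ Icc a b, γ' t ≠ 0
  continuousOn_deriv : ContinuousOn γ' (Icc a b)

/-- The centre of curvature `γ t + N t / κ t` of an arc with unit normal `N` and curvature `κ`. -/
noncomputable def focal (γ N : ℝ → V) (κ : ℝ → ℝ) (t : ℝ) : V := γ t + (κ t)⁻¹ • N t

theorem strictAntiOn_comp_neg {κ : ℝ → ℝ} {a b : ℝ} (hκ : StrictMonoOn κ (Icc a b)) :
    StrictAntiOn (fun t => κ (-t)) (Icc (-b) (-a)) := fun _ hx _ hy hxy =>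
  hκ ⟨le_neg_of_le_neg hy.2, neg_le_of_neg_le hy.1⟩ ⟨le_neg_of_le_neg hx.2, neg_le_of_neg_le hx.1⟩
    (neg_lt_neg hxy)

namespace IsFramedOn

variable {γ γ' N : ℝ → V} {κ : ℝ → ℝ} {a b : ℝ}

theorem mono (h : IsFramedOn γ γ' N κ a b) {c d : ℝ} (hcd : Icc c d ⊆ Icc a b) :
    IsFramedOn γ γ' N κ c d :=
  ⟨fun t ht => h.hasDerivAt t (hcd ht), fun t ht => h.hasDerivAt_normal t (hcd ht),
    fun t ht => h.norm_normal t (hcd ht), fun t ht => h.pos t (hcd ht),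
    fun t ht => h.ne_zero t (hcd ht), h.continuousOn_deriv.mono hcd⟩

theorem comp_neg (h : IsFramedOn γ γ' N κ a b) :
    IsFramedOn (fun t => γ (-t)) (fun t => -γ' (-t)) (fun t => N (-t)) (fun t => κ (-t))
      (-b) (-a) := by
  have hneg : MapsTo Neg.neg (Icc (-b) (-a)) (Icc a b) := fun t ht =>
    ⟨le_neg_of_le_neg ht.2, neg_le_of_neg_le ht.1⟩
  refine ⟨fun t ht => ?_, fun t ht => ?_, fun t ht => h.norm_normal _ (hneg ht),
    fun t ht => h.pos _ (hneg ht), fun t ht => neg_ne_zero.2 (h.ne_zero _ (hneg ht)),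
    (h.continuousOn_deriv.comp continuous_neg.continuousOn hneg).neg⟩
  · simpa [Function.comp_def] using (h.hasDerivAt _ (hneg ht)).scomp t (hasDerivAt_neg t)
  · simpa [Function.comp_def] using (h.hasDerivAt_normal _ (hneg ht)).scomp t (hasDerivAt_neg t)

theorem inv_sub_inv_nonneg (h : IsFramedOn γ γ' N κ a b) (hκ : AntitoneOn κ (Icc a b))
    {x y : ℝ} (hx : x ∈ Icc a b) (hy : y ∈ Icc a b) (hxy : x ≤ y) : 0 ≤ (κ y)⁻¹ - (κ x)⁻¹ :=
  sub_nonneg.2 (inv_anti₀ (h.pos y hy) (hκ hx hy hxy))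

theorem inv_sub_inv_pos (h : IsFramedOn γ γ' N κ a b) (hκ : StrictAntiOn κ (Icc a b))
    {x y : ℝ} (hx : x ∈ Icc a b) (hy : y ∈ Icc a b) (hxy : x < y) : 0 < (κ y)⁻¹ - (κ x)⁻¹ :=
  sub_pos.2 (inv_strictAnti₀ (h.pos y hy) (hκ hx hy hxy))

theorem abs_one_sub_inv_mul_le (h : IsFramedOn γ γ' N κ a b) (hκ : AntitoneOn κ (Icc a b))
    {x y σ : ℝ} (hx : x ∈ Icc a b) (hy : y ∈ Icc a b) (hσ : σ ∈ Icc x y) :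
    |1 - (κ y)⁻¹ * κ σ| ≤ κ a * ((κ y)⁻¹ - (κ x)⁻¹) := by
  have hσ' : σ ∈ Icc a b := ⟨hx.1.trans hσ.1, hσ.2.trans hy.2⟩
  have hx0 := (h.pos x hx).ne'
  have hy0 := h.pos y hy
  have hge : 1 ≤ (κ y)⁻¹ * κ σ := by
    rw [inv_mul_eq_div, one_le_div hy0]; exact hκ hσ' hy hσ.2
  rw [abs_of_nonpos (sub_nonpos.2 hge), neg_sub]
  calc (κ y)⁻¹ * κ σ - 1 ≤ (κ y)⁻¹ * κ x - 1 := by gcongr; exact hκ hx hσ' hσ.1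
    _ = κ x * ((κ y)⁻¹ - (κ x)⁻¹) := by field_simp
    _ ≤ κ a * ((κ y)⁻¹ - (κ x)⁻¹) :=
        mul_le_mul_of_nonneg_right (hκ ⟨le_rfl, hx.1.trans hx.2⟩ hx hx.1)
          (h.inv_sub_inv_nonneg hκ hx hy (hσ.1.trans hσ.2))

/-- Freezing the radius at its final value `1 / κ y` gives a differentiable curve
`γ + N / κ y`, although `κ` itself need not be differentiable. -/
theorem exists_norm_focal_sub_sub_le (h : IsFramedOn γ γ' N κ a b)
    (hκ : AntitoneOn κ (Icc a b)) :
    ∃ C : ℝ, ∀ x ∈ Icc a b, ∀ y ∈ Icc a b, x ≤ y →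
      ‖focal γ N κ y - focal γ N κ x - ((κ y)⁻¹ - (κ x)⁻¹) • N x‖
        ≤ C * (y - x) * ((κ y)⁻¹ - (κ x)⁻¹) := by
  obtain ⟨M, hM⟩ := isCompact_Icc.exists_bound_of_continuousOn h.continuousOn_deriv
  refine ⟨M * κ a, fun x hx y hy hxy => ?_⟩
  have hs : Icc x y ⊆ Icc a b := Icc_subset_Icc hx.1 hy.2
  have hderiv : ∀ σ ∈ Icc x y, HasDerivWithinAt (fun σ => γ σ + (κ y)⁻¹ • N σ)
      ((1 - (κ y)⁻¹ * κ σ) • γ' σ) (Icc x y) σ := fun σ hσ => by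
    rw [sub_smul, one_smul, sub_eq_add_neg, ← neg_smul, ← mul_neg, mul_smul]
    exact ((h.hasDerivAt σ (hs hσ)).add
      ((h.hasDerivAt_normal σ (hs hσ)).const_smul (κ y)⁻¹)).hasDerivWithinAt
  have hbound : ∀ σ ∈ Icc x y,
      ‖(1 - (κ y)⁻¹ * κ σ) • γ' σ‖ ≤ κ a * ((κ y)⁻¹ - (κ x)⁻¹) * M := fun σ hσ => by
    rw [norm_smul, Real.norm_eq_abs]
    have := h.abs_one_sub_inv_mul_le hκ hx hy hσ
    exact mul_le_mul this (hM σ (hs hσ)) (norm_nonneg _) ((abs_nonneg _).trans this)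
  calc ‖focal γ N κ y - focal γ N κ x - ((κ y)⁻¹ - (κ x)⁻¹) • N x‖
      = ‖γ y + (κ y)⁻¹ • N y - (γ x + (κ y)⁻¹ • N x)‖ := by
        congr 1; simp only [focal, sub_smul]; abel
    _ ≤ κ a * ((κ y)⁻¹ - (κ x)⁻¹) * M * ‖y - x‖ :=
        (convex_Icc x y).norm_image_sub_le_of_norm_hasDerivWithin_le hderiv hbound
          (left_mem_Icc.2 hxy) (right_mem_Icc.2 hxy)
    _ = M * κ a * (y - x) * ((κ y)⁻¹ - (κ x)⁻¹) := by
        rw [Real.norm_of_nonneg (sub_nonneg.2 hxy)]; ring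

theorem norm_focal_sub_le (h : IsFramedOn γ γ' N κ a b) (hκ : AntitoneOn κ (Icc a b))
    {x y : ℝ} (hx : x ∈ Icc a b) (hy : y ∈ Icc a b) (hxy : x ≤ y) :
    ‖focal γ N κ y - focal γ N κ x‖ ≤ (κ y)⁻¹ - (κ x)⁻¹ := by
  obtain ⟨C, hC⟩ := h.exists_norm_focal_sub_sub_le hκ
  rw [← dist_eq_norm, dist_comm]
  refine dist_le_sub_of_forall_dist_le_one_add_mul (F := focal γ N κ) (ρ := fun t => (κ t)⁻¹)
    (C := C) hxy fun s hs t ht hst => ?_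
  have hs' : s ∈ Icc a b := ⟨hx.1.trans hs.1, hs.2.trans hy.2⟩
  have ht' : t ∈ Icc a b := ⟨hx.1.trans ht.1, ht.2.trans hy.2⟩
  calc dist (focal γ N κ s) (focal γ N κ t) = ‖focal γ N κ t - focal γ N κ s‖ := by
        rw [dist_comm, dist_eq_norm]
    _ ≤ ‖focal γ N κ t - focal γ N κ s - ((κ t)⁻¹ - (κ s)⁻¹) • N s‖
          + ‖((κ t)⁻¹ - (κ s)⁻¹) • N s‖ := norm_le_norm_sub_add _ _
    _ ≤ C * (t - s) * ((κ t)⁻¹ - (κ s)⁻¹) + ((κ t)⁻¹ - (κ s)⁻¹) := by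
        gcongr
        · exact hC s hs' t ht' hst
        · rw [norm_smul, h.norm_normal s hs', mul_one,
            Real.norm_of_nonneg (h.inv_sub_inv_nonneg hκ hs' ht' hst)]
    _ = (1 + C * (t - s)) * ((κ t)⁻¹ - (κ s)⁻¹) := by ring

theorem tendsto_direction_right (h : IsFramedOn γ γ' N κ a b) (hab : a < b)
    (hκ : StrictAntiOn κ (Icc a b)) :
    Tendsto (fun s => ‖focal γ N κ s - focal γ N κ a‖⁻¹ • (focal γ N κ s - focal γ N κ a))
      (𝓝[>] a) (𝓝 (N a)) := by
  obtain ⟨C, hC⟩ := h.exists_norm_focal_sub_sub_le hκ.antitoneOn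
  have ha : a ∈ Icc a b := left_mem_Icc.2 hab.le
  have hpos : ∀ s ∈ Ioc a b, 0 < (κ s)⁻¹ - (κ a)⁻¹ := fun s hs =>
    h.inv_sub_inv_pos hκ ha (Ioc_subset_Icc_self hs) hs.1
  refine tendsto_inv_norm_smul_of_tendsto_inv_smul (r := fun s => (κ s)⁻¹ - (κ a)⁻¹)
    (Filter.mem_of_superset (Ioc_mem_nhdsGT hab) hpos) (h.norm_normal a ha) ?_
  have hlim : Tendsto (fun s : ℝ => C * (s - a)) (𝓝[>] a) (𝓝 0) :=
    (Continuous.tendsto' (by fun_prop) a 0 (by simp)).mono_left nhdsWithin_le_nhds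
  rw [tendsto_iff_norm_sub_tendsto_zero]
  refine squeeze_zero' (Eventually.of_forall fun _ => norm_nonneg _) ?_ hlim
  filter_upwards [Ioc_mem_nhdsGT hab] with s hs
  have hs0 := hpos s hs
  have hsmul : ((κ s)⁻¹ - (κ a)⁻¹)⁻¹ • (focal γ N κ s - focal γ N κ a) - N a
      = ((κ s)⁻¹ - (κ a)⁻¹)⁻¹ •
        (focal γ N κ s - focal γ N κ a - ((κ s)⁻¹ - (κ a)⁻¹) • N a) := by
    rw [smul_sub _ _ (_ • N a), smul_smul, inv_mul_cancel₀ hs0.ne', one_smul]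
  rw [hsmul, norm_smul, norm_inv, Real.norm_of_nonneg hs0.le, inv_mul_le_iff₀ hs0, mul_comm]
  exact hC a ha s (Ioc_subset_Icc_self hs) hs.1.le

theorem tendsto_direction_left (h : IsFramedOn γ γ' N κ a b) (hab : a < b)
    (hκ : StrictMonoOn κ (Icc a b)) :
    Tendsto (fun s => ‖focal γ N κ s - focal γ N κ b‖⁻¹ • (focal γ N κ s - focal γ N κ b))
      (𝓝[<] b) (𝓝 (N b)) := by
  have hright := h.comp_neg.tendsto_direction_right (neg_lt_neg hab)
    (strictAntiOn_comp_neg hκ)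
  simpa [focal, Function.comp_def] using hright.comp tendsto_neg_nhdsLT

theorem not_normal_eqOn_const (h : IsFramedOn γ γ' N κ a b) (hab : a < b) (v : V) :
    ¬ ∀ t ∈ Ico a b, N t = v := by
  intro hN
  obtain ⟨m, hm⟩ := exists_between hab
  have hm' := Ioo_subset_Icc_self hm
  have hderiv : HasDerivAt N 0 m := (hasDerivAt_const m v).congr_of_eventuallyEq <|
    (isOpen_Ioo.eventually_mem hm).mono fun t ht => hN t (Ioo_subset_Ico_self ht)
  exact smul_ne_zero (neg_ne_zero.2 (h.pos m hm').ne') (h.ne_zero m hm')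
    ((h.hasDerivAt_normal m hm').unique hderiv)

theorem inner_focal_sub_of_norm_eq (h : IsFramedOn γ γ' N κ a b) (hκ : AntitoneOn κ (Icc a b))
    {v : V} (hv : ‖v‖ = 1) (hvab : inner ℝ v (focal γ N κ b - focal γ N κ a) = (κ b)⁻¹ - (κ a)⁻¹)
    {x y : ℝ} (hx : x ∈ Icc a b) (hy : y ∈ Icc a b) (hxy : x ≤ y) :
    inner ℝ v (focal γ N κ y - focal γ N κ x) = (κ y)⁻¹ - (κ x)⁻¹ := by
  have hab : a ≤ b := hx.1.trans hx.2
  have hle : ∀ s ∈ Icc a b, ∀ t ∈ Icc a b, s ≤ t →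
      inner ℝ v (focal γ N κ t - focal γ N κ s) ≤ (κ t)⁻¹ - (κ s)⁻¹ := fun s hs t ht hst =>
    (real_inner_le_norm _ _).trans (by
      rw [hv, one_mul]; exact h.norm_focal_sub_le hκ hs ht hst)
  have hax := hle a (left_mem_Icc.2 hab) x hx hx.1
  have hxy' := hle x hx y hy hxy
  have hyb := hle y hy b (right_mem_Icc.2 hab) hy.2
  simp only [inner_sub_right] at hvab hax hxy' hyb ⊢
  linarith

/-- Equality would make the focal curve straight, and the normal is its tangent. -/
theorem norm_focal_sub_lt (h : IsFramedOn γ γ' N κ a b) (hab : a < b)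
    (hκ : StrictAntiOn κ (Icc a b)) :
    ‖focal γ N κ b - focal γ N κ a‖ < (κ b)⁻¹ - (κ a)⁻¹ := by
  have ha := left_mem_Icc.2 hab.le
  have hb := right_mem_Icc.2 hab.le
  refine (h.norm_focal_sub_le hκ.antitoneOn ha hb hab.le).lt_of_ne fun heq => ?_
  have hL := h.inv_sub_inv_pos hκ ha hb hab
  set w := focal γ N κ b - focal γ N κ a
  have hw : ‖w‖ ≠ 0 := heq ▸ hL.ne'
  set v := ‖w‖⁻¹ • w
  have hv : ‖v‖ = 1 := by rw [norm_smul, norm_inv, norm_norm, inv_mul_cancel₀ hw]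
  have hvw : inner ℝ v w = (κ b)⁻¹ - (κ a)⁻¹ := by
    rw [real_inner_smul_left, real_inner_self_eq_norm_mul_norm, inv_mul_cancel_left₀ hw, heq]
  refine h.not_normal_eqOn_const hab v fun x hx => ?_
  have hx' := Ico_subset_Icc_self hx
  have hlim := (tendsto_const_nhds (x := v)).inner (𝕜 := ℝ)
    ((h.mono (Icc_subset_Icc_left hx.1)).tendsto_direction_right hx.2
      (hκ.mono (Icc_subset_Icc_left hx.1)))
  have hone : ∀ᶠ s in 𝓝[>] x, inner ℝ v
      (‖focal γ N κ s - focal γ N κ x‖⁻¹ • (focal γ N κ s - focal γ N κ x)) = 1 := by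
    filter_upwards [Ioc_mem_nhdsGT hx.2] with s hs
    have hs' : s ∈ Icc a b := ⟨hx.1.trans hs.1.le, hs.2⟩
    have hinner := h.inner_focal_sub_of_norm_eq hκ.antitoneOn hv hvw hx' hs' hs.1.le
    have hnorm : ‖focal γ N κ s - focal γ N κ x‖ = (κ s)⁻¹ - (κ x)⁻¹ :=
      (h.norm_focal_sub_le hκ.antitoneOn hx' hs' hs.1.le).antisymm
        (hinner ▸ by simpa [hv] using real_inner_le_norm v (focal γ N κ s - focal γ N κ x))
    rw [real_inner_smul_right, hinner, hnorm,
      inv_mul_cancel₀ (h.inv_sub_inv_pos hκ hx' hs' hs.1).ne']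
  exact ((inner_eq_one_iff_of_norm_eq_one hv (h.norm_normal x hx')).1
    (tendsto_nhds_unique hlim (tendsto_const_nhds.congr' (hone.mono fun _ => Eq.symm)))).symm

theorem closedBall_focal_subset_ball_of_strictAntiOn (h : IsFramedOn γ γ' N κ a b) (hab : a < b)
    (hκ : StrictAntiOn κ (Icc a b)) :
    Metric.closedBall (focal γ N κ a) (κ a)⁻¹ ⊆ Metric.ball (focal γ N κ b) (κ b)⁻¹ :=
  Metric.closedBall_subset_ball' <| by
    rw [dist_comm, dist_eq_norm]; linarith [h.norm_focal_sub_lt hab hκ]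

theorem closedBall_focal_subset_ball_of_strictMonoOn (h : IsFramedOn γ γ' N κ a b) (hab : a < b)
    (hκ : StrictMonoOn κ (Icc a b)) :
    Metric.closedBall (focal γ N κ b) (κ b)⁻¹ ⊆ Metric.ball (focal γ N κ a) (κ a)⁻¹ := by
  simpa [focal] using h.comp_neg.closedBall_focal_subset_ball_of_strictAntiOn (neg_lt_neg hab)
    (strictAntiOn_comp_neg hκ)

end IsFramedOn

end FocalCurve

section Plane

theorem inner_eq_coord (v w : Plane) : inner ℝ v w = v 0 * w 0 + v 1 * w 1 := by
  simp [PiLp.inner_apply, Fin.sum_univ_two, mul_comm]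

@[simp] theorem rot_zero_apply (v : Plane) : rot v 0 = -(v 1) := by simp [rot]

@[simp] theorem rot_one_apply (v : Plane) : rot v 1 = v 0 := by simp [rot]

theorem plane_ext {v w : Plane} (h0 : v 0 = w 0) (h1 : v 1 = w 1) : v = w := by
  ext i
  fin_cases i
  exacts [h0, h1]

theorem norm_sq_eq_coord (v : Plane) : ‖v‖ ^ 2 = v 0 ^ 2 + v 1 ^ 2 := by
  rw [← real_inner_self_eq_norm_sq, inner_eq_coord, sq, sq]

theorem norm_rot (v : Plane) : ‖rot v‖ = ‖v‖ := by
  rw [← sq_eq_sq₀ (norm_nonneg _) (norm_nonneg _), norm_sq_eq_coord, norm_sq_eq_coord,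
    rot_zero_apply, rot_one_apply, neg_sq, add_comm]

theorem inner_rot_left (v w : Plane) : inner ℝ (rot v) w = cross v w := by
  rw [inner_eq_coord, rot_zero_apply, rot_one_apply, cross]; ring

theorem inner_self_rot (v : Plane) : inner ℝ v (rot v) = 0 := by
  rw [inner_eq_coord, rot_zero_apply, rot_one_apply]; ring

theorem smul_eq_inner_smul_add_cross_smul_rot (v w : Plane) :
    ‖v‖ ^ 2 • w = inner ℝ v w • v + cross v w • rot v := by
  apply plane_ext <;>
    simp only [PiLp.smul_apply, PiLp.add_apply, smul_eq_mul, rot_zero_apply, rot_one_apply,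
      norm_sq_eq_coord, inner_eq_coord, cross] <;> ring

theorem smul_rot_of_inner_eq_zero {v w : Plane} (h : inner ℝ v w = 0) :
    ‖v‖ ^ 2 • w = cross v w • rot v := by
  rw [smul_eq_inner_smul_add_cross_smul_rot, h, zero_smul, zero_add]

theorem eq_inner_smul_of_inner_eq_zero {v w n : Plane} (hv : v ≠ 0) (hn : ‖n‖ = 1)
    (hvn : inner ℝ v n = 0) (hvw : inner ℝ v w = 0) : w = inner ℝ w n • n := by
  have hv2 : ‖v‖ ^ 2 ≠ 0 := pow_ne_zero 2 (norm_ne_zero_iff.2 hv)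
  have hrn := smul_rot_of_inner_eq_zero hvn
  have hcn : cross v n ≠ 0 := fun h0 => by
    rw [h0, zero_smul, smul_eq_zero_iff_right hv2] at hrn
    exact zero_ne_one ((norm_zero (E := Plane)).symm.trans (hrn ▸ hn))
  obtain ⟨d, hd⟩ : ∃ d : ℝ, w = d • n := ⟨cross v w / cross v n, smul_right_injective _ hv2 <| by
    simp only
    rw [smul_comm _ _ n, hrn, smul_smul, div_mul_cancel₀ _ hcn, smul_rot_of_inner_eq_zero hvw]⟩
  rw [hd, real_inner_smul_left, real_inner_self_eq_norm_sq, hn, one_pow, mul_one]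

theorem continuous_cross : Continuous fun p : Plane × Plane => cross p.1 p.2 := by
  unfold cross; fun_prop

theorem hasDerivAt_rot {v : ℝ → Plane} {w : Plane} {t : ℝ} (h : HasDerivAt v w t) :
    HasDerivAt (fun s => rot (v s)) (rot w) t := by
  have hlin : IsLinearMap ℝ rot :=
    ⟨fun x y => plane_ext (by simp; ring) (by simp),
      fun c x => plane_ext (by simp) (by simp)⟩
  exact (hlin.mk' rot).toContinuousLinearMap.hasFDerivAt.comp_hasDerivAt t h

theorem hasDerivAt_inv_norm_smul_rot {v : ℝ → Plane} {w : Plane} {t : ℝ} (h : HasDerivAt v w t)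
    (hv : v t ≠ 0) :
    HasDerivAt (fun s => ‖v s‖⁻¹ • rot (v s)) (-(cross (v t) w / ‖v t‖ ^ 3) • v t) t := by
  have hn : ‖v t‖ ≠ 0 := norm_ne_zero_iff.2 hv
  have hsq := norm_sq_eq_coord (v t)
  have hnorm : HasDerivAt (fun s => ‖v s‖) (inner ℝ (v t) w / ‖v t‖) t := by
    have hsqrt := h.norm_sq.sqrt (pow_ne_zero 2 hn)
    simp only [Real.sqrt_sq (norm_nonneg _)] at hsqrt
    exact hsqrt.congr_deriv (mul_div_mul_left _ _ two_ne_zero)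
  refine ((hnorm.inv hn).smul (hasDerivAt_rot h)).congr_deriv (plane_ext ?_ ?_) <;>
    simp only [Pi.inv_apply, PiLp.smul_apply, PiLp.add_apply, smul_eq_mul, rot_zero_apply,
      rot_one_apply, inner_eq_coord, cross] <;>
    field_simp <;> rw [hsq] <;> ring

end Plane

section Arc

variable {γ : ℝ → Plane} {t : ℝ}

theorem curvature_nonneg (γ : ℝ → Plane) (t : ℝ) : 0 ≤ curvature γ t :=
  div_nonneg (abs_nonneg _) (pow_nonneg (norm_nonneg _) 3)

theorem curvature_pos_of_ne_zero (h : curvature γ t ≠ 0) : 0 < curvature γ t :=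
  (curvature_nonneg γ t).lt_of_ne' h

theorem cross_ne_zero_of_curvature_ne_zero (h : curvature γ t ≠ 0) :
    cross (deriv γ t) (deriv (deriv γ) t) ≠ 0 := fun h0 => h (by simp [curvature, h0])

/-- The unit normal of the curve that points to the centre of the osculating circle; it is zero
where the curvature vanishes. -/
noncomputable def unitNormal (γ : ℝ → Plane) (t : ℝ) : Plane :=
  (SignType.sign (cross (deriv γ t) (deriv (deriv γ) t)) : ℝ) • ‖deriv γ t‖⁻¹ • rot (deriv γ t)

theorem inner_deriv_unitNormal (γ : ℝ → Plane) (t : ℝ) :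
    inner ℝ (deriv γ t) (unitNormal γ t) = 0 := by
  rw [unitNormal, inner_smul_right, inner_smul_right, inner_self_rot, mul_zero, mul_zero]

namespace IsC2OpenArc

theorem hasDerivAt (hγ : IsC2OpenArc γ) (ht : t ∈ Ioo (0 : ℝ) 1) :
    HasDerivAt γ (deriv γ t) t :=
  ((hγ.contDiffOn.contDiffAt (isOpen_Ioo.mem_nhds ht)).differentiableAt two_ne_zero).hasDerivAt

theorem contDiffOn_deriv (hγ : IsC2OpenArc γ) : ContDiffOn ℝ 1 (deriv γ) (Ioo 0 1) :=
  hγ.contDiffOn.deriv_of_isOpen isOpen_Ioo (by norm_num)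

theorem hasDerivAt_deriv (hγ : IsC2OpenArc γ) (ht : t ∈ Ioo (0 : ℝ) 1) :
    HasDerivAt (deriv γ) (deriv (deriv γ) t) t :=
  ((hγ.contDiffOn_deriv.contDiffAt (isOpen_Ioo.mem_nhds ht)).differentiableAt
    one_ne_zero).hasDerivAt

theorem continuousAt_deriv2 (hγ : IsC2OpenArc γ) (ht : t ∈ Ioo (0 : ℝ) 1) :
    ContinuousAt (deriv (deriv γ)) t :=
  (hγ.contDiffOn_deriv.continuousOn_deriv_of_isOpen isOpen_Ioo le_rfl).continuousAt
    (isOpen_Ioo.mem_nhds ht)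

theorem continuousAt_cross (hγ : IsC2OpenArc γ) (ht : t ∈ Ioo (0 : ℝ) 1) :
    ContinuousAt (fun t => cross (deriv γ t) (deriv (deriv γ) t)) t :=
  continuous_cross.continuousAt.comp
    ((hγ.hasDerivAt_deriv ht).continuousAt.prodMk (hγ.continuousAt_deriv2 ht))

theorem norm_deriv_pos (hγ : IsC2OpenArc γ) (ht : t ∈ Ioo (0 : ℝ) 1) : 0 < ‖deriv γ t‖ :=
  norm_pos_iff.2 (hγ.deriv_ne_zero t ht)

theorem continuousAt_curvature (hγ : IsC2OpenArc γ) (ht : t ∈ Ioo (0 : ℝ) 1) :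
    ContinuousAt (curvature γ) t :=
  (hγ.continuousAt_cross ht).abs.div ((hγ.hasDerivAt_deriv ht).continuousAt.norm.pow 3)
    (pow_ne_zero 3 (hγ.norm_deriv_pos ht).ne')

theorem norm_unitNormal (hγ : IsC2OpenArc γ) (ht : t ∈ Ioo (0 : ℝ) 1)
    (hk : curvature γ t ≠ 0) : ‖unitNormal γ t‖ = 1 := by
  rw [unitNormal, norm_smul, norm_smul, norm_rot, norm_inv, norm_norm,
    inv_mul_cancel₀ (hγ.norm_deriv_pos ht).ne', mul_one]
  rcases lt_or_gt_of_ne (cross_ne_zero_of_curvature_ne_zero hk) with h | h <;> simp [h]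

theorem inner_unitNormal_deriv2 (hγ : IsC2OpenArc γ) (ht : t ∈ Ioo (0 : ℝ) 1) :
    inner ℝ (unitNormal γ t) (deriv (deriv γ) t) = curvature γ t * ‖deriv γ t‖ ^ 2 := by
  have hv := (hγ.norm_deriv_pos ht).ne'
  rw [unitNormal, real_inner_smul_left, real_inner_smul_left, inner_rot_left, mul_left_comm,
    sign_mul_self, curvature]
  field_simp

theorem evolute_eq (hγ : IsC2OpenArc γ) (ht : t ∈ Ioo (0 : ℝ) 1) (hk : curvature γ t ≠ 0) :
    evolute γ t = γ t + (curvature γ t)⁻¹ • unitNormal γ t := by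
  have hc := cross_ne_zero_of_curvature_ne_zero hk
  have hv := (hγ.norm_deriv_pos ht).ne'
  rw [evolute, unitNormal, smul_smul, smul_smul, curvature, ← sign_mul_self]
  congr 2
  rcases lt_or_gt_of_ne hc with h | h <;>
    simp only [sign_neg, sign_pos, h, SignType.coe_neg_one, SignType.coe_one] <;> field_simp

theorem dist_evolute (hγ : IsC2OpenArc γ) (ht : t ∈ Ioo (0 : ℝ) 1) (hk : curvature γ t ≠ 0) :
    dist (evolute γ t) (γ t) = (curvature γ t)⁻¹ := by
  rw [hγ.evolute_eq ht hk, dist_eq_norm, add_sub_cancel_left, norm_smul, hγ.norm_unitNormal ht hk,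
    mul_one, Real.norm_of_nonneg (inv_nonneg.2 (curvature_nonneg γ t))]

theorem hasDerivAt_unitNormal (hγ : IsC2OpenArc γ) (ht : t ∈ Ioo (0 : ℝ) 1)
    (hk : curvature γ t ≠ 0) :
    HasDerivAt (unitNormal γ) (-(curvature γ t) • deriv γ t) t := by
  have hc := cross_ne_zero_of_curvature_ne_zero hk
  have hsign : ∀ᶠ s in 𝓝 t, SignType.sign (cross (deriv γ s) (deriv (deriv γ) s)) =
      SignType.sign (cross (deriv γ t) (deriv (deriv γ) t)) :=
    (hγ.continuousAt_cross ht).tendsto.eventually <|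
      (continuousAt_sign_of_ne_zero hc).tendsto.eventually_mem ((isOpen_discrete {_}).mem_nhds rfl)
  have hnormal := (hasDerivAt_inv_norm_smul_rot (hγ.hasDerivAt_deriv ht)
    (hγ.deriv_ne_zero t ht)).const_smul
      (SignType.sign (cross (deriv γ t) (deriv (deriv γ) t)) : ℝ)
  refine (hnormal.congr_of_eventuallyEq (hsign.mono fun s hs => ?_)).congr_deriv ?_
  · rw [unitNormal, hs, Pi.smul_apply]
  · rw [smul_smul, mul_neg, ← mul_div_assoc, sign_mul_self, curvature]

theorem isFramedOn (hγ : IsC2OpenArc γ) {a b : ℝ} (ha : 0 < a) (hb : b < 1)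
    (hk : ∀ t ∈ Icc a b, curvature γ t ≠ 0) :
    IsFramedOn γ (deriv γ) (unitNormal γ) (curvature γ) a b := by
  have hs : ∀ t ∈ Icc a b, t ∈ Ioo (0 : ℝ) 1 := fun t ht =>
    ⟨ha.trans_le ht.1, ht.2.trans_lt hb⟩
  exact ⟨fun t ht => hγ.hasDerivAt (hs t ht),
    fun t ht => hγ.hasDerivAt_unitNormal (hs t ht) (hk t ht),
    fun t ht => hγ.norm_unitNormal (hs t ht) (hk t ht),
    fun t ht => curvature_pos_of_ne_zero (hk t ht),
    fun t ht => hγ.deriv_ne_zero t (hs t ht),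
    fun t ht => (hγ.hasDerivAt_deriv (hs t ht)).continuousAt.continuousWithinAt⟩

theorem focal_eq_evolute (hγ : IsC2OpenArc γ) (ht : t ∈ Ioo (0 : ℝ) 1) (hk : curvature γ t ≠ 0) :
    focal γ (unitNormal γ) (curvature γ) t = evolute γ t := (hγ.evolute_eq ht hk).symm

end IsC2OpenArc

end Arc

section StrictMin

theorem lt_of_strictConvexOn_of_hasDerivAt_zero {g : ℝ → ℝ} {s : Set ℝ} {x t : ℝ}
    (hg : StrictConvexOn ℝ s g) (hx : x ∈ s) (h0 : HasDerivAt g 0 x) (ht : t ∈ s) (htx : t ≠ x) :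
    g x < g t := by
  rcases htx.lt_or_gt with hlt | hlt
  · have hslope := hg.slope_lt_of_hasDerivAt ht hx hlt h0
    rwa [slope_def_field, div_lt_iff₀ (sub_pos.2 hlt), zero_mul, sub_neg] at hslope
  · have hslope := hg.lt_slope_of_hasDerivAt hx ht hlt h0
    rwa [slope_def_field, div_pos_iff_of_pos_right (sub_pos.2 hlt), sub_pos] at hslope

theorem strictConvexOn_of_hasDerivAt2_pos {g g' g'' : ℝ → ℝ} {s : Set ℝ} (hs : Convex ℝ s)
    (hg : ∀ t ∈ s, HasDerivAt g (g' t) t) (hg' : ∀ t ∈ s, HasDerivAt g' (g'' t) t)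
    (hpos : ∀ t ∈ s, 0 < g'' t) : StrictConvexOn ℝ s g := by
  have hmono : StrictMonoOn g' s :=
    strictMonoOn_of_deriv_pos hs (fun t ht => (hg' t ht).continuousAt.continuousWithinAt)
      fun t ht => (hg' t (interior_subset ht)).deriv ▸ hpos t (interior_subset ht)
  refine StrictMonoOn.strictConvexOn_of_deriv hs
    (fun t ht => (hg t ht).continuousAt.continuousWithinAt) ?_
  exact (hmono.mono interior_subset).congr fun t ht => (hg t (interior_subset ht)).deriv.symm

theorem lt_of_hasDerivAt2_pos {g g' g'' : ℝ → ℝ} {s : Set ℝ} {x t : ℝ} (hs : Convex ℝ s)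
    (hg : ∀ t ∈ s, HasDerivAt g (g' t) t) (hg' : ∀ t ∈ s, HasDerivAt g' (g'' t) t)
    (hpos : ∀ t ∈ s, 0 < g'' t) (hx : x ∈ s) (h0 : g' x = 0) (ht : t ∈ s) (htx : t ≠ x) :
    g x < g t :=
  lt_of_strictConvexOn_of_hasDerivAt_zero (strictConvexOn_of_hasDerivAt2_pos hs hg hg' hpos) hx
    (h0 ▸ hg x hx) ht htx

theorem exists_Icc_subset_of_eventually {P : ℝ → Prop} {t : ℝ} (h : ∀ᶠ s in 𝓝 t, P s) :
    ∃ η > 0, ∀ s ∈ Icc (t - η) (t + η), P s := by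
  obtain ⟨η, hη, hP⟩ := Metric.nhds_basis_closedBall.eventually_iff.1 h
  exact ⟨η, hη, fun s hs => hP (by rwa [Real.closedBall_eq_Icc])⟩

end StrictMin

section SquaredDistance

variable {γ : ℝ → Plane} {z : Plane} {t : ℝ}

/-- Half of the second derivative of the squared distance of `γ t` to `z`. -/
noncomputable def secondForm (γ : ℝ → Plane) (z : Plane) (t : ℝ) : ℝ :=
  ‖deriv γ t‖ ^ 2 + inner ℝ (γ t - z) (deriv (deriv γ) t)

theorem dist_lt_dist_iff_sq {z x y : Plane} :
    dist z x < dist z y ↔ ‖x - z‖ ^ 2 < ‖y - z‖ ^ 2 := by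
  rw [dist_comm z x, dist_comm z y, dist_eq_norm, dist_eq_norm,
    sq_lt_sq₀ (norm_nonneg _) (norm_nonneg _)]

theorem inner_normal_sub_deriv (γ : ℝ → Plane) (t d : ℝ) :
    inner ℝ (γ t - (γ t + d • unitNormal γ t)) (deriv γ t) = 0 := by
  rw [sub_add_cancel_left, inner_neg_left, real_inner_smul_left, real_inner_comm,
    inner_deriv_unitNormal, mul_zero, neg_zero]

namespace IsC2OpenArc

theorem hasDerivAt_sqDist (hγ : IsC2OpenArc γ) (z : Plane) (ht : t ∈ Ioo (0 : ℝ) 1) :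
    HasDerivAt (fun t => ‖γ t - z‖ ^ 2) (2 * inner ℝ (γ t - z) (deriv γ t)) t :=
  ((hγ.hasDerivAt ht).sub_const z).norm_sq

theorem hasDerivAt_deriv_sqDist (hγ : IsC2OpenArc γ) (z : Plane) (ht : t ∈ Ioo (0 : ℝ) 1) :
    HasDerivAt (fun t => 2 * inner ℝ (γ t - z) (deriv γ t)) (2 * secondForm γ z t) t := by
  refine ((((hγ.hasDerivAt ht).sub_const z).inner ℝ (hγ.hasDerivAt_deriv ht)).const_mul
    2).congr_deriv ?_
  rw [secondForm, real_inner_self_eq_norm_sq, add_comm]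

theorem continuousAt_secondForm (hγ : IsC2OpenArc γ) (z : Plane) (ht : t ∈ Ioo (0 : ℝ) 1) :
    ContinuousAt (fun p : Plane × ℝ => secondForm γ p.1 p.2) (z, t) := by
  have comp_snd : ∀ f : ℝ → Plane, ContinuousAt f t →
      ContinuousAt (fun p : Plane × ℝ => f p.2) (z, t) := fun f hf =>
    ContinuousAt.comp (g := f) (f := Prod.snd) hf continuousAt_snd
  exact ((comp_snd _ (hγ.hasDerivAt_deriv ht).continuousAt).norm.pow 2).add
    (((comp_snd _ (hγ.hasDerivAt ht).continuousAt).sub continuousAt_fst).inner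
      (comp_snd _ (hγ.continuousAt_deriv2 ht)))

theorem exists_strict_min (hγ : IsC2OpenArc γ) {c : Plane} (ht : t ∈ Ioo (0 : ℝ) 1)
    (h : 0 < secondForm γ c t) :
    ∃ η > 0, Icc (t - η) (t + η) ⊆ Ioo 0 1 ∧ ∀ᶠ z in 𝓝 c, inner ℝ (γ t - z) (deriv γ t) = 0 →
      ∀ s ∈ Icc (t - η) (t + η), s ≠ t → dist z (γ t) < dist z (γ s) := by
  have hpos := (hγ.continuousAt_secondForm c ht).eventually (Ioi_mem_nhds h)
  rw [nhds_prod_eq, eventually_prod_iff] at hpos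
  obtain ⟨P, hP, Q, hQ, hPQ⟩ := hpos
  obtain ⟨η, hη, hs⟩ := exists_Icc_subset_of_eventually (hQ.and (isOpen_Ioo.mem_nhds ht))
  refine ⟨η, hη, fun s hs' => (hs s hs').2, hP.mono fun z hz hcrit s hs' hst => ?_⟩
  exact dist_lt_dist_iff_sq.2 <| lt_of_hasDerivAt2_pos (convex_Icc _ _)
    (fun s hs' => hγ.hasDerivAt_sqDist z (hs s hs').2)
    (fun s hs' => hγ.hasDerivAt_deriv_sqDist z (hs s hs').2)
    (fun s hs' => mul_pos two_pos (hPQ hz (hs s hs').1))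
    ⟨by linarith, by linarith⟩ (by rw [hcrit, mul_zero]) hs' hst

theorem eventually_dist_lt (hγ : IsC2OpenArc γ) (ht : t ∈ Ioo (0 : ℝ) 1)
    (h : secondForm γ z t < 0) (hcrit : inner ℝ (γ t - z) (deriv γ t) = 0) :
    ∀ᶠ s in 𝓝 t, s ≠ t → dist z (γ s) < dist z (γ t) := by
  have hneg : ∀ᶠ s in 𝓝 t, secondForm γ z s < 0 :=
    (ContinuousAt.comp (f := fun s : ℝ => (z, s)) (hγ.continuousAt_secondForm z ht)
      (by fun_prop)).eventually (Iio_mem_nhds h)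
  obtain ⟨η, hη, hs⟩ := exists_Icc_subset_of_eventually (hneg.and (isOpen_Ioo.mem_nhds ht))
  filter_upwards [Icc_mem_nhds (sub_lt_self t hη) (lt_add_of_pos_right t hη)] with s hs' hst
  refine dist_lt_dist_iff_sq.2 <| neg_lt_neg_iff.1 <| lt_of_hasDerivAt2_pos
    (g := -fun s => ‖γ s - z‖ ^ 2) (convex_Icc _ _)
    (fun s hs' => (hγ.hasDerivAt_sqDist z (hs s hs').2).neg)
    (fun s hs' => (hγ.hasDerivAt_deriv_sqDist z (hs s hs').2).neg)
    (fun s hs' => ?_) ⟨by linarith, by linarith⟩ (by simp [hcrit]) hs' hst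
  linarith [(hs s hs').1]

theorem inner_eq_zero_of_isLocalExtr (hγ : IsC2OpenArc γ) (ht : t ∈ Ioo (0 : ℝ) 1)
    (h : IsLocalExtr (fun s => dist z (γ s)) t) : inner ℝ (γ t - z) (deriv γ t) = 0 := by
  have hsq : IsLocalExtr (fun t => ‖γ t - z‖ ^ 2) t := by
    simp only [← dist_eq_norm, dist_comm (γ _) z]
    refine h.imp (fun hmin => ?_) fun hmax => ?_
    · filter_upwards [hmin] with s hs
      gcongr
    · filter_upwards [hmax] with s hs
      gcongr
  exact (mul_eq_zero.1 (hsq.hasDerivAt_eq_zero (hγ.hasDerivAt_sqDist z ht))).resolve_left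
    two_ne_zero

theorem secondForm_nonpos_of_isLocalMax (hγ : IsC2OpenArc γ) (ht : t ∈ Ioo (0 : ℝ) 1)
    (h : IsLocalMax (fun s => dist z (γ s)) t) : secondForm γ z t ≤ 0 := by
  by_contra! hpos
  obtain ⟨η, hη, -, hmin⟩ := hγ.exists_strict_min ht hpos
  have hlt := hmin.self_of_nhds (hγ.inner_eq_zero_of_isLocalExtr ht (Or.inr h))
  obtain ⟨s, ⟨hs, hsη⟩, hst⟩ := ((eventually_nhdsWithin_of_eventually_nhds (h.and
    (Icc_mem_nhds (sub_lt_self t hη) (lt_add_of_pos_right t hη)))).and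
      self_mem_nhdsWithin : ∀ᶠ s in 𝓝[≠] t, _).exists
  exact (hlt s hsη hst).not_ge hs

theorem secondForm_nonneg_of_isLocalMin (hγ : IsC2OpenArc γ) (ht : t ∈ Ioo (0 : ℝ) 1)
    (h : IsLocalMin (fun s => dist z (γ s)) t) : 0 ≤ secondForm γ z t := by
  by_contra! hneg
  have hlt := hγ.eventually_dist_lt ht hneg (hγ.inner_eq_zero_of_isLocalExtr ht (Or.inl h))
  obtain ⟨s, ⟨hs, hslt⟩, hst⟩ := ((eventually_nhdsWithin_of_eventually_nhds (h.and hlt)).and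
    self_mem_nhdsWithin : ∀ᶠ s in 𝓝[≠] t, _).exists
  exact (hslt hst).not_ge hs

theorem smul_unitNormal_of_inner_eq_zero (hγ : IsC2OpenArc γ) (ht : t ∈ Ioo (0 : ℝ) 1)
    (hk : curvature γ t ≠ 0) (hcrit : inner ℝ (γ t - z) (deriv γ t) = 0) :
    z = γ t + inner ℝ (z - γ t) (unitNormal γ t) • unitNormal γ t := by
  rw [← eq_inner_smul_of_inner_eq_zero (hγ.deriv_ne_zero t ht) (hγ.norm_unitNormal ht hk)
    (inner_deriv_unitNormal γ t), add_sub_cancel]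
  rw [real_inner_comm, ← neg_sub, inner_neg_left, hcrit, neg_zero]

theorem secondForm_normal (hγ : IsC2OpenArc γ) (ht : t ∈ Ioo (0 : ℝ) 1) (d : ℝ) :
    secondForm γ (γ t + d • unitNormal γ t) t = ‖deriv γ t‖ ^ 2 * (1 - d * curvature γ t) := by
  rw [secondForm, sub_add_cancel_left, inner_neg_left, real_inner_smul_left,
    hγ.inner_unitNormal_deriv2 ht]
  ring

theorem curvature_ne_zero_of_secondForm_nonpos (hγ : IsC2OpenArc γ) (ht : t ∈ Ioo (0 : ℝ) 1)
    (hcrit : inner ℝ (γ t - z) (deriv γ t) = 0) (h : secondForm γ z t ≤ 0) :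
    curvature γ t ≠ 0 := by
  intro hk
  have hv := hγ.norm_deriv_pos ht
  have hcross : cross (deriv γ t) (deriv (deriv γ) t) = 0 := by
    rw [curvature, div_eq_zero_iff, abs_eq_zero] at hk
    exact hk.resolve_right (pow_pos hv 3).ne'
  have hparallel : ‖deriv γ t‖ ^ 2 * inner ℝ (γ t - z) (deriv (deriv γ) t) = 0 := by
    rw [← real_inner_smul_right, smul_eq_inner_smul_add_cross_smul_rot, hcross, zero_smul,
      add_zero, real_inner_smul_right, hcrit, mul_zero]
  rw [secondForm, (mul_eq_zero.1 hparallel).resolve_left (pow_pos hv 2).ne', add_zero] at h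
  exact h.not_gt (pow_pos hv 2)

theorem exists_normal_of_isLocalMax (hγ : IsC2OpenArc γ) (ht : t ∈ Ioo (0 : ℝ) 1)
    (h : IsLocalMax (fun s => dist z (γ s)) t) :
    curvature γ t ≠ 0 ∧ ∃ d, (curvature γ t)⁻¹ ≤ d ∧ z = γ t + d • unitNormal γ t := by
  have hcrit := hγ.inner_eq_zero_of_isLocalExtr ht (Or.inr h)
  have hform := hγ.secondForm_nonpos_of_isLocalMax ht h
  have hk := hγ.curvature_ne_zero_of_secondForm_nonpos ht hcrit hform
  have hz := hγ.smul_unitNormal_of_inner_eq_zero ht hk hcrit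
  refine ⟨hk, _, ?_, hz⟩
  rw [hz, hγ.secondForm_normal ht] at hform
  rw [inv_le_iff_one_le_mul₀ (curvature_pos_of_ne_zero hk)]
  linarith [nonpos_of_mul_nonpos_right hform (pow_pos (hγ.norm_deriv_pos ht) 2)]

theorem eq_evolute_of_secondForm_eq_zero (hγ : IsC2OpenArc γ) (ht : t ∈ Ioo (0 : ℝ) 1)
    (hcrit : inner ℝ (γ t - z) (deriv γ t) = 0) (h : secondForm γ z t = 0) :
    curvature γ t ≠ 0 ∧ z = evolute γ t := by
  have hk := hγ.curvature_ne_zero_of_secondForm_nonpos ht hcrit h.le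
  have hz := hγ.smul_unitNormal_of_inner_eq_zero ht hk hcrit
  refine ⟨hk, ?_⟩
  rw [hz, hγ.secondForm_normal ht] at h
  have hd := (mul_eq_zero.1 h).resolve_left (pow_pos (hγ.norm_deriv_pos ht) 2).ne'
  rw [hz, hγ.evolute_eq ht hk, eq_inv_of_mul_eq_one_left (sub_eq_zero.1 hd).symm]

theorem dist_normal (hγ : IsC2OpenArc γ) (ht : t ∈ Ioo (0 : ℝ) 1) (hk : curvature γ t ≠ 0)
    (d : ℝ) : dist (γ t + d • unitNormal γ t) (γ t) = |d| := by
  rw [dist_eq_norm, add_sub_cancel_left, norm_smul, hγ.norm_unitNormal ht hk, mul_one,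
    Real.norm_eq_abs]

theorem sbtw_iff (hγ : IsC2OpenArc γ) (ht : t ∈ Ioo (0 : ℝ) 1) (hk : curvature γ t ≠ 0) :
    Sbtw ℝ (γ t) (evolute γ t) z ↔
      ∃ d, (curvature γ t)⁻¹ < d ∧ z = γ t + d • unitNormal γ t := by
  have hk' := inv_pos.2 (curvature_pos_of_ne_zero hk)
  have hne : γ t ≠ evolute γ t := (dist_pos.1 (hγ.dist_evolute ht hk ▸ hk')).symm
  have hline : ∀ c : ℝ, AffineMap.lineMap (γ t) (evolute γ t) c =
      γ t + (c * (curvature γ t)⁻¹) • unitNormal γ t := fun c => by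
    rw [AffineMap.lineMap_apply, hγ.evolute_eq ht hk, vsub_eq_sub, vadd_eq_add,
      add_sub_cancel_left, smul_smul, add_comm]
  rw [sbtw_iff_left_ne_and_right_mem_image_Ioi]
  constructor
  · rintro ⟨-, c, hc, rfl⟩
    exact ⟨_, lt_mul_of_one_lt_left hk' hc, hline c⟩
  · rintro ⟨d, hd, rfl⟩
    refine ⟨hne, d * curvature γ t, (inv_lt_iff_one_lt_mul₀ (inv_pos.1 hk')).1 hd, ?_⟩
    rw [hline, mul_inv_cancel_right₀ hk]

theorem exists_dist_ne (hγ : IsC2OpenArc γ) (hconst : NoConstantCurvatureArc γ) {a b : ℝ}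
    (ha : 0 ≤ a) (hab : a < b) (hb : b ≤ 1) (c : Plane) (R : ℝ) :
    ∃ t ∈ Ioo a b, dist c (γ t) ≠ R := by
  by_contra! hall
  refine hconst (a + (b - a) / 3) (a + 2 * (b - a) / 3) (by linarith) (by linarith) (by linarith)
    ⟨R⁻¹, fun t ht => ?_⟩
  have htab : t ∈ Ioo a b := ⟨by linarith [ht.1], by linarith [ht.2]⟩
  have ht' : t ∈ Ioo (0 : ℝ) 1 := ⟨ha.trans_lt htab.1, htab.2.trans_le hb⟩
  have heq : ∀ᶠ s in 𝓝 t, dist c (γ s) = dist c (γ t) := by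
    filter_upwards [isOpen_Ioo.mem_nhds htab] with s hs
    rw [hall s hs, hall t htab]
  have hmax : IsLocalMax (fun s => dist c (γ s)) t := heq.mono fun _ => Eq.le
  have hmin : IsLocalMin (fun s => dist c (γ s)) t := heq.mono fun _ => Eq.ge
  obtain ⟨hk, hc⟩ := hγ.eq_evolute_of_secondForm_eq_zero ht'
    (hγ.inner_eq_zero_of_isLocalExtr ht' (Or.inr hmax))
    ((hγ.secondForm_nonpos_of_isLocalMax ht' hmax).antisymm
      (hγ.secondForm_nonneg_of_isLocalMin ht' hmin))
  rw [← hall t htab, hc, hγ.dist_evolute ht' hk, inv_inv]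

end IsC2OpenArc

end SquaredDistance

section StrictQuasiconvex

variable {α β : Type*} [LinearOrder α] [LinearOrder β] {k : α → β} {s : Set α}

/-- `k` is strictly quasiconvex on `s`: its value at a point between two points of `s` is smaller
than one of their values. No linear structure is needed on a linear order, where these functions
are the ones that first decrease and then increase. -/
def StrictQuasiconvexOn (k : α → β) (s : Set α) : Prop :=
  ∀ x ∈ s, ∀ z ∈ s, ∀ y, x < y → y < z → k y < max (k x) (k z)

namespace StrictQuasiconvexOn

theorem mono (h : StrictQuasiconvexOn k s) {t : Set α} (hts : t ⊆ s) : StrictQuasiconvexOn k t :=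
  fun x hx z hz => h x (hts hx) z (hts hz)

theorem dual (h : StrictQuasiconvexOn k s) :
    StrictQuasiconvexOn (k ∘ OrderDual.ofDual) (OrderDual.ofDual ⁻¹' s) :=
  fun _ hx _ hz _ hxy hyz => by
    rw [max_comm]
    exact h _ hz _ hx _ (OrderDual.ofDual_lt_ofDual.2 hyz) (OrderDual.ofDual_lt_ofDual.2 hxy)

theorem strictMonoOn_inter_Ici (h : StrictQuasiconvexOn k s) {y z : α} (hy : y ∈ s) (hz : z ∈ s)
    (hyz : y < z) (hle : k y ≤ k z) : StrictMonoOn k (s ∩ Ici z) := by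
  have hlt : ∀ w ∈ s, z < w → k z < k w := fun w hw hzw =>
    (lt_max_iff.1 (h y hy w hw z hyz hzw)).resolve_left hle.not_gt
  rintro u ⟨-, hzu⟩ v ⟨hv, -⟩ huv
  rcases eq_or_lt_of_le hzu with rfl | hzu
  · exact hlt v hv huv
  · rcases lt_max_iff.1 (h z hz v hv u hzu huv) with hlt' | hlt'
    · exact hlt'.trans (hlt v hv (hzu.trans huv))
    · exact hlt'

theorem strictAntiOn_or_exists_strictMonoOn (h : StrictQuasiconvexOn k s) :
    StrictAntiOn k s ∨ ∃ y ∈ s, ∃ z ∈ s, y < z ∧ StrictMonoOn k (s ∩ Ici z) := by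
  by_contra! hcon
  exact hcon.1 fun y hy z hz hyz => not_le.1 fun hle =>
    hcon.2 y hy z hz hyz (h.strictMonoOn_inter_Ici hy hz hyz hle)

theorem strictMonoOn_or_exists_strictAntiOn (h : StrictQuasiconvexOn k s) :
    StrictMonoOn k s ∨ ∃ y ∈ s, ∃ z ∈ s, z < y ∧ StrictAntiOn k (s ∩ Iic z) :=
  h.dual.strictAntiOn_or_exists_strictMonoOn.imp StrictAntiOn.dual_left
    fun ⟨y, hy, z, hz, hyz, hmono⟩ => ⟨y, hy, z, hz, hyz, StrictMonoOn.dual_left hmono⟩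

theorem strictMonoOn_inter_Ici_of_isMinOn [DenselyOrdered α] (h : StrictQuasiconvexOn k s)
    (hs : s.OrdConnected) {m : α} (hm : m ∈ s) (hmin : IsMinOn k s m) :
    StrictMonoOn k (s ∩ Ici m) := by
  have hmono : ∀ x ∈ s, ∀ y ∈ s, m < x → x < y → k x < k y := fun x hx y hy hmx hxy =>
    h.strictMonoOn_inter_Ici hm hx hmx (hmin hx) ⟨hx, le_rfl⟩ ⟨hy, hxy.le⟩ hxy
  rintro x ⟨hx, hmx⟩ y ⟨hy, -⟩ hxy
  rcases eq_or_lt_of_le hmx with rfl | hmx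
  · obtain ⟨w, hmw, hwy⟩ := exists_between hxy
    have hw := hs.out hm hy ⟨hmw.le, hwy.le⟩
    exact (hmin hw).trans_lt (hmono w hw y hy hmw hwy)
  · exact hmono x hx y hy hmx hxy

theorem strictAntiOn_inter_Iic_of_isMinOn [DenselyOrdered α] (h : StrictQuasiconvexOn k s)
    (hs : s.OrdConnected) {m : α} (hm : m ∈ s) (hmin : IsMinOn k s m) :
    StrictAntiOn k (s ∩ Iic m) :=
  StrictMonoOn.dual_left (h.dual.strictMonoOn_inter_Ici_of_isMinOn hs.dual hm hmin)

end StrictQuasiconvexOn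

variable [TopologicalSpace α]

theorem StrictQuasiconvexOn.strictMonoOn_inter_Ici_of_frequently_lt [OrderTopology α]
    (h : StrictQuasiconvexOn k s) (hs : s.OrdConnected) {t : α} (ht : t ∈ s)
    (hf : ∃ᶠ r in 𝓝[>] t, k t < k r) : StrictMonoOn k (s ∩ Ici t) := by
  have hex : ∀ x, t < x → ∃ r ∈ Ioo t x, k t < k r := fun x hx =>
    (hf.and_eventually (Ioo_mem_nhdsGT hx)).exists.imp fun _ hr => ⟨hr.2, hr.1⟩
  rintro x ⟨hx, htx⟩ y ⟨hy, -⟩ hxy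
  rcases eq_or_lt_of_le htx with rfl | htx
  · obtain ⟨r, hr, htr⟩ := hex y hxy
    have hrs := hs.out ht hy (Ioo_subset_Icc_self hr)
    exact htr.trans
      (h.strictMonoOn_inter_Ici ht hrs hr.1 htr.le ⟨hrs, le_rfl⟩ ⟨hy, hr.2.le⟩ hr.2)
  · obtain ⟨r, hr, htr⟩ := hex x htx
    have hrs := hs.out ht hx (Ioo_subset_Icc_self hr)
    exact h.strictMonoOn_inter_Ici ht hrs hr.1 htr.le ⟨hx, hr.2.le⟩ ⟨hy, (hr.2.trans hxy).le⟩ hxy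

theorem StrictQuasiconvexOn.strictAntiOn_inter_Iic_of_frequently_lt [OrderTopology α]
    (h : StrictQuasiconvexOn k s) (hs : s.OrdConnected) {t : α} (ht : t ∈ s)
    (hf : ∃ᶠ r in 𝓝[<] t, k t < k r) : StrictAntiOn k (s ∩ Iic t) :=
  StrictMonoOn.dual_left (h.dual.strictMonoOn_inter_Ici_of_frequently_lt hs.dual ht hf)

variable [TopologicalSpace β] [OrderClosedTopology β]

theorem strictQuasiconvexOn_of_forall_not_isLocalMax [OrderTopology α] [CompactIccSpace α]
    (hs : s.OrdConnected) (hk : ContinuousOn k s) (hmax : ∀ t ∈ interior s, ¬ IsLocalMax k t) :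
    StrictQuasiconvexOn k s := by
  intro x hx z hz y hxy hyz
  by_contra! hle
  have hsub := hs.out hx hz
  have hinterior : ∀ p ∈ Ioo x z, ¬ IsMaxOn k (Icc x z) p := fun p hp hpmax =>
    hmax p (interior_maximal (Ioo_subset_Icc_self.trans hsub) isOpen_Ioo hp)
      (hpmax.isLocalMax (Icc_mem_nhds hp.1 hp.2))
  obtain ⟨m, hm, hmmax⟩ := isCompact_Icc.exists_isMaxOn ⟨x, left_mem_Icc.2 (hxy.trans hyz).le⟩
    (hk.mono hsub)
  have hmy : k m ≤ k y := by
    rcases eq_endpoints_or_mem_Ioo_of_mem_Icc hm with rfl | rfl | hm'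
    · exact (le_max_left _ _).trans hle
    · exact (le_max_right _ _).trans hle
    · exact absurd hmmax (hinterior m hm')
  exact hinterior y ⟨hxy, hyz⟩ fun t ht => (hmmax ht).trans hmy

theorem StrictQuasiconvexOn.exists_strictAntiOn_Icc [DenselyOrdered α] [CompactIccSpace α]
    {a b : α} (h : StrictQuasiconvexOn k (Icc a b)) (hk : ContinuousOn k (Icc a b))
    (hle : ∃ r ∈ Ioc a b, k r ≤ k a) : ∃ m ∈ Ioc a b, StrictAntiOn k (Icc a m) := by
  obtain ⟨r, hr, hra⟩ := hle
  have ha : a ∈ Icc a b := left_mem_Icc.2 (hr.1.le.trans hr.2)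
  obtain ⟨m, hm, hmin⟩ := isCompact_Icc.exists_isMinOn ⟨a, ha⟩ hk
  have ham : a < m := lt_of_le_of_ne hm.1 <| by
    rintro rfl
    exact (h.strictMonoOn_inter_Ici_of_isMinOn ordConnected_Icc ha hmin ⟨ha, le_rfl⟩
      ⟨Ioc_subset_Icc_self hr, hr.1.le⟩ hr.1).not_ge hra
  exact ⟨m, ⟨ham, hm.2⟩, (h.strictAntiOn_inter_Iic_of_isMinOn ordConnected_Icc hm hmin).mono
    fun x hx => ⟨⟨hx.1, hx.2.trans hm.2⟩, hx.2⟩⟩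

theorem StrictQuasiconvexOn.exists_strictMonoOn_Icc [DenselyOrdered α] [CompactIccSpace α]
    {a b : α} (h : StrictQuasiconvexOn k (Icc a b)) (hk : ContinuousOn k (Icc a b))
    (hle : ∃ r ∈ Ico a b, k r ≤ k b) : ∃ m ∈ Ico a b, StrictMonoOn k (Icc m b) := by
  obtain ⟨r, hr, hrb⟩ := hle
  obtain ⟨m, hm, hanti⟩ := (h.dual.mono (t := Icc (OrderDual.toDual b) (OrderDual.toDual a))
    (by rw [Icc_toDual])).exists_strictAntiOn_Icc (by rw [Icc_toDual]; exact hk)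
    ⟨OrderDual.toDual r, ⟨hr.2, hr.1⟩, hrb⟩
  exact ⟨OrderDual.ofDual m, ⟨hm.2, hm.1⟩,
    (StrictAntiOn.dual_left hanti).mono fun x hx => ⟨hx.2, hx.1⟩⟩

end StrictQuasiconvex

section Curvature

variable {γ : ℝ → Plane} {a b t t₀ : ℝ}

theorem curvature_ne_zero_of_strictAntiOn (h : StrictAntiOn (curvature γ) (Ico a b))
    (ht : t ∈ Ico a b) : curvature γ t ≠ 0 := by
  obtain ⟨s, hts, hsb⟩ := exists_between ht.2
  exact ((curvature_nonneg γ s).trans_lt (h ht ⟨ht.1.trans hts.le, hsb⟩ hts)).ne'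

theorem curvature_ne_zero_of_strictMonoOn (h : StrictMonoOn (curvature γ) (Ioc a b))
    (ht : t ∈ Ioc a b) : curvature γ t ≠ 0 := by
  obtain ⟨s, has, hst⟩ := exists_between ht.1
  exact ((curvature_nonneg γ s).trans_lt (h ⟨has, hst.le.trans ht.2⟩ ht hst)).ne'

theorem eventually_not_isLocalMax_of_forall_eq {k : ℝ → ℝ} (ht : t ∈ Ioo (0 : ℝ) 1)
    (huniq : ∀ s ∈ Ioo (0 : ℝ) 1, IsLocalMax k s → s = t₀) :
    ∀ᶠ s in 𝓝[≠] t, ¬ IsLocalMax k s := by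
  rcases eq_or_ne t t₀ with rfl | hne
  · filter_upwards [nhdsWithin_le_nhds (isOpen_Ioo.mem_nhds ht), self_mem_nhdsWithin]
      with s hs hst hmax using hst (huniq s hs hmax)
  · filter_upwards [nhdsWithin_le_nhds (isOpen_Ioo.mem_nhds ht),
      nhdsWithin_le_nhds (eventually_ne_nhds hne)] with s hs hst hmax using hst (huniq s hs hmax)

namespace IsC2OpenArc

theorem closedBall_evolute_subset_ball_of_strictAntiOn (hγ : IsC2OpenArc γ) (ha : 0 < a)
    (hab : a < b) (hb : b < 1) (h : StrictAntiOn (curvature γ) (Icc a b))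
    (hk : curvature γ b ≠ 0) :
    Metric.closedBall (evolute γ a) (curvature γ a)⁻¹ ⊆
      Metric.ball (evolute γ b) (curvature γ b)⁻¹ := by
  have hne : ∀ t ∈ Icc a b, curvature γ t ≠ 0 := fun t ht => ((curvature_pos_of_ne_zero hk).trans_le
    (h.antitoneOn ht (right_mem_Icc.2 hab.le) ht.2)).ne'
  have hball := (hγ.isFramedOn ha hb hne).closedBall_focal_subset_ball_of_strictAntiOn hab h
  rwa [hγ.focal_eq_evolute ⟨ha, hab.trans hb⟩ (hne a (left_mem_Icc.2 hab.le)),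
    hγ.focal_eq_evolute ⟨ha.trans hab, hb⟩ hk] at hball

theorem closedBall_evolute_subset_ball_of_strictMonoOn (hγ : IsC2OpenArc γ) (ha : 0 < a)
    (hab : a < b) (hb : b < 1) (h : StrictMonoOn (curvature γ) (Icc a b))
    (hk : curvature γ a ≠ 0) :
    Metric.closedBall (evolute γ b) (curvature γ b)⁻¹ ⊆
      Metric.ball (evolute γ a) (curvature γ a)⁻¹ := by
  have hne : ∀ t ∈ Icc a b, curvature γ t ≠ 0 := fun t ht => ((curvature_pos_of_ne_zero hk).trans_le
    (h.monotoneOn (left_mem_Icc.2 hab.le) ht ht.1)).ne'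
  have hball := (hγ.isFramedOn ha hb hne).closedBall_focal_subset_ball_of_strictMonoOn hab h
  rwa [hγ.focal_eq_evolute ⟨ha, hab.trans hb⟩ hk,
    hγ.focal_eq_evolute ⟨ha.trans hab, hb⟩ (hne b (right_mem_Icc.2 hab.le))] at hball

theorem mem_closedBall_evolute (hγ : IsC2OpenArc γ) (ht : t ∈ Ioo (0 : ℝ) 1)
    (hk : curvature γ t ≠ 0) : γ t ∈ Metric.closedBall (evolute γ t) (curvature γ t)⁻¹ := by
  rw [Metric.mem_closedBall, dist_comm, hγ.dist_evolute ht hk]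

theorem notMem_ball_evolute (hγ : IsC2OpenArc γ) (ht : t ∈ Ioo (0 : ℝ) 1)
    (hk : curvature γ t ≠ 0) : γ t ∉ Metric.ball (evolute γ t) (curvature γ t)⁻¹ := by
  rw [Metric.mem_ball, dist_comm, hγ.dist_evolute ht hk]
  exact lt_irrefl _

theorem strictQuasiconvexOn_curvature (hγ : IsC2OpenArc γ) {s : Set ℝ} (hs : s.OrdConnected)
    (hs01 : s ⊆ Ioo 0 1) (hmax : ∀ t ∈ interior s, ¬ IsLocalMax (curvature γ) t) :
    StrictQuasiconvexOn (curvature γ) s :=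
  strictQuasiconvexOn_of_forall_not_isLocalMax hs
    (fun _ ht => (hγ.continuousAt_curvature (hs01 ht)).continuousWithinAt) hmax

theorem eventually_direction_focal_eq_evolute (hγ : IsC2OpenArc γ) (ht : t ∈ Ioo (0 : ℝ) 1)
    (hk : curvature γ t ≠ 0) : ∀ᶠ s in 𝓝 t,
      ‖focal γ (unitNormal γ) (curvature γ) s - focal γ (unitNormal γ) (curvature γ) t‖⁻¹ •
        (focal γ (unitNormal γ) (curvature γ) s - focal γ (unitNormal γ) (curvature γ) t) =
      ‖evolute γ s - evolute γ t‖⁻¹ • (evolute γ s - evolute γ t) := by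
  filter_upwards [isOpen_Ioo.eventually_mem ht, (hγ.continuousAt_curvature ht).eventually_ne hk]
    with s hs hks
  rw [hγ.focal_eq_evolute hs hks, hγ.focal_eq_evolute ht hk]

theorem tendsto_direction_evolute_right (hγ : IsC2OpenArc γ) (ha : 0 < a) (hab : a < b)
    (hb : b ≤ 1) (h : StrictAntiOn (curvature γ) (Ico a b)) :
    Tendsto (fun s => ‖evolute γ s - evolute γ a‖⁻¹ • (evolute γ s - evolute γ a))
      (𝓝[>] a) (𝓝 (unitNormal γ a)) := by
  obtain ⟨c, hac, hcb⟩ := exists_between hab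
  have hsub : Icc a c ⊆ Ico a b := Icc_subset_Ico_right hcb
  have hF := hγ.isFramedOn ha (hcb.trans_le hb) fun t ht =>
    curvature_ne_zero_of_strictAntiOn h (hsub ht)
  exact (hF.tendsto_direction_right hac (h.mono hsub)).congr' <| nhdsWithin_le_nhds <|
    hγ.eventually_direction_focal_eq_evolute ⟨ha, hab.trans_le hb⟩
      (curvature_ne_zero_of_strictAntiOn h (left_mem_Ico.2 hab))

theorem tendsto_direction_evolute_left (hγ : IsC2OpenArc γ) (ha : 0 ≤ a) (hab : a < b)
    (hb : b < 1) (h : StrictMonoOn (curvature γ) (Ioc a b)) :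
    Tendsto (fun s => ‖evolute γ s - evolute γ b‖⁻¹ • (evolute γ s - evolute γ b))
      (𝓝[<] b) (𝓝 (unitNormal γ b)) := by
  obtain ⟨c, hac, hcb⟩ := exists_between hab
  have hsub : Icc c b ⊆ Ioc a b := Icc_subset_Ioc_left hac
  have hF := hγ.isFramedOn (ha.trans_lt hac) hb fun t ht =>
    curvature_ne_zero_of_strictMonoOn h (hsub ht)
  exact (hF.tendsto_direction_left hcb (h.mono hsub)).congr' <| nhdsWithin_le_nhds <|
    hγ.eventually_direction_focal_eq_evolute ⟨ha.trans_lt hab, hb⟩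
      (curvature_ne_zero_of_strictMonoOn h (right_mem_Ioc.2 hab))

theorem exists_Icc_strictQuasiconvexOn_curvature (hγ : IsC2OpenArc γ) (ht : t ∈ Ioo (0 : ℝ) 1)
    (hmax : ∀ᶠ s in 𝓝[≠] t, ¬ IsLocalMax (curvature γ) s) :
    ∃ η > 0, Icc (t - η) (t + η) ⊆ Ioo 0 1 ∧
      StrictQuasiconvexOn (curvature γ) (Icc (t - η) t) ∧
      StrictQuasiconvexOn (curvature γ) (Icc t (t + η)) := by
  obtain ⟨η, hη, hs⟩ := exists_Icc_subset_of_eventually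
    ((isOpen_Ioo.eventually_mem ht).and (eventually_nhdsWithin_iff.1 hmax))
  have hsl : Icc (t - η) t ⊆ Icc (t - η) (t + η) := Icc_subset_Icc_right (by linarith)
  have hsr : Icc t (t + η) ⊆ Icc (t - η) (t + η) := Icc_subset_Icc_left (by linarith)
  refine ⟨η, hη, fun s hs' => (hs s hs').1, ?_, ?_⟩
  · refine hγ.strictQuasiconvexOn_curvature ordConnected_Icc (fun s hs' => (hs s (hsl hs')).1)
      fun s hs' => (hs s (hsl (interior_subset hs'))).2 ?_
    rw [interior_Icc] at hs'
    exact hs'.2.ne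
  · refine hγ.strictQuasiconvexOn_curvature ordConnected_Icc (fun s hs' => (hs s (hsr hs')).1)
      fun s hs' => (hs s (hsr (interior_subset hs'))).2 ?_
    rw [interior_Icc] at hs'
    exact hs'.1.ne'

theorem isEvoluteCusp (hγ : IsC2OpenArc γ) (ht₀ : t₀ ∈ Ioo (0 : ℝ) 1)
    (hloc : IsLocalMax (curvature γ) t₀)
    (hmax : ∀ᶠ s in 𝓝[≠] t₀, ¬ IsLocalMax (curvature γ) s) : IsEvoluteCusp γ t₀ := by
  obtain ⟨η, hη, hs, hql, hqr⟩ := hγ.exists_Icc_strictQuasiconvexOn_curvature ht₀ hmax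
  have hlt : t₀ < t₀ + η := lt_add_of_pos_right t₀ hη
  have hgt : t₀ - η < t₀ := sub_lt_self t₀ hη
  have hsl : Icc (t₀ - η) t₀ ⊆ Ioo 0 1 := (Icc_subset_Icc_right hlt.le).trans hs
  have hsr : Icc t₀ (t₀ + η) ⊆ Ioo 0 1 := (Icc_subset_Icc_left hgt.le).trans hs
  have hcont : ContinuousOn (curvature γ) (Ioo 0 1) := fun t ht =>
    (hγ.continuousAt_curvature ht).continuousWithinAt
  obtain ⟨l, hl, hmono⟩ := hql.exists_strictMonoOn_Icc (hcont.mono hsl) <|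
    ((eventually_mem_set.2 (Ico_mem_nhdsLT hgt)).and (hloc.filter_mono nhdsWithin_le_nhds)).exists
  obtain ⟨r, hr, hanti⟩ := hqr.exists_strictAntiOn_Icc (hcont.mono hsr) <|
    ((eventually_mem_set.2 (Ioc_mem_nhdsGT hlt)).and (hloc.filter_mono nhdsWithin_le_nhds)).exists
  replace hanti := hanti.mono Ico_subset_Icc_self
  have hk := curvature_ne_zero_of_strictAntiOn hanti (left_mem_Ico.2 hr.1)
  refine ⟨hk, unitNormal γ t₀, hγ.norm_unitNormal ht₀ hk, ?_⟩
  rw [← Iio_union_Ioi, nhdsWithin_union]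
  exact (hγ.tendsto_direction_evolute_left (hsl (Ico_subset_Icc_self hl)).1.le hl.2 ht₀.2
    (hmono.mono Ioc_subset_Icc_self)).sup <|
    hγ.tendsto_direction_evolute_right ht₀.1 hr.1 (hsr (Ioc_subset_Icc_self hr)).2.le hanti

theorem exists_mem_ball_evolute (hγ : IsC2OpenArc γ) (ht : t ∈ Ioo (0 : ℝ) 1)
    (hk : curvature γ t ≠ 0) (hloc : ¬ IsLocalMax (curvature γ) t)
    (hmax : ∀ᶠ s in 𝓝[≠] t, ¬ IsLocalMax (curvature γ) s) :
    ∃ s ∈ Ioo (0 : ℝ) 1, γ s ∈ Metric.ball (evolute γ t) (curvature γ t)⁻¹ := by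
  obtain ⟨η, hη, hs, hql, hqr⟩ := hγ.exists_Icc_strictQuasiconvexOn_curvature ht hmax
  have hfreq : ∃ᶠ s in 𝓝[<] t ⊔ 𝓝[>] t, curvature γ t < curvature γ s := by
    rw [← nhdsWithin_union, Iio_union_Ioi, frequently_nhdsWithin_iff]
    exact (not_eventually.1 hloc).mono fun s hts =>
      ⟨not_le.1 hts, by rintro rfl; exact hts le_rfl⟩
  rcases frequently_sup.1 hfreq with hf | hf
  · have hl := hs (left_mem_Icc.2 (by linarith))
    have hanti := (hql.strictAntiOn_inter_Iic_of_frequently_lt ordConnected_Icc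
      (right_mem_Icc.2 (by linarith)) hf).mono (subset_inter Subset.rfl Icc_subset_Iic_self)
    exact ⟨t - η, hl, hγ.closedBall_evolute_subset_ball_of_strictAntiOn hl.1 (by linarith) ht.2
      hanti hk <| hγ.mem_closedBall_evolute hl <|
        curvature_ne_zero_of_strictAntiOn (hanti.mono Ico_subset_Icc_self) ⟨le_rfl, by linarith⟩⟩
  · have hr := hs (right_mem_Icc.2 (by linarith))
    have hmono := (hqr.strictMonoOn_inter_Ici_of_frequently_lt ordConnected_Icc
      (left_mem_Icc.2 (by linarith)) hf).mono (subset_inter Subset.rfl Icc_subset_Ici_self)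
    exact ⟨t + η, hr, hγ.closedBall_evolute_subset_ball_of_strictMonoOn ht.1 (by linarith) hr.2
      hmono hk <| hγ.mem_closedBall_evolute hr <|
        curvature_ne_zero_of_strictMonoOn (hmono.mono Ioc_subset_Icc_self) ⟨by linarith, le_rfl⟩⟩

theorem maxCurvatureCusps_eq_singleton (hγ : IsC2OpenArc γ) (ht₀ : t₀ ∈ Ioo (0 : ℝ) 1)
    (hloc : IsLocalMax (curvature γ) t₀)
    (huniq : ∀ t ∈ Ioo (0 : ℝ) 1, IsLocalMax (curvature γ) t → t = t₀) :
    maxCurvatureCusps γ = {evolute γ t₀} := by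
  refine Subset.antisymm ?_ <| singleton_subset_iff.2
    ⟨t₀, ht₀, hloc, hγ.isEvoluteCusp ht₀ hloc <|
      eventually_not_isLocalMax_of_forall_eq ht₀ huniq, rfl⟩
  rintro _ ⟨t, ht, hmax, -, rfl⟩
  rw [huniq t ht hmax, mem_singleton_iff]

theorem strictAntiOn_curvature (hγ : IsC2OpenArc γ) (ht₀ : 0 < t₀)
    (hmax : ∀ t ∈ Ioo t₀ 1, ¬ IsLocalMax (curvature γ) t)
    (hunb : ∀ t ∈ Ioo t₀ 1, ¬ Bornology.IsBounded (γ '' Ioo t 1)) :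
    StrictAntiOn (curvature γ) (Ico t₀ 1) := by
  have hq := hγ.strictQuasiconvexOn_curvature ordConnected_Ico
    (fun t ht => ⟨ht₀.trans_le ht.1, ht.2⟩) (by rwa [interior_Ico])
  refine hq.strictAntiOn_or_exists_strictMonoOn.resolve_right ?_
  rintro ⟨y, hy, z, hz, hyz, hmono⟩
  obtain ⟨w, hzw, hw⟩ := exists_between hz.2
  have hw0 : 0 < w := ht₀.trans_le (hz.1.trans hzw.le)
  replace hmono : StrictMonoOn (curvature γ) (Ico z 1) :=
    hmono.mono fun x hx => ⟨⟨hz.1.trans hx.1, hx.2⟩, hx.1⟩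
  have hk : ∀ s ∈ Ioo z 1, curvature γ s ≠ 0 := fun s hs =>
    curvature_ne_zero_of_strictMonoOn (hmono.mono (Icc_subset_Ico_right hs.2) |>.mono
      Ioc_subset_Icc_self) ⟨hs.1, le_rfl⟩
  refine hunb w ⟨(hy.1.trans_lt hyz).trans hzw, hw⟩
    (Metric.isBounded_ball (x := evolute γ w) (r := (curvature γ w)⁻¹) |>.subset ?_)
  rintro _ ⟨s, hs, rfl⟩
  exact hγ.closedBall_evolute_subset_ball_of_strictMonoOn hw0 hs.1 hs.2
    (hmono.mono fun x hx => ⟨hzw.le.trans hx.1, hx.2.trans_lt hs.2⟩) (hk w ⟨hzw, hw⟩)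
    (hγ.mem_closedBall_evolute ⟨hw0.trans hs.1, hs.2⟩ (hk s ⟨hzw.trans hs.1, hs.2⟩))

theorem strictMonoOn_curvature (hγ : IsC2OpenArc γ) (ht₀ : t₀ < 1)
    (hmax : ∀ t ∈ Ioo 0 t₀, ¬ IsLocalMax (curvature γ) t)
    (hunb : ∀ t ∈ Ioo 0 t₀, ¬ Bornology.IsBounded (γ '' Ioo 0 t)) :
    StrictMonoOn (curvature γ) (Ioc 0 t₀) := by
  have hq := hγ.strictQuasiconvexOn_curvature ordConnected_Ioc
    (fun t ht => ⟨ht.1, ht.2.trans_lt ht₀⟩) (by rwa [interior_Ioc])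
  refine hq.strictMonoOn_or_exists_strictAntiOn.resolve_right ?_
  rintro ⟨y, hy, z, hz, hzy, hanti⟩
  obtain ⟨w, hw, hwz⟩ := exists_between hz.1
  have hw1 : w < 1 := hwz.trans_le hz.2 |>.trans ht₀
  replace hanti : StrictAntiOn (curvature γ) (Ioc 0 z) :=
    hanti.mono fun x hx => ⟨⟨hx.1, hx.2.trans hz.2⟩, hx.2⟩
  have hk : ∀ s ∈ Ioo 0 z, curvature γ s ≠ 0 := fun s hs =>
    curvature_ne_zero_of_strictAntiOn (hanti.mono (Icc_subset_Ioc_left hs.1) |>.mono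
      Ico_subset_Icc_self) ⟨le_rfl, hs.2⟩
  refine hunb w ⟨hw, hwz.trans (hzy.trans_le hy.2)⟩
    (Metric.isBounded_ball (x := evolute γ w) (r := (curvature γ w)⁻¹) |>.subset ?_)
  rintro _ ⟨s, hs, rfl⟩
  exact hγ.closedBall_evolute_subset_ball_of_strictAntiOn hs.1 hs.2 hw1
    (hanti.mono fun x hx => ⟨hs.1.trans_le hx.1, hx.2.trans hwz.le⟩) (hk w ⟨hw, hwz⟩)
    (hγ.mem_closedBall_evolute ⟨hs.1, hs.2.trans hw1⟩ (hk s ⟨hs.1, hs.2.trans hwz⟩))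

end IsC2OpenArc

end Curvature

open Metric

section Feet

variable {α : Type*} [PseudoMetricSpace α] {S F : Set α} {z p q : α}

/-- `p` is a foot of `z` on `S`: a point of the closure of `S` nearest to `z`. The closure is taken
because an end of the curve may approach a point of the plane that is not on the curve. -/
structure IsFoot (S : Set α) (z p : α) : Prop where
  mem_closure : p ∈ closure S
  dist_eq : dist z p = infDist z S

theorem infDist_le_dist_of_mem_closure (hp : p ∈ closure S) : infDist z S ≤ dist z p := by
  rw [← infDist_closure]; exact infDist_le_dist_of_mem hp

theorem IsFoot.dist_le (hp : IsFoot S z p) (hq : q ∈ closure S) : dist z p ≤ dist z q :=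
  hp.dist_eq.trans_le (infDist_le_dist_of_mem_closure hq)

theorem isFoot_of_dist_le (hp : p ∈ closure S) (h : dist z p ≤ infDist z S) : IsFoot S z p :=
  ⟨hp, h.antisymm (infDist_le_dist_of_mem_closure hp)⟩

theorem exists_isFoot [ProperSpace α] (hS : S.Nonempty) (z : α) : ∃ p, IsFoot S z p := by
  obtain ⟨p, hp, h⟩ := isClosed_closure.exists_infDist_eq_dist hS.closure z
  exact ⟨p, hp, by rw [← h, infDist_closure]⟩

theorem isClosed_setOf_exists_isFoot [ProperSpace α] (hF : IsClosed F) :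
    IsClosed {z | ∃ p ∈ F, IsFoot S z p} := by
  rcases (F ∩ closure S).eq_empty_or_nonempty with he | hne
  · convert isClosed_empty (X := α)
    refine Set.eq_empty_of_forall_notMem ?_
    rintro z ⟨p, hpF, hp⟩
    exact he.subset (mem_inter hpF hp.mem_closure)
  · convert isClosed_le (continuous_infDist_pt (F ∩ closure S)) (continuous_infDist_pt S) using 1
    ext z
    constructor
    · rintro ⟨p, hpF, hp⟩
      exact (infDist_le_dist_of_mem (mem_inter hpF hp.mem_closure)).trans_eq hp.dist_eq
    · intro hz
      obtain ⟨p, hp, h⟩ := (hF.inter isClosed_closure).exists_infDist_eq_dist hne z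
      exact ⟨p, hp.1, isFoot_of_dist_le hp.2 (h.symm.trans_le hz)⟩

theorem exists_isFoot_and_isFoot [ProperSpace α] {A K : Set α} (hA : IsPreconnected A)
    (hK : IsClosed K) (hF : IsClosed F) (hcov : closure S ⊆ K ∪ F)
    (h₁ : ∃ z ∈ A, ∃ p ∈ K, IsFoot S z p) (h₂ : ∃ z ∈ A, ∃ q ∈ F, IsFoot S z q) :
    ∃ z ∈ A, (∃ p ∈ K, IsFoot S z p) ∧ ∃ q ∈ F, IsFoot S z q := by
  obtain ⟨_, _, _, _, hp⟩ := id h₁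
  have hS : S.Nonempty := closure_nonempty_iff.1 ⟨_, hp.mem_closure⟩
  refine isPreconnected_closed_iff.1 hA _ _ (isClosed_setOf_exists_isFoot hK)
    (isClosed_setOf_exists_isFoot hF) (fun z _ => ?_) h₁ h₂
  obtain ⟨p, hp⟩ := exists_isFoot hS z
  exact (hcov hp.mem_closure).imp (fun h => ⟨p, h, hp⟩) fun h => ⟨p, h, hp⟩

theorem IsFoot.eventually_forall_dist_lt [ProperSpace α] (hp : IsFoot S z p) (hF : IsClosed F)
    (hFS : F ⊆ closure S) (h : ∀ q ∈ F, ¬ IsFoot S z q) :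
    ∀ᶠ w in 𝓝 z, ∀ q ∈ F, dist w p < dist w q := by
  rcases F.eq_empty_or_nonempty with rfl | hne
  · exact Eventually.of_forall fun w q hq => absurd hq (notMem_empty q)
  obtain ⟨q, hq, hzq⟩ := hF.exists_infDist_eq_dist hne z
  have hlt : dist z p < infDist z F := by
    rw [hzq]
    exact lt_of_not_ge fun hle =>
      h q hq (isFoot_of_dist_le (hFS hq) (hle.trans_eq hp.dist_eq))
  have hnhds : ∀ᶠ w in 𝓝 z, dist w p < infDist w F :=
    (isOpen_lt (by fun_prop) (continuous_infDist_pt F)).mem_nhds hlt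
  exact hnhds.mono fun w hw q hq => hw.trans_le (infDist_le_dist_of_mem hq)

end Feet

section Disks

variable {E : Type*} [NormedAddCommGroup E] [InnerProductSpace ℝ E]

theorem norm_smul_of_norm_eq_one {u : E} (hu : ‖u‖ = 1) {a : ℝ} (ha : 0 ≤ a) : ‖a • u‖ = a := by
  rw [norm_smul, hu, mul_one, Real.norm_of_nonneg ha]

theorem dist_add_smul_self {u : E} (hu : ‖u‖ = 1) {a : ℝ} (ha : 0 ≤ a) (p : E) :
    dist (p + a • u) p = a := by
  rw [dist_self_add_left, norm_smul_of_norm_eq_one hu ha]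

theorem dist_add_smul_add_smul {u : E} (hu : ‖u‖ = 1) {a b : ℝ} (hab : a ≤ b) (p : E) :
    dist (p + a • u) (p + b • u) = b - a := by
  rw [dist_comm, dist_add_left, dist_eq_norm, ← sub_smul,
    norm_smul_of_norm_eq_one hu (sub_nonneg.2 hab)]

theorem exists_norm_eq_one_eq_add_dist_smul {z p : E} (h : z ≠ p) :
    ∃ u : E, ‖u‖ = 1 ∧ z = p + dist z p • u := by
  have h' : ‖z - p‖ ≠ 0 := norm_ne_zero_iff.2 (sub_ne_zero.2 h)
  refine ⟨‖z - p‖⁻¹ • (z - p), ?_, ?_⟩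
  · rw [norm_smul, norm_inv, norm_norm, inv_mul_cancel₀ h']
  · rw [dist_eq_norm, smul_inv_smul₀ h', add_sub_cancel]

theorem mem_ball_of_mem_closedBall_of_tangent {p u q : E} {d r : ℝ} (hu : ‖u‖ = 1) (hd : 0 < d)
    (hdr : d < r) (hq : q ∈ closedBall (p + d • u) d) (hqp : q ≠ p) : q ∈ ball (p + r • u) r := by
  have hdist (x : ℝ) :
      ‖q - (p + x • u)‖ ^ 2 = ‖q - p‖ ^ 2 - 2 * x * inner ℝ (q - p) u + x ^ 2 := by
    rw [← sub_sub, norm_sub_sq_real, inner_smul_right, norm_smul, hu, mul_one, Real.norm_eq_abs,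
      sq_abs]
    ring
  have hpos : 0 < ‖q - p‖ ^ 2 := pow_pos (norm_pos_iff.2 (sub_ne_zero.2 hqp)) 2
  rw [mem_closedBall, dist_eq_norm, ← sq_le_sq₀ (norm_nonneg _) hd.le, hdist] at hq
  have hinner : 0 < inner ℝ (q - p) u := by
    by_contra! hneg
    nlinarith
  rw [mem_ball, dist_eq_norm, ← sq_lt_sq₀ (norm_nonneg _) (hd.trans hdr).le, hdist]
  nlinarith [mul_pos (sub_pos.2 hdr) hinner]

theorem IsFoot.exists_eq_add_smul {S : Set E} {c p : E} (hp : IsFoot S c p)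
    (hpos : 0 < infDist c S) : ∃ u : E, ‖u‖ = 1 ∧ p = c + infDist c S • u := by
  have hpc : p ≠ c := (dist_pos.1 (hp.dist_eq ▸ hpos)).symm
  simpa only [dist_comm p c, hp.dist_eq] using exists_norm_eq_one_eq_add_dist_smul hpc

theorem IsFoot.isFoot_add_smul {S : Set E} {c u : E} {r : ℝ} (hu : ‖u‖ = 1)
    (hq : IsFoot S c (c + infDist c S • u)) (hr : 0 ≤ r) (hrR : r ≤ infDist c S) :
    IsFoot S (c + r • u) (c + infDist c S • u) := by
  refine isFoot_of_dist_le hq.mem_closure ?_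
  rw [dist_add_smul_add_smul hu hrR]
  have h := infDist_le_infDist_add_dist (s := S) (x := c) (y := c + r • u)
  rw [dist_comm, dist_add_smul_self hu hr] at h
  linarith

theorem IsFoot.eq_of_isFoot_add_smul {S : Set E} {c u p : E} {r : ℝ} (hu : ‖u‖ = 1)
    (hq : IsFoot S c (c + infDist c S • u)) (hr : 0 < r) (hrR : r < infDist c S)
    (hp : IsFoot S (c + r • u) p) : p = c + infDist c S • u := by
  set q := c + infDist c S • u with hqdef
  by_contra hne
  have hz : q + (infDist c S - r) • -u = c + r • u := by rw [hqdef]; module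
  have hc : q + infDist c S • -u = c := by rw [hqdef]; module
  have hmem := mem_ball_of_mem_closedBall_of_tangent (p := q) (u := -u) (q := p)
    (d := infDist c S - r) (r := infDist c S) (by rwa [norm_neg]) (by linarith) (by linarith)
    (by
      rw [hz, mem_closedBall, dist_comm]
      exact (hp.dist_le hq.mem_closure).trans_eq (dist_add_smul_add_smul hu hrR.le c)) hne
  rw [hc, mem_ball, dist_comm] at hmem
  exact hmem.not_ge (infDist_le_dist_of_mem_closure hp.mem_closure)

end Disks

section Divider

variable {S : Set Plane}

theorem mem_contactRadii_of_forall_lt_dist {p u : Plane} {r : ℝ} (hp : p ∈ S) (hu : ‖u‖ = 1)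
    (hr : 0 < r) (h : ∀ y ∈ S, y ≠ p → r < dist (p + r • u) y) : r ∈ contactRadii S p u := by
  refine ⟨hr, Subset.antisymm ?_ ?_⟩
  · rintro y ⟨hy, hyS⟩
    by_contra hyp
    exact (h y hyS hyp).not_ge (mem_closedBall'.1 hy)
  · rintro y rfl
    exact ⟨by rw [mem_closedBall', dist_add_smul_self hu hr.le], hp⟩

theorem mem_contactRadii_of_lt {p u : Plane} {d r : ℝ} (hp : p ∈ S) (hu : ‖u‖ = 1)
    (hr : 0 < r) (hrd : r < d) (hS : d ≤ infDist (p + d • u) S) : r ∈ contactRadii S p u := by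
  refine mem_contactRadii_of_forall_lt_dist hp hu hr fun y hyS hyp => ?_
  by_contra! hy
  have hmem := mem_ball_of_mem_closedBall_of_tangent hu hr hrd (mem_closedBall'.2 hy) hyp
  exact (mem_ball'.1 hmem).not_ge (hS.trans (infDist_le_dist_of_mem hyS))

theorem isLUB_contactRadii {p u : Plane} {d : ℝ} (hp : p ∈ S) (hu : ‖u‖ = 1)
    (hd : 0 < d) (hS : d ≤ infDist (p + d • u) S) (hub : ∀ r ∈ contactRadii S p u, r ≤ d) :
    IsLUB (contactRadii S p u) d := by
  refine ⟨hub, fun b hb => ?_⟩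
  by_contra! hlt
  obtain ⟨r, hr₁, hr₂⟩ := exists_between (max_lt hlt hd)
  have hrb := hb (mem_contactRadii_of_lt hp hu ((le_max_right _ _).trans_lt hr₁) hr₂ hS)
  exact ((le_max_left b 0).trans_lt hr₁).not_ge hrb

theorem mem_divider_of_isFoot {z p q : Plane} (hpS : p ∈ S) (hp : IsFoot S z p)
    (hq : IsFoot S z q) (hpq : q ≠ p) (hz : 0 < infDist z S) : z ∈ divider S := by
  obtain ⟨u, hu, hzu⟩ := exists_norm_eq_one_eq_add_dist_smul (z := z) (p := p)
    (dist_pos.1 (hp.dist_eq ▸ hz))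
  rw [hp.dist_eq] at hzu
  refine ⟨p, hpS, u, hu, infDist z S, isLUB_contactRadii hpS hu hz (by rw [← hzu])
    (fun r hr => ?_), hzu⟩
  by_contra! hdr
  have hqr : q ∈ ball (p + r • u) r := mem_ball_of_mem_closedBall_of_tangent hu hz hdr
    (by rw [← hzu, mem_closedBall', hq.dist_eq]) hpq
  obtain ⟨y, ⟨hyr, hyp⟩, hyS⟩ := mem_closure_iff.1 hq.mem_closure _
    (isOpen_ball.inter isOpen_compl_singleton) ⟨hqr, hpq⟩
  exact hyp (hr.2.le ⟨ball_subset_closedBall hyr, hyS⟩)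

theorem isFoot_add_smul_of_isLUB {p u : Plane} {R : ℝ} (hp : p ∈ S) (hu : ‖u‖ = 1)
    (hR : IsLUB (contactRadii S p u) R) : IsFoot S (p + R • u) p := by
  have hR₀ : 0 ≤ R := let ⟨r, hr⟩ := hR.nonempty; hr.1.le.trans (hR.1 hr)
  refine isFoot_of_dist_le (subset_closure hp) ((le_infDist ⟨p, hp⟩).2 fun y hy => ?_)
  by_contra! hlt
  obtain ⟨r, hr, hr₁, hr₂⟩ := hR.exists_between
    (show R - (dist (p + R • u) p - dist (p + R • u) y) / 2 < R by linarith)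
  rw [dist_add_smul_self hu hR₀] at hlt hr₁
  have hyr : y ∈ closedBall (p + r • u) r := by
    have h := dist_triangle (p + r • u) (p + R • u) y
    rw [dist_add_smul_add_smul hu hr₂] at h
    rw [mem_closedBall']
    linarith
  rw [mem_singleton_iff.1 (hr.2.le ⟨hyr, hy⟩), dist_add_smul_self hu hR₀] at hlt
  exact lt_irrefl _ hlt

theorem exists_isLUB_of_mem_divider {c : Plane} (hc : c ∈ divider S) :
    ∃ p ∈ S, ∃ u : Plane, ‖u‖ = 1 ∧ 0 < infDist c S ∧ IsLUB (contactRadii S p u) (infDist c S) ∧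
      c = p + infDist c S • u ∧ IsFoot S c p := by
  obtain ⟨p, hp, u, hu, R, hR, rfl⟩ := hc
  obtain ⟨r, hr⟩ := hR.nonempty
  have hR₀ : 0 < R := hr.1.trans_le (hR.1 hr)
  have hfoot := isFoot_add_smul_of_isLUB hp hu hR
  have hinf : infDist (p + R • u) S = R := by
    rw [← hfoot.dist_eq, dist_add_smul_self hu hR₀.le]
  rw [hinf]
  exact ⟨p, hp, u, hu, hR₀, hR, rfl, hfoot⟩

theorem IsFoot.add_smul_notMem_divider {c u : Plane} {r : ℝ} (hu : ‖u‖ = 1)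
    (hq : IsFoot S c (c + infDist c S • u)) (hr : 0 < r) (hrR : r < infDist c S) :
    c + r • u ∉ divider S := by
  intro hz
  obtain ⟨p, hpS, v, hv, -, hlub, hzp, hp⟩ := exists_isLUB_of_mem_divider hz
  have hinf : infDist (c + r • u) S = infDist c S - r := by
    rw [← (hq.isFoot_add_smul hu hr.le hrR.le).dist_eq, dist_add_smul_add_smul hu hrR.le]
  obtain rfl := hq.eq_of_isFoot_add_smul hu hr hrR hp
  have hvu : v = -u := by
    rw [hinf] at hzp
    refine smul_right_injective _ (sub_pos.2 hrR).ne' ?_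
    linear_combination (norm := module) -hzp
  subst hvu
  have hc : c + infDist c S • u + infDist c S • -u = c := by module
  have hmem := mem_contactRadii_of_lt (r := infDist c S - r / 2) (d := infDist c S) hpS hv
    (by linarith) (by linarith) (by rw [hc])
  linarith [hlub.1 hmem]

end Divider

section Sectors

theorem rot_rot (v : Plane) : rot (rot v) = -v := by
  apply plane_ext <;> simp

theorem cross_add_right (d v w : Plane) : cross d (v + w) = cross d v + cross d w := by
  simp only [cross, PiLp.add_apply]; ring

theorem cross_sub_right (d v w : Plane) : cross d (v - w) = cross d v - cross d w := by
  simp only [cross, PiLp.sub_apply]; ring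

theorem cross_smul_right (d : Plane) (a : ℝ) (v : Plane) : cross d (a • v) = a * cross d v := by
  simp only [cross, PiLp.smul_apply, smul_eq_mul]; ring

theorem cross_sub_left_swap (u v w : Plane) : cross (u - v) w = -cross (v - u) w := by
  simp only [cross, PiLp.sub_apply]; ring

theorem cross_sub_self (u v : Plane) : cross (v - u) v = cross (v - u) u := by
  simp only [cross, PiLp.sub_apply]; ring

/-- The function that is affine on the unit circle and vanishes there at `u` and `v`, extended
homogeneously. Its sign separates the two sectors bounded by the rays through `u` and `v`. -/
noncomputable def sectorSide (u v w : Plane) : ℝ := cross (v - u) w - ‖w‖ * cross (v - u) u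

theorem continuous_sectorSide (u v : Plane) : Continuous (sectorSide u v) := by
  unfold sectorSide cross; fun_prop

theorem sectorSide_swap (u v w : Plane) : sectorSide v u w = -sectorSide u v w := by
  rw [sectorSide, sectorSide, cross_sub_left_swap v u, cross_sub_left_swap v u, cross_sub_self]
  ring

theorem sectorSide_smul (u v : Plane) {a : ℝ} (ha : 0 ≤ a) (w : Plane) :
    sectorSide u v (a • w) = a * sectorSide u v w := by
  rw [sectorSide, sectorSide, cross_smul_right, norm_smul, Real.norm_of_nonneg ha]
  ring

theorem two_inner_sub_of_norm_eq {u v : Plane} (h : ‖u‖ = ‖v‖) :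
    2 * inner ℝ (v - u) u = -‖v - u‖ ^ 2 := by
  have h' := norm_add_sq_real (v - u) u
  rw [sub_add_cancel, h] at h'
  linarith

theorem eq_smul_or_eq_smul_of_sectorSide_eq_zero {u v w : Plane} (hu : ‖u‖ = 1) (hv : ‖v‖ = 1)
    (huv : u ≠ v) (h : sectorSide u v w = 0) : w = ‖w‖ • u ∨ w = ‖w‖ • v := by
  have hd : 0 < ‖v - u‖ ^ 2 := pow_pos (norm_pos_iff.2 (sub_ne_zero.2 huv.symm)) 2
  obtain ⟨s, hs⟩ : ∃ s : ℝ, w = ‖w‖ • u + s • (v - u) := by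
    have hinner : inner ℝ (rot (v - u)) (w - ‖w‖ • u) = 0 := by
      rw [inner_rot_left, cross_sub_right, cross_smul_right]; exact h
    have hpar := smul_rot_of_inner_eq_zero hinner
    rw [norm_rot, rot_rot, smul_neg, ← neg_smul] at hpar
    refine ⟨(‖v - u‖ ^ 2)⁻¹ * -cross (rot (v - u)) (w - ‖w‖ • u), ?_⟩
    rw [mul_smul, ← hpar, inv_smul_smul₀ hd.ne', add_sub_cancel]
  have hnorm := norm_add_sq_real (‖w‖ • u) (s • (v - u))
  rw [← hs, norm_smul_of_norm_eq_one hu (norm_nonneg w), norm_smul, Real.norm_eq_abs, mul_pow,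
    sq_abs, real_inner_smul_left, inner_smul_right, real_inner_comm] at hnorm
  have hzero : s * (s - ‖w‖) = 0 := by
    apply mul_left_cancel₀ hd.ne'
    linear_combination (-1 : ℝ) * hnorm
      - ‖w‖ * s * two_inner_sub_of_norm_eq (hu.trans hv.symm)
  rcases mul_eq_zero.1 hzero with h₀ | h₀
  · left; rwa [h₀, zero_smul, add_zero] at hs
  · right; rwa [sub_eq_zero.1 h₀, ← smul_add, add_sub_cancel] at hs

theorem cross_sub_norm_mul_nonneg_of_mem_segment {d m x w : Plane} (hx : ‖x‖ = 1) (hm : ‖m‖ = 1)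
    (hdm : cross d m = ‖d‖) (hw : w ∈ segment ℝ x m) : 0 ≤ cross d w - ‖w‖ * cross d x := by
  obtain ⟨α, β, hα, hβ, hαβ, rfl⟩ := hw
  have hnα := norm_smul_of_norm_eq_one hx hα
  have hnβ := norm_smul_of_norm_eq_one hm hβ
  have hle : ‖α • x + β • m‖ ≤ 1 := (norm_add_le _ _).trans (by rw [hnα, hnβ, hαβ])
  have hge : α - β ≤ ‖α • x + β • m‖ := by
    simpa only [norm_neg, sub_neg_eq_add, hnα, hnβ] using norm_sub_norm_le (α • x) (-(β • m))
  obtain ⟨hlow, hup⟩ : -‖d‖ ≤ cross d x ∧ cross d x ≤ ‖d‖ := by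
    rw [← abs_le, ← inner_rot_left]
    simpa only [norm_rot, hx, mul_one] using abs_real_inner_le_norm (rot d) x
  rw [cross_add_right, cross_smul_right, cross_smul_right, hdm]
  rcases le_total 0 (cross d x) with h | h
  · nlinarith [mul_nonneg hβ (sub_nonneg.2 hup), mul_nonneg h (sub_nonneg.2 hle)]
  · nlinarith [mul_nonneg hβ (neg_le_iff_add_nonneg.1 hlow),
      mul_nonneg (neg_nonneg.2 h) (sub_nonneg.2 hge)]

theorem ne_zero_of_mem_segment {d m x w : Plane} (hm : m ≠ 0) (hdm : inner ℝ d m = 0)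
    (hdx : inner ℝ d x ≠ 0) (hw : w ∈ segment ℝ x m) : w ≠ 0 := by
  obtain ⟨α, β, -, -, hαβ, rfl⟩ := hw
  intro h
  have hinner := congrArg (inner ℝ d) h
  rw [inner_add_right, inner_smul_right, inner_smul_right, hdm, inner_zero_right, mul_zero,
    add_zero] at hinner
  have hα : α = 0 := (mul_eq_zero.1 hinner).resolve_right hdx
  rw [hα, zero_add] at hαβ
  rw [hα, hαβ, zero_smul, zero_add, one_smul] at h
  exact hm h

theorem exists_isPreconnected_sectorSide_nonneg {u v : Plane} (hu : ‖u‖ = 1) (hv : ‖v‖ = 1)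
    (huv : u ≠ v) :
    ∃ A : Set Plane, IsPreconnected A ∧ u ∈ A ∧ v ∈ A ∧
      ∀ w ∈ A, w ≠ 0 ∧ ‖w‖ ≤ 1 ∧ 0 ≤ sectorSide u v w := by
  have hd : ‖v - u‖ ≠ 0 := norm_ne_zero_iff.2 (sub_ne_zero.2 huv.symm)
  set m := ‖v - u‖⁻¹ • rot (v - u) with hm
  have hm₁ : ‖m‖ = 1 := by
    rw [hm, norm_smul, norm_rot, norm_inv, norm_norm, inv_mul_cancel₀ hd]
  have hdm : inner ℝ (v - u) m = 0 := by rw [hm, inner_smul_right, inner_self_rot, mul_zero]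
  have hmd : cross (v - u) m = ‖v - u‖ := by
    rw [hm, cross_smul_right, ← inner_rot_left, real_inner_self_eq_norm_sq, norm_rot, sq,
      inv_mul_cancel_left₀ hd]
  have hd₂ : 0 < ‖v - u‖ ^ 2 := by positivity
  have hdu : inner ℝ (v - u) u ≠ 0 := fun h => by
    linarith [two_inner_sub_of_norm_eq (hu.trans hv.symm)]
  have hdv : inner ℝ (v - u) v ≠ 0 := fun h => by
    have h' := two_inner_sub_of_norm_eq (hv.trans hu.symm)
    rw [← neg_sub v u, inner_neg_left, norm_neg, h] at h'
    linarith
  have key : ∀ x : Plane, ‖x‖ = 1 → inner ℝ (v - u) x ≠ 0 → cross (v - u) x = cross (v - u) u →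
      ∀ w ∈ segment ℝ x m, w ≠ 0 ∧ ‖w‖ ≤ 1 ∧ 0 ≤ sectorSide u v w := fun x hx hdx hxu w hw =>
    ⟨ne_zero_of_mem_segment (norm_ne_zero_iff.1 (hm₁ ▸ one_ne_zero)) hdm hdx hw,
      mem_closedBall_zero_iff.1 ((convex_closedBall 0 1).segment_subset
        (mem_closedBall_zero_iff.2 hx.le) (mem_closedBall_zero_iff.2 hm₁.le) hw),
      by rw [sectorSide, ← hxu]; exact cross_sub_norm_mul_nonneg_of_mem_segment hx hm₁ hmd hw⟩
  refine ⟨segment ℝ u m ∪ segment ℝ v m, ?_, Or.inl (left_mem_segment _ _ _),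
    Or.inr (left_mem_segment _ _ _), fun w hw => hw.elim (key u hu hdu rfl w)
      (key v hv hdv (cross_sub_self u v) w)⟩
  exact (convex_segment u m).isPreconnected.union m (right_mem_segment _ _ _)
    (right_mem_segment _ _ _) (convex_segment v m).isPreconnected

end Sectors

section PiSet

theorem mem_piSet_iff_exists {S : Set Plane} {p : Plane} :
    p ∈ piSet S ↔ ∃ r : ℝ, 0 < r ∧ ¬ IsPreconnected (closedBall p r ∩ S) := by
  rw [piSet, mem_ofPred_eq, lctCurvature, ENNReal.inv_pos, lctRadius, Ne, sInf_eq_top]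
  push Not
  constructor
  · rintro ⟨_, ⟨r, hr, h, rfl⟩, -⟩
    exact ⟨r, hr, h⟩
  · rintro ⟨r, hr, h⟩
    exact ⟨_, ⟨r, hr, h, rfl⟩, ENNReal.ofReal_ne_top⟩

variable {γ : ℝ → Plane}

theorem mem_trace {t : ℝ} (ht : t ∈ Ioo (0 : ℝ) 1) : γ t ∈ trace γ := mem_image_of_mem γ ht

theorem closedBall_inter_trace (p : Plane) (r : ℝ) :
    closedBall p r ∩ trace γ = γ '' {t ∈ Ioo (0 : ℝ) 1 | dist p (γ t) ≤ r} := by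
  rw [trace, ← image_preimage_inter, inter_comm]
  congr 1
  ext t
  rw [mem_inter_iff, mem_preimage, mem_closedBall', mem_ofPred_eq]

theorem domRestrict_image_preimage {A : Set ℝ} (hA : A ⊆ Ioo 0 1) :
    (Ioo (0 : ℝ) 1).domRestrict γ '' (Subtype.val ⁻¹' A) = γ '' A := by
  ext x
  constructor
  · rintro ⟨t, ht, rfl⟩
    exact ⟨t, ht, rfl⟩
  · rintro ⟨t, ht, rfl⟩
    exact ⟨⟨t, hA ht⟩, ht, rfl⟩

namespace IsC2OpenArc

theorem continuousOn (hγ : IsC2OpenArc γ) : ContinuousOn γ (Ioo 0 1) := hγ.contDiffOn.continuousOn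

theorem injOn (hγ : IsC2OpenArc γ) : InjOn γ (Ioo 0 1) :=
  injOn_iff_injective.2 hγ.isEmbedding.injective

theorem isPreconnected_image (hγ : IsC2OpenArc γ) {A : Set ℝ} (hA : A ⊆ Ioo 0 1) :
    IsPreconnected (γ '' A) ↔ A.OrdConnected := by
  rw [← domRestrict_image_preimage hA, hγ.isEmbedding.isInducing.isPreconnected_image,
    ← IsInducing.subtypeVal.isPreconnected_image, Subtype.image_preimage_coe,
    inter_eq_right.2 hA, isPreconnected_iff_ordConnected]

theorem mem_closure_of_apply_mem_closure (hγ : IsC2OpenArc γ) {A : Set ℝ}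
    (hA : A ⊆ Ioo 0 1) {t : ℝ} (ht : t ∈ Ioo (0 : ℝ) 1) (h : γ t ∈ closure (γ '' A)) :
    t ∈ closure A := by
  have hmem : (⟨t, ht⟩ : Ioo (0 : ℝ) 1) ∈ closure (Subtype.val ⁻¹' A) := by
    rw [hγ.isEmbedding.isInducing.closure_eq_preimage_closure_image, mem_preimage,
      domRestrict_image_preimage hA]
    exact h
  exact closure_mono (image_preimage_subset _ _) (closure_subtype.1 hmem)

theorem mem_piSet_iff (hγ : IsC2OpenArc γ) {p : Plane} :
    p ∈ piSet (trace γ) ↔ ∃ s ∈ Ioo (0 : ℝ) 1, ∃ t, ∃ u ∈ Ioo (0 : ℝ) 1, s < t ∧ t < u ∧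
      dist p (γ s) < dist p (γ t) ∧ dist p (γ u) < dist p (γ t) := by
  have hord (r : ℝ) : IsPreconnected (closedBall p r ∩ trace γ) ↔
      {t ∈ Ioo (0 : ℝ) 1 | dist p (γ t) ≤ r}.OrdConnected := by
    rw [closedBall_inter_trace, hγ.isPreconnected_image fun t ht => ht.1]
  simp only [mem_piSet_iff_exists, hord]
  constructor
  · rintro ⟨r, -, hr⟩
    rw [ordConnected_def] at hr
    push Not at hr
    obtain ⟨s, hs, u, hu, hnot⟩ := hr
    obtain ⟨t, ht, htr⟩ := not_subset.1 hnot
    have hrt : r < dist p (γ t) := by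
      by_contra! h
      exact htr ⟨⟨hs.1.1.trans_le ht.1, ht.2.trans_lt hu.1.2⟩, h⟩
    exact ⟨s, hs.1, t, u, hu.1, ht.1.lt_of_ne fun h => htr (h ▸ hs),
      ht.2.lt_of_ne fun h => htr (h ▸ hu), hs.2.trans_lt hrt, hu.2.trans_lt hrt⟩
  · rintro ⟨s, hs, t, u, hu, hst, htu, hlts, hltu⟩
    have hr : 0 < max (dist p (γ s)) (dist p (γ u)) := by
      by_contra! h
      rw [max_le_iff, dist_le_zero, dist_le_zero] at h
      exact (hst.trans htu).ne (hγ.injOn hs hu (h.1.symm.trans h.2))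
    refine ⟨_, hr, fun hord => ?_⟩
    have ht := hord.out ⟨hs, le_max_left _ _⟩ ⟨hu, le_max_right _ _⟩ ⟨hst.le, htu.le⟩
    exact ht.2.not_gt (max_lt hlts hltu)

theorem normal_mem_convexSide (hγ : IsC2OpenArc γ) {t d : ℝ} (ht : t ∈ Ioo (0 : ℝ) 1)
    (hk : curvature γ t ≠ 0) (hd : (curvature γ t)⁻¹ < d) :
    γ t + d • unitNormal γ t ∈ convexSide γ :=
  ⟨t, ht, hk, (hγ.sbtw_iff ht hk).2 ⟨d, hd, rfl⟩⟩

theorem normal_mem_closure_convexSide (hγ : IsC2OpenArc γ) {t d : ℝ}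
    (ht : t ∈ Ioo (0 : ℝ) 1) (hk : curvature γ t ≠ 0) (hd : (curvature γ t)⁻¹ ≤ d) :
    γ t + d • unitNormal γ t ∈ closure (convexSide γ) := by
  have hlim : Tendsto (fun x : ℝ => γ t + x • unitNormal γ t) (𝓝[>] d)
      (𝓝 (γ t + d • unitNormal γ t)) :=
    (Continuous.tendsto (by fun_prop) d).mono_left nhdsWithin_le_nhds
  refine mem_closure_of_tendsto hlim ?_
  filter_upwards [self_mem_nhdsWithin] with x hx
  exact hγ.normal_mem_convexSide ht hk (hd.trans_lt hx)

theorem eventually_dist_lt_of_inv_lt (hγ : IsC2OpenArc γ) {t d : ℝ}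
    (ht : t ∈ Ioo (0 : ℝ) 1) (hk : curvature γ t ≠ 0) (hd : (curvature γ t)⁻¹ < d) :
    ∀ᶠ s in 𝓝 t, s ≠ t →
      dist (γ t + d • unitNormal γ t) (γ s) < dist (γ t + d • unitNormal γ t) (γ t) := by
  refine hγ.eventually_dist_lt ht ?_ (inner_normal_sub_deriv γ t d)
  rw [hγ.secondForm_normal ht]
  refine mul_neg_of_pos_of_neg (pow_pos (hγ.norm_deriv_pos ht) 2) (sub_neg.2 ?_)
  rwa [← inv_lt_iff_one_lt_mul₀ (curvature_pos_of_ne_zero hk)]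

theorem convexSide_subset_piSet (hγ : IsC2OpenArc γ) : convexSide γ ⊆ piSet (trace γ) := by
  rintro z ⟨t, ht, hk, hb⟩
  obtain ⟨d, hd, rfl⟩ := (hγ.sbtw_iff ht hk).1 hb
  obtain ⟨η, hη, hs⟩ := exists_Icc_subset_of_eventually
    ((hγ.eventually_dist_lt_of_inv_lt ht hk hd).and (isOpen_Ioo.eventually_mem ht))
  have hl := hs (t - η) ⟨le_rfl, by linarith⟩
  have hr := hs (t + η) ⟨by linarith, le_rfl⟩
  exact hγ.mem_piSet_iff.2 ⟨t - η, hl.2, t, t + η, hr.2, by linarith, by linarith,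
    hl.1 (by linarith), hr.1 (by linarith)⟩

theorem exists_isLocalMax_of_mem_piSet (hγ : IsC2OpenArc γ) {p : Plane}
    (hp : p ∈ piSet (trace γ)) :
    ∃ m ∈ Ioo (0 : ℝ) 1, IsLocalMax (fun t => dist p (γ t)) m := by
  obtain ⟨s, hs, t, u, hu, hst, htu, hlts, hltu⟩ := hγ.mem_piSet_iff.1 hp
  have hsub : Icc s u ⊆ Ioo 0 1 := Icc_subset_Ioo hs.1 hu.2
  have hcont : ContinuousOn (fun x => dist p (γ x)) (Icc s u) :=
    (continuous_const.dist continuous_id).comp_continuousOn (hγ.continuousOn.mono hsub)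
  obtain ⟨m, hm, hmax⟩ := isCompact_Icc.exists_isMaxOn ⟨t, hst.le, htu.le⟩ hcont
  have htm : dist p (γ t) ≤ dist p (γ m) := hmax ⟨hst.le, htu.le⟩
  have hsm : s < m := hm.1.lt_of_ne (by rintro rfl; exact htm.not_gt hlts)
  have hmu : m < u := hm.2.lt_of_ne (by rintro rfl; exact htm.not_gt hltu)
  exact ⟨m, hsub hm, hmax.isLocalMax (Icc_mem_nhds hsm hmu)⟩

theorem piSet_subset_closure_convexSide (hγ : IsC2OpenArc γ) :
    piSet (trace γ) ⊆ closure (convexSide γ) := by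
  intro p hp
  obtain ⟨m, hm, hmax⟩ := hγ.exists_isLocalMax_of_mem_piSet hp
  obtain ⟨hk, d, hd, rfl⟩ := hγ.exists_normal_of_isLocalMax hm hmax
  exact hγ.normal_mem_closure_convexSide hm hk hd

end IsC2OpenArc

end PiSet

section DividerOfArc

variable {γ : ℝ → Plane} {a b t : ℝ} {c q : Plane}

theorem isLocalMin_dist_of_isFoot (ht : t ∈ Ioo (0 : ℝ) 1) (h : IsFoot (trace γ) c (γ t)) :
    IsLocalMin (fun s => dist c (γ s)) t := by
  filter_upwards [isOpen_Ioo.mem_nhds ht] with s hs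
  exact h.dist_le (subset_closure (mem_trace hs))

namespace IsC2OpenArc

theorem closure_trace_subset (hγ : IsC2OpenArc γ) (ha : 0 < a) (hb : b < 1) :
    closure (trace γ) ⊆ γ '' Icc a b ∪ closure (γ '' (Ioc 0 a ∪ Ico b 1)) := by
  have hK : IsCompact (γ '' Icc a b) := isCompact_Icc.image_of_continuousOn
    (hγ.continuousOn.mono (Icc_subset_Ioo ha hb))
  have hcov : trace γ ⊆ γ '' Icc a b ∪ γ '' (Ioc 0 a ∪ Ico b 1) := by
    rw [trace, ← image_union]
    refine image_mono fun s hs => ?_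
    rcases le_total s a with hsa | has
    · exact Or.inr (Or.inl ⟨hs.1, hsa⟩)
    · exact (le_total s b).imp (fun hsb => ⟨has, hsb⟩) fun hbs => Or.inr ⟨hbs, hs.2⟩
  simpa only [closure_union, hK.isClosed.closure_eq] using closure_mono hcov

theorem eq_or_eq_of_apply_mem_closure (hγ : IsC2OpenArc γ) (ha : 0 < a) (hb : b < 1)
    (ht : t ∈ Icc a b) (h : γ t ∈ closure (γ '' (Ioc 0 a ∪ Ico b 1))) : t = a ∨ t = b := by
  have hab := ht.1.trans ht.2
  have hsub : Ioc 0 a ∪ Ico b 1 ⊆ Ioo 0 1 :=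
    union_subset (fun x hx => ⟨hx.1, by linarith [hx.2]⟩) fun x hx => ⟨by linarith [hx.1], hx.2⟩
  have hcl : t ∈ Iic a ∪ Ici b :=
    closure_minimal (union_subset_union (fun x hx => hx.2) fun x hx => hx.1)
      (isClosed_Iic.union isClosed_Ici)
      (hγ.mem_closure_of_apply_mem_closure hsub (Icc_subset_Ioo ha hb ht) h)
  exact hcl.imp (fun h => le_antisymm h ht.1) fun h => le_antisymm ht.2 h

theorem exists_far_parameters (hγ : IsC2OpenArc γ) (hconst : NoConstantCurvatureArc γ)
    (ht : t ∈ Ioo (0 : ℝ) 1) (hq : q ∈ closure (trace γ)) (hqt : q ≠ γ t) (c : Plane) :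
    ∃ a b, 0 < a ∧ a < t ∧ t < b ∧ b < 1 ∧ infDist c (trace γ) < dist c (γ a) ∧
      infDist c (trace γ) < dist c (γ b) ∧ q ∈ closure (γ '' (Ioc 0 a ∪ Ico b 1)) := by
  have hne : ∀ᶠ s in 𝓝 t, γ s ≠ q := (hγ.hasDerivAt ht).continuousAt.eventually_ne hqt.symm
  obtain ⟨η, hη, hs⟩ := exists_Icc_subset_of_eventually (hne.and (isOpen_Ioo.eventually_mem ht))
  have hl := (hs (t - η) ⟨le_rfl, by linarith⟩).2
  have hr := (hs (t + η) ⟨by linarith, le_rfl⟩).2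
  obtain ⟨a, ha, hca⟩ := hγ.exists_dist_ne hconst hl.1.le (show t - η < t by linarith) ht.2.le c
    (infDist c (trace γ))
  obtain ⟨b, hb, hcb⟩ := hγ.exists_dist_ne hconst ht.1.le (show t < t + η by linarith) hr.2.le c
    (infDist c (trace γ))
  have ha₁ := (hs a ⟨ha.1.le, by linarith [ha.2]⟩).2
  have hb₁ := (hs b ⟨by linarith [hb.1], hb.2.le⟩).2
  refine ⟨a, b, ha₁.1, ha.2, hb.1, hb₁.2,
    (infDist_le_dist_of_mem (mem_trace ha₁)).lt_of_ne hca.symm,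
    (infDist_le_dist_of_mem (mem_trace hb₁)).lt_of_ne hcb.symm,
    (hγ.closure_trace_subset ha₁.1 hb₁.2 hq).resolve_left ?_⟩
  rintro ⟨s, hsab, rfl⟩
  exact (hs s ⟨ha.1.le.trans hsab.1, hsab.2.trans hb.2.le⟩).1 rfl

theorem mem_piSet_of_isFoot (hγ : IsC2OpenArc γ) (hconst : NoConstantCurvatureArc γ)
    (ht : t ∈ Ioo (0 : ℝ) 1) (hct : IsFoot (trace γ) c (γ t)) (hcq : IsFoot (trace γ) c q)
    (hqt : q ≠ γ t) : c ∈ piSet (trace γ) := by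
  obtain ⟨a, b, ha, hat, htb, hb, hfa, hfb, hcl⟩ :=
    hγ.exists_far_parameters hconst ht hcq.mem_closure hqt c
  have hopen : IsOpen {x | dist c x < min (dist c (γ a)) (dist c (γ b))} :=
    isOpen_lt (by fun_prop) continuous_const
  obtain ⟨_, hlt, s, hs, rfl⟩ := mem_closure_iff.1 hcl _ hopen
    (show dist c q < _ from hcq.dist_eq ▸ lt_min hfa hfb)
  rw [mem_ofPred_eq, lt_min_iff] at hlt
  obtain ⟨hlta, hltb⟩ := hlt
  rw [hγ.mem_piSet_iff]
  rcases hs with hs | hs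
  · have hsa : s < a := hs.2.lt_of_ne (by rintro rfl; exact lt_irrefl _ hlta)
    exact ⟨s, ⟨hs.1, by linarith [ht.2]⟩, a, t, ht, hsa, hat, hlta, hct.dist_eq.trans_lt hfa⟩
  · have hbs : b < s := hs.1.lt_of_ne (by rintro rfl; exact lt_irrefl _ hltb)
    exact ⟨t, ht, b, s, ⟨by linarith [ht.1], hs.2⟩, htb, hbs, hct.dist_eq.trans_lt hfb, hltb⟩

theorem eventually_forall_dist_lt (hγ : IsC2OpenArc γ) (ht : t ∈ Ioo (0 : ℝ) 1)
    (hct : IsFoot (trace γ) c (γ t)) (hsole : ∀ q, IsFoot (trace γ) c q → q = γ t)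
    (hpos : 0 < secondForm γ c t) :
    ∀ᶠ z in 𝓝 c, inner ℝ (γ t - z) (deriv γ t) = 0 →
      ∀ s ∈ Ioo (0 : ℝ) 1, s ≠ t → dist z (γ t) < dist z (γ s) := by
  obtain ⟨η, hη, -, hnear⟩ := hγ.exists_strict_min ht hpos
  set O : Set ℝ := Ioo 0 1 \ Ioo (t - η) (t + η)
  have htO : t ∉ closure O := fun h => by
    obtain ⟨s, hs, hs'⟩ := mem_closure_iff.1 h _ isOpen_Ioo
      (show t ∈ Ioo (t - η) (t + η) from ⟨by linarith, by linarith⟩)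
    exact hs'.2 hs
  have hfar : ∀ᶠ z in 𝓝 c, ∀ y ∈ closure (γ '' O), dist z (γ t) < dist z y :=
    hct.eventually_forall_dist_lt isClosed_closure (closure_mono (image_mono sdiff_subset))
      fun y hy hcy => htO (hγ.mem_closure_of_apply_mem_closure sdiff_subset ht (hsole y hcy ▸ hy))
  filter_upwards [hnear, hfar] with z hzn hzf hz s hs hst
  by_cases hsO : s ∈ O
  · exact hzf _ (subset_closure (mem_image_of_mem γ hsO))
  · exact hzn hz s (Ioo_subset_Icc_self (not_not.1 fun h => hsO ⟨hs, h⟩)) hst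

theorem exists_isFoot_ne_or_eq_evolute (hγ : IsC2OpenArc γ) (hc : c ∈ divider (trace γ)) :
    0 < infDist c (trace γ) ∧ ∃ t ∈ Ioo (0 : ℝ) 1, IsFoot (trace γ) c (γ t) ∧
      ((∃ q, IsFoot (trace γ) c q ∧ q ≠ γ t) ∨ (curvature γ t ≠ 0 ∧ c = evolute γ t)) := by
  obtain ⟨_, ⟨t, ht, rfl⟩, u, hu, hpos, hlub, hcu, hfoot⟩ := exists_isLUB_of_mem_divider hc
  refine ⟨hpos, t, ht, hfoot, ?_⟩
  have hmin := isLocalMin_dist_of_isFoot ht hfoot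
  have hcrit := hγ.inner_eq_zero_of_isLocalExtr ht (Or.inl hmin)
  by_contra! ⟨hsole, hev⟩
  have hQ : 0 < secondForm γ c t := (hγ.secondForm_nonneg_of_isLocalMin ht hmin).lt_of_ne' fun h =>
    let ⟨hk, he⟩ := hγ.eq_evolute_of_secondForm_eq_zero ht hcrit h; hev hk he
  have hline : Tendsto (fun r : ℝ => γ t + r • u) (𝓝 (infDist c (trace γ))) (𝓝 c) :=
    Continuous.tendsto' (by fun_prop) _ _ hcu.symm
  obtain ⟨r, hr, hRr⟩ := (((hline.eventually (hγ.eventually_forall_dist_lt ht hfoot hsole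
    hQ)).filter_mono nhdsWithin_le_nhds).and
      (self_mem_nhdsWithin (s := Ioi (infDist c (trace γ))))).exists
  have hr₀ : 0 < r := hpos.trans hRr
  have hnormal : inner ℝ (γ t - (γ t + r • u)) (deriv γ t) = 0 := by
    rw [hcu, sub_add_cancel_left, ← smul_neg, real_inner_smul_left] at hcrit
    rw [sub_add_cancel_left, ← smul_neg, real_inner_smul_left,
      (mul_eq_zero.1 hcrit).resolve_left hpos.ne', mul_zero]
  refine (hlub.1 (mem_contactRadii_of_forall_lt_dist (mem_trace ht) hu hr₀ ?_)).not_gt hRr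
  rintro _ ⟨s, hs, rfl⟩ hst
  simpa only [dist_add_smul_self hu hr₀.le] using
    hr hnormal s hs (by rintro rfl; exact hst rfl)

theorem divider_subset_closure_piSet (hγ : IsC2OpenArc γ) (hconst : NoConstantCurvatureArc γ) :
    divider (trace γ) ⊆ closure (piSet (trace γ)) := by
  intro c hc
  obtain ⟨-, t, ht, hct, ⟨q, hcq, hqt⟩ | ⟨hk, he⟩⟩ := hγ.exists_isFoot_ne_or_eq_evolute hc
  · exact subset_closure (hγ.mem_piSet_of_isFoot hconst ht hct hcq hqt)
  · refine closure_mono hγ.convexSide_subset_piSet ?_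
    rw [he, hγ.evolute_eq ht hk]
    exact hγ.normal_mem_closure_convexSide ht hk le_rfl

theorem inter_divider_nonempty (hγ : IsC2OpenArc γ) {A : Set Plane} (hA : IsPreconnected A)
    (ha : 0 < a) (hb : b < 1) (hfa : ∀ z ∈ A, infDist z (trace γ) < dist z (γ a))
    (hfb : ∀ z ∈ A, infDist z (trace γ) < dist z (γ b)) (hpos : ∀ z ∈ A, 0 < infDist z (trace γ))
    (h₁ : ∃ z ∈ A, ∃ p ∈ γ '' Icc a b, IsFoot (trace γ) z p)
    (h₂ : ∃ z ∈ A, ∃ q ∈ closure (γ '' (Ioc 0 a ∪ Ico b 1)), IsFoot (trace γ) z q) :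
    (A ∩ divider (trace γ)).Nonempty := by
  have hsub : Icc a b ⊆ Ioo 0 1 := Icc_subset_Ioo ha hb
  obtain ⟨z, hzA, ⟨_, ⟨s, hs, rfl⟩, hzs⟩, q, hq, hzq⟩ := exists_isFoot_and_isFoot hA
    (isCompact_Icc.image_of_continuousOn (hγ.continuousOn.mono hsub)).isClosed isClosed_closure
    (hγ.closure_trace_subset ha hb) h₁ h₂
  refine ⟨z, hzA, mem_divider_of_isFoot (mem_trace (hsub hs)) hzs hzq ?_ (hpos z hzA)⟩
  rintro rfl
  rcases hγ.eq_or_eq_of_apply_mem_closure ha hb hs hq with rfl | rfl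
  · exact (hfa z hzA).ne' hzs.dist_eq
  · exact (hfb z hzA).ne' hzs.dist_eq

end IsC2OpenArc

end DividerOfArc

section EndPoint

variable {X : Set Plane} {c : Plane}

theorem IsEndPoint.exists_isPreconnected (h : IsEndPoint X c) {V : Set Plane} (hV : V ∈ 𝓝 c) :
    ∃ C : Set Plane, IsPreconnected C ∧ C ⊆ V ∩ (X \ {c}) ∧ C ∈ 𝓝[X \ {c}] c := by
  obtain ⟨U, hcU, hU, φ, hφ⟩ := h
  have hcont : Continuous fun x => (φ.symm x : Plane) := by fun_prop
  have hVφ : (fun x => (φ.symm x : Plane)) ⁻¹' V ∈ 𝓝 (φ ⟨c, hcU⟩) :=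
    hcont.continuousAt (by rwa [φ.symm_apply_apply])
  obtain ⟨ε, hε, hεV⟩ := Metric.mem_nhds_iff.1 hVφ
  have hJ : IsPreconnected ((↑) ⁻¹' Ioo 0 ε : Set (Ico (0 : ℝ) 1)) := by
    rw [← IsInducing.subtypeVal.isPreconnected_image, Subtype.image_preimage_coe]
    exact (ordConnected_Ico.inter ordConnected_Ioo).isPreconnected
  refine ⟨_, hJ.image _ hcont.continuousOn, ?_, ?_⟩
  · rintro _ ⟨x, hx, rfl⟩
    refine ⟨hεV ?_, (φ.symm x).2.1, fun hxc => hx.1.ne' ?_⟩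
    · rw [mem_ball, Subtype.dist_eq, hφ, Real.dist_0_eq_abs, abs_of_pos hx.1]
      exact hx.2
    · have hx' : x = φ ⟨c, hcU⟩ := φ.symm_apply_eq.1 (Subtype.ext hxc)
      rw [hx', hφ]
  · have hopen : IsOpen {y | (φ y : ℝ) < ε} := isOpen_lt (by fun_prop) continuous_const
    obtain ⟨O, hO, hOε⟩ := isOpen_induced_iff.1 hopen
    refine mem_nhdsWithin.2 ⟨U ∩ O, hU.inter hO, ⟨hcU.2, ?_⟩, ?_⟩
    · exact hOε.ge (show (φ ⟨c, hcU⟩ : ℝ) < ε from hφ.trans_lt hε)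
    · rintro z ⟨⟨hzU, hzO⟩, hzX, hzc⟩
      have hzε : (φ ⟨z, hzX, hzU⟩ : ℝ) < ε := hOε.le (show _ ∈ Subtype.val ⁻¹' O from hzO)
      refine ⟨φ ⟨z, hzX, hzU⟩, ⟨(φ _).2.1.lt_of_ne fun h₀ => hzc ?_, hzε⟩, by simp⟩
      exact congrArg Subtype.val (φ.injective (Subtype.ext (h₀.symm.trans hφ.symm)))

theorem not_isEndPoint_of_frequently {G : Plane → ℝ} (hG : Continuous G)
    (hne : ∀ᶠ z in 𝓝[X \ {c}] c, G z ≠ 0) (hnonneg : ∃ᶠ z in 𝓝[X \ {c}] c, 0 ≤ G z)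
    (hnonpos : ∃ᶠ z in 𝓝[X \ {c}] c, G z ≤ 0) : ¬ IsEndPoint X c := by
  intro h
  obtain ⟨V, hV, hVne⟩ := mem_nhdsWithin_iff_exists_mem_nhds_inter.1 hne
  obtain ⟨C, hC, hCsub, hCmem⟩ := h.exists_isPreconnected hV
  obtain ⟨y, hy, hyC⟩ := (hnonneg.and_eventually hCmem).exists
  obtain ⟨x, hx, hxC⟩ := (hnonpos.and_eventually hCmem).exists
  obtain ⟨z, hzC, hz⟩ := hC.intermediate_value hxC hyC hG.continuousOn ⟨hx, hy⟩
  exact hVne (hCsub hzC) hz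

theorem frequently_sectorSide_nonneg {u v : Plane} (hu : ‖u‖ = 1) (hv : ‖v‖ = 1) (huv : u ≠ v)
    (h : ∀ᶠ δ : ℝ in 𝓝[>] 0, ∀ A : Set Plane, IsPreconnected A → u ∈ A → v ∈ A →
      (∀ w ∈ A, ‖w‖ ≤ 1) → ∃ w ∈ A, c + δ • w ∈ X) :
    ∃ᶠ z in 𝓝[X \ {c}] c, 0 ≤ sectorSide u v (z - c) := by
  obtain ⟨A, hA, huA, hvA, hAw⟩ := exists_isPreconnected_sectorSide_nonneg hu hv huv
  refine frequently_iff.2 fun {V} hV => ?_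
  obtain ⟨ε, hε, hεV⟩ := mem_nhdsWithin_iff.1 hV
  obtain ⟨δ, hδ, hδ₀, hδε⟩ := (h.and (Ioo_mem_nhdsGT hε)).exists
  obtain ⟨w, hw, hwX⟩ := hδ A hA huA hvA fun w hw => (hAw w hw).2.1
  obtain ⟨hw₀, hw₁, hside⟩ := hAw w hw
  refine ⟨c + δ • w, hεV ⟨?_, hwX, ?_⟩, ?_⟩
  · rw [mem_ball, dist_self_add_left, norm_smul, Real.norm_of_nonneg hδ₀.le]
    exact (mul_le_of_le_one_right hδ₀.le hw₁).trans_lt hδε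
  · rw [mem_singleton_iff, add_eq_left]
    exact smul_ne_zero hδ₀.ne' hw₀
  · rw [add_sub_cancel_left, sectorSide_smul _ _ hδ₀.le]
    exact mul_nonneg hδ₀.le hside

variable {γ : ℝ → Plane} {t : ℝ} {q : Plane}

theorem eventually_sectorSide_ne_zero {S : Set Plane} {u v : Plane} (hu : ‖u‖ = 1) (hv : ‖v‖ = 1)
    (huv : u ≠ v) (hpos : 0 < infDist c S) (hcu : IsFoot S c (c + infDist c S • u))
    (hcv : IsFoot S c (c + infDist c S • v)) :
    ∀ᶠ z in 𝓝[divider S \ {c}] c, sectorSide u v (z - c) ≠ 0 := by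
  filter_upwards [self_mem_nhdsWithin, mem_nhdsWithin_of_mem_nhds (ball_mem_nhds c hpos)]
    with z ⟨hz, hzc⟩ hzR hzero
  have hn : 0 < ‖z - c‖ := norm_pos_iff.2 (sub_ne_zero.2 hzc)
  rw [mem_ball, dist_eq_norm] at hzR
  rcases eq_smul_or_eq_smul_of_sectorSide_eq_zero hu hv huv hzero with h | h
  · exact hcu.add_smul_notMem_divider hu hn hzR (by rwa [← h, add_sub_cancel])
  · exact hcv.add_smul_notMem_divider hv hn hzR (by rwa [← h, add_sub_cancel])

theorem IsC2OpenArc.eventually_exists_mem_divider (hγ : IsC2OpenArc γ)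
    (hconst : NoConstantCurvatureArc γ) (ht : t ∈ Ioo (0 : ℝ) 1) {u v : Plane} (hu : ‖u‖ = 1)
    (hv : ‖v‖ = 1) (huv : u ≠ v) (hpos : 0 < infDist c (trace γ))
    (hct : γ t = c + infDist c (trace γ) • u)
    (hcv : IsFoot (trace γ) c (c + infDist c (trace γ) • v)) :
    ∀ᶠ δ : ℝ in 𝓝[>] 0, ∀ A : Set Plane, IsPreconnected A → u ∈ A → v ∈ A →
      (∀ w ∈ A, ‖w‖ ≤ 1) → ∃ w ∈ A, c + δ • w ∈ divider (trace γ) := by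
  have hcu : IsFoot (trace γ) c (c + infDist c (trace γ) • u) :=
    ⟨hct ▸ subset_closure (mem_trace ht), by
      rw [dist_comm, dist_add_smul_self hu hpos.le]⟩
  obtain ⟨a, b, ha, hat, htb, hb, hfa, hfb, hcl⟩ :=
    hγ.exists_far_parameters hconst ht hcv.mem_closure
      (by rw [hct, ne_eq, add_right_inj, smul_right_inj hpos.ne']; exact huv.symm) c
  have hcont := continuous_infDist_pt (trace γ)
  obtain ⟨η, hη, hball⟩ := nhds_basis_closedBall.eventually_iff.1
    (((isOpen_lt hcont (continuous_id.dist continuous_const)).eventually_mem hfa).and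
      (((isOpen_lt hcont (continuous_id.dist continuous_const)).eventually_mem hfb).and
        ((isOpen_lt continuous_const hcont).eventually_mem hpos)))
  filter_upwards [Ioo_mem_nhdsGT (lt_min hη hpos)] with δ ⟨hδ, hδlt⟩ A hA huA hvA hA₁
  have hδη := hδlt.le.trans (min_le_left _ _)
  have hδR := hδlt.le.trans (min_le_right _ _)
  have hsub : ∀ z ∈ (fun w => c + δ • w) '' A, z ∈ closedBall c η := by
    rintro _ ⟨w, hw, rfl⟩
    rw [mem_closedBall, dist_self_add_left, norm_smul, Real.norm_of_nonneg hδ.le]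
    exact (mul_le_of_le_one_right hδ.le (hA₁ w hw)).trans hδη
  obtain ⟨_, ⟨w, hw, rfl⟩, hwX⟩ := hγ.inter_divider_nonempty
    (hA.image (fun w => c + δ • w) (by fun_prop)) ha hb (fun z hz => (hball (hsub z hz)).1)
    (fun z hz => (hball (hsub z hz)).2.1) (fun z hz => (hball (hsub z hz)).2.2)
    ⟨_, mem_image_of_mem _ huA, _, mem_image_of_mem γ ⟨hat.le, htb.le⟩,
      hct ▸ hcu.isFoot_add_smul hu hδ.le hδR⟩
    ⟨_, mem_image_of_mem _ hvA, _, hcl, hcv.isFoot_add_smul hv hδ.le hδR⟩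
  exact ⟨w, hw, hwX⟩

/-- The Divider leaves a centre with two feet on both sides of the pair of radii to the feet. -/
theorem IsC2OpenArc.not_isEndPoint_of_isFoot (hγ : IsC2OpenArc γ)
    (hconst : NoConstantCurvatureArc γ) (ht : t ∈ Ioo (0 : ℝ) 1) (hpos : 0 < infDist c (trace γ))
    (hct : IsFoot (trace γ) c (γ t)) (hcq : IsFoot (trace γ) c q) (hqt : q ≠ γ t) :
    ¬ IsEndPoint (divider (trace γ)) c := by
  obtain ⟨u, hu, hcu⟩ := hct.exists_eq_add_smul hpos
  obtain ⟨v, hv, hcv⟩ := hcq.exists_eq_add_smul hpos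
  have huv : u ≠ v := by
    rintro rfl; exact hqt (hcv.trans hcu.symm)
  subst hcv
  have hmeet := hγ.eventually_exists_mem_divider hconst ht hu hv huv hpos hcu hcq
  refine not_isEndPoint_of_frequently (G := fun z => sectorSide u v (z - c))
    ((continuous_sectorSide u v).comp (continuous_id.sub continuous_const))
    (eventually_sectorSide_ne_zero hu hv huv hpos (hcu ▸ hct) hcq)
    (frequently_sectorSide_nonneg hu hv huv hmeet) ?_
  refine (frequently_sectorSide_nonneg hv hu huv.symm (hmeet.mono fun δ h A hA hvA huA =>
    h A hA huA hvA)).mono fun z hz => ?_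
  rwa [sectorSide_swap, neg_nonneg] at hz

end EndPoint

section CuspChart

theorem IsFoot.inner_sub_sub_nonneg {E : Type*} [NormedAddCommGroup E] [InnerProductSpace ℝ E]
    {S : Set E} {z c x y : E} (hx : IsFoot S z x) (hy : IsFoot S c y) :
    0 ≤ inner ℝ (x - y) (z - c) := by
  have hz := hx.dist_le hy.mem_closure
  have hc := hy.dist_le hx.mem_closure
  rw [dist_eq_norm, dist_eq_norm, ← sq_le_sq₀ (norm_nonneg _) (norm_nonneg _),
    norm_sub_sq_real, norm_sub_sq_real, real_inner_comm] at hz hc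
  rw [inner_sub_left, inner_sub_right, inner_sub_right]
  linarith [real_inner_comm z y, real_inner_comm c x]

/-- The points with a foot on the closed side of `p₀` towards which `w` points. -/
def footSide (S : Set Plane) (p₀ w : Plane) : Set Plane :=
  {z | ∃ p ∈ {p | 0 ≤ inner ℝ (p - p₀) w}, IsFoot S z p}

variable {S X : Set Plane} {c p₀ w n z : Plane} {ε : ℝ}

theorem isClosed_setOf_inner_sub_nonneg (p₀ w : Plane) :
    IsClosed {p : Plane | 0 ≤ inner ℝ (p - p₀) w} :=
  isClosed_le continuous_const (by fun_prop)

theorem isClosed_footSide (S : Set Plane) (p₀ w : Plane) : IsClosed (footSide S p₀ w) :=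
  isClosed_setOf_exists_isFoot (isClosed_setOf_inner_sub_nonneg p₀ w)

theorem inner_sub_nonneg_or_neg (p₀ w p : Plane) :
    0 ≤ inner ℝ (p - p₀) w ∨ 0 ≤ inner ℝ (p - p₀) (-w) := by
  rw [inner_neg_right, neg_nonneg]
  exact le_total _ _

theorem mem_footSide_or_mem_footSide_neg (hS : S.Nonempty) (p₀ w z : Plane) :
    z ∈ footSide S p₀ w ∨ z ∈ footSide S p₀ (-w) := by
  obtain ⟨p, hp⟩ := exists_isFoot hS z
  exact (inner_sub_nonneg_or_neg p₀ w p).imp (fun h => ⟨p, h, hp⟩) fun h => ⟨p, h, hp⟩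

theorem exists_eq_smul_add_inner_smul (hw : w ≠ 0) (hn : ‖n‖ = 1) (hwn : inner ℝ w n = 0)
    (v : Plane) : ∃ x : ℝ, v = x • w + inner ℝ v n • n := by
  refine ⟨inner ℝ w v / ‖w‖ ^ 2, ?_⟩
  have horth : inner ℝ w (v - (inner ℝ w v / ‖w‖ ^ 2) • w) = 0 := by
    rw [inner_sub_right, real_inner_smul_right, real_inner_self_eq_norm_sq,
      div_mul_cancel₀ _ (pow_ne_zero 2 (norm_ne_zero_iff.2 hw)), sub_self]
  have hnormal := eq_inner_smul_of_inner_eq_zero hw hn hwn horth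
  rwa [inner_sub_left, real_inner_smul_left, hwn, mul_zero, sub_zero, sub_eq_iff_eq_add'] at hnormal

/-- The local picture of a centre locus `X` of `S` at a point `c` whose foot `p₀` is a vertex of
`S`: near `c`, the set `X` consists of `c` and the points with two feet, `S` lies near `p₀` on the
side of the normal `n`, distinct feet of a point are separated by the normal line with respect to
the tangent `w`, and the centres with foot `p₀` do not lie beyond `c`. -/
structure IsCuspChart (S X : Set Plane) (c p₀ w n : Plane) (ε : ℝ) : Prop where
  ne_zero : w ≠ 0
  norm_eq_one : ‖n‖ = 1
  inner_eq_zero : inner ℝ w n = 0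
  isFoot : IsFoot S c p₀
  inner_normal_pos : ∀ z ∈ ball c ε, ∀ p, IsFoot S z p → p ≠ p₀ → 0 < inner ℝ (p - p₀) n
  inner_tangent_ne_zero : ∀ z ∈ ball c ε, ∀ p, IsFoot S z p → p ≠ p₀ → inner ℝ (p - p₀) w ≠ 0
  mul_neg : ∀ z ∈ ball c ε, ∀ p, IsFoot S z p → ∀ q, IsFoot S z q → p ≠ q →
    inner ℝ (p - p₀) w * inner ℝ (q - p₀) w < 0
  exists_eq_add_smul : ∀ z ∈ ball c ε, IsFoot S z p₀ → ∃ r ≤ (0 : ℝ), z = c + r • n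
  mem_iff : ∀ z ∈ ball c ε, z ∈ X ↔ z = c ∨ ∃ p q, IsFoot S z p ∧ IsFoot S z q ∧ p ≠ q

namespace IsCuspChart

theorem neg (h : IsCuspChart S X c p₀ w n ε) : IsCuspChart S X c p₀ (-w) n ε where
  ne_zero := neg_ne_zero.2 h.ne_zero
  norm_eq_one := h.norm_eq_one
  inner_eq_zero := by rw [inner_neg_left, h.inner_eq_zero, neg_zero]
  isFoot := h.isFoot
  inner_normal_pos := h.inner_normal_pos
  inner_tangent_ne_zero z hz p hp hne := by
    rw [inner_neg_right]
    exact neg_ne_zero.2 (h.inner_tangent_ne_zero z hz p hp hne)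
  mul_neg z hz p hp q hq hne := by
    rw [inner_neg_right, inner_neg_right, neg_mul_neg]
    exact h.mul_neg z hz p hp q hq hne
  exists_eq_add_smul := h.exists_eq_add_smul
  mem_iff := h.mem_iff

theorem nonempty (h : IsCuspChart S X c p₀ w n ε) : S.Nonempty :=
  closure_nonempty_iff.1 ⟨p₀, h.isFoot.mem_closure⟩

theorem inner_smul_add_smul (h : IsCuspChart S X c p₀ w n ε) (x y : ℝ) :
    inner ℝ (x • w + y • n) n = y := by
  rw [inner_add_left, real_inner_smul_left, real_inner_smul_left, h.inner_eq_zero,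
    real_inner_self_eq_norm_sq, h.norm_eq_one]
  ring

theorem inner_sub_nonpos (h : IsCuspChart S X c p₀ w n ε) (hz : z ∈ ball c ε)
    (hp : IsFoot S z p₀) : inner ℝ (z - c) n ≤ 0 := by
  obtain ⟨r, hr, rfl⟩ := h.exists_eq_add_smul z hz hp
  simpa only [add_sub_cancel_left, zero_smul, zero_add]
    using (h.inner_smul_add_smul 0 r).trans_le hr

theorem eq_of_isFoot (h : IsCuspChart S X c p₀ w n ε) (hε : 0 < ε) {p : Plane}
    (hp : IsFoot S c p) : p = p₀ := by
  by_contra hne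
  have hneg := h.mul_neg c (mem_ball_self hε) p hp p₀ h.isFoot hne
  rw [sub_self, inner_zero_left, mul_zero] at hneg
  exact lt_irrefl _ hneg

theorem inner_sub_pos_of_isFoot (h : IsCuspChart S X c p₀ w n ε) (hz : z ∈ ball c ε)
    {p q : Plane} (hp : IsFoot S z p) (hq : IsFoot S z q) (hpq : p ≠ q) :
    0 < inner ℝ (z - c) n := by
  have hneg := h.mul_neg z hz p hp q hq hpq
  have hp₀ : p ≠ p₀ := by
    rintro rfl
    rw [sub_self, inner_zero_left, zero_mul] at hneg
    exact lt_irrefl _ hneg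
  have hnp := h.inner_normal_pos z hz p hp hp₀
  obtain ⟨x, hx⟩ := exists_eq_smul_add_inner_smul h.ne_zero h.norm_eq_one h.inner_eq_zero (z - c)
  have hmp := hp.inner_sub_sub_nonneg h.isFoot
  have hmq := hq.inner_sub_sub_nonneg h.isFoot
  rw [hx, inner_add_right, real_inner_smul_right, real_inner_smul_right] at hmp hmq
  by_contra! hle
  have hnq : 0 ≤ inner ℝ (q - p₀) n := by
    by_cases hq₀ : q = p₀
    · rw [hq₀, sub_self, inner_zero_left]
    · exact (h.inner_normal_pos z hz q hq hq₀).le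
  have hxp : 0 ≤ x * inner ℝ (p - p₀) w := by
    linarith [mul_nonpos_of_nonpos_of_nonneg hle hnp.le]
  have hxq : 0 ≤ x * inner ℝ (q - p₀) w := by
    linarith [mul_nonpos_of_nonpos_of_nonneg hle hnq]
  have hx₀ : x = 0 := by
    by_contra hx₀
    nlinarith [mul_nonneg hxp hxq, mul_neg_of_pos_of_neg (sq_pos_of_ne_zero hx₀) hneg]
  have hy : inner ℝ (z - c) n = 0 := by
    rw [hx₀, zero_mul, zero_add] at hmp
    exact hle.antisymm (nonneg_of_mul_nonneg_left hmp hnp)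
  rw [hx₀, hy, zero_smul, zero_smul, add_zero, sub_eq_zero] at hx
  have hε : 0 < ε := dist_nonneg.trans_lt hz
  exact hp₀ (h.eq_of_isFoot hε (hx ▸ hp))

theorem eq_of_mem_of_inner_eq_zero (h : IsCuspChart S X c p₀ w n ε) (hz : z ∈ ball c ε)
    (hX : z ∈ X) (h₀ : inner ℝ (z - c) n = 0) : z = c := by
  obtain rfl | ⟨p, q, hp, hq, hpq⟩ := (h.mem_iff z hz).1 hX
  · rfl
  · exact absurd h₀ (h.inner_sub_pos_of_isFoot hz hp hq hpq).ne'

theorem mem_iff_mem_footSide (h : IsCuspChart S X c p₀ w n ε) (hz : z ∈ ball c ε) :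
    z ∈ X ↔ z ∈ footSide S p₀ w ∧ z ∈ footSide S p₀ (-w) ∧ 0 ≤ inner ℝ (z - c) n := by
  rw [h.mem_iff z hz]
  simp only [footSide, mem_ofPred_eq, inner_neg_right, neg_nonneg]
  constructor
  · rintro (rfl | ⟨p, q, hp, hq, hpq⟩)
    · simpa using ⟨⟨p₀, by simp, h.isFoot⟩, ⟨p₀, by simp, h.isFoot⟩⟩
    · have hpos := (h.inner_sub_pos_of_isFoot hz hp hq hpq).le
      rcases mul_neg_iff.1 (h.mul_neg z hz p hp q hq hpq) with ⟨hpw, hqw⟩ | ⟨hpw, hqw⟩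
      · exact ⟨⟨p, hpw.le, hp⟩, ⟨q, hqw.le, hq⟩, hpos⟩
      · exact ⟨⟨q, hqw.le, hq⟩, ⟨p, hpw.le, hp⟩, hpos⟩
  · rintro ⟨⟨p, hpw, hp⟩, ⟨q, hqw, hq⟩, hy⟩
    by_cases hpq : p = q
    · subst hpq
      have hp₀ : p = p₀ := by
        by_contra hne
        exact h.inner_tangent_ne_zero z hz p hp hne (hqw.antisymm hpw)
      obtain ⟨r, hr, rfl⟩ := h.exists_eq_add_smul z hz (hp₀ ▸ hp)
      have hr₀ := h.inner_smul_add_smul 0 r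
      rw [zero_smul, zero_add] at hr₀
      rw [add_sub_cancel_left, hr₀] at hy
      rw [hr.antisymm hy, zero_smul, add_zero]
      exact Or.inl rfl
    · exact Or.inr ⟨p, q, hp, hq, hpq⟩

theorem exists_isFoot_inner_pos (h : IsCuspChart S X c p₀ w n ε) (hz : z ∈ ball c ε)
    (hX : z ∈ X) (hpos : 0 < inner ℝ (z - c) n) :
    ∃ p, IsFoot S z p ∧ 0 < inner ℝ (p - p₀) w := by
  obtain ⟨p, hpw, hp⟩ := ((h.mem_iff_mem_footSide hz).1 hX).1
  refine ⟨p, hp, hpw.lt_of_ne' (h.inner_tangent_ne_zero z hz p hp ?_)⟩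
  rintro rfl
  exact hpos.not_ge (h.inner_sub_nonpos hz hp)

/-- Moving a centre along the tangent moves its feet in the same direction, so the left foot of
one of two centres at equal height cannot lie on the right of the right foot of the other. -/
theorem nonpos_of_sub_eq_smul (h : IsCuspChart S X c p₀ w n ε) {z' : Plane} {x : ℝ}
    (hz : z ∈ ball c ε) (hz' : z' ∈ ball c ε) (hX : z ∈ X) (hX' : z' ∈ X)
    (hpos : 0 < inner ℝ (z - c) n) (hpos' : 0 < inner ℝ (z' - c) n) (hx : z - z' = x • w) :
    x ≤ 0 := by
  obtain ⟨p, hp, hpw⟩ := h.neg.exists_isFoot_inner_pos hz hX hpos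
  obtain ⟨q, hq, hqw⟩ := h.exists_isFoot_inner_pos hz' hX' hpos'
  have hmono := hp.inner_sub_sub_nonneg hq
  rw [hx, real_inner_smul_right, ← sub_sub_sub_cancel_right p q p₀, inner_sub_left] at hmono
  rw [inner_neg_right, neg_pos] at hpw
  by_contra! hx₀
  exact hmono.not_gt (mul_neg_of_pos_of_neg hx₀ (by linarith))

theorem injOn_inner_sub (h : IsCuspChart S X c p₀ w n ε) :
    InjOn (fun z => inner ℝ (z - c) n) (X ∩ ball c ε) := by
  rintro z ⟨hX, hz⟩ z' ⟨hX', hz'⟩ (heq : inner ℝ (z - c) n = inner ℝ (z' - c) n)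
  rcases ((h.mem_iff_mem_footSide hz).1 hX).2.2.eq_or_lt with h₀ | hpos
  · rw [h.eq_of_mem_of_inner_eq_zero hz hX h₀.symm,
      h.eq_of_mem_of_inner_eq_zero hz' hX' (heq ▸ h₀.symm)]
  obtain ⟨x, hx⟩ := exists_eq_smul_add_inner_smul h.ne_zero h.norm_eq_one h.inner_eq_zero (z - z')
  rw [← sub_sub_sub_cancel_right z z' c, inner_sub_left, heq, sub_self, zero_smul, add_zero,
    sub_sub_sub_cancel_right] at hx
  have hx' : z' - z = (-x) • w := by rw [neg_smul, ← hx, neg_sub]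
  have hle := h.nonpos_of_sub_eq_smul hz hz' hX hX' hpos (heq ▸ hpos) hx
  have hge := h.nonpos_of_sub_eq_smul hz' hz hX' hX (heq ▸ hpos) hpos hx'
  rw [hle.antisymm (by linarith), zero_smul] at hx
  exact sub_eq_zero.1 hx

theorem add_smul_notMem_footSide_neg (h : IsCuspChart S X c p₀ w n ε) {x : ℝ} (hx : 0 < x)
    (hz : c + x • w ∈ ball c ε) : c + x • w ∉ footSide S p₀ (-w) := by
  rintro ⟨p, hpw, hp⟩
  rw [mem_ofPred_eq, inner_neg_right, neg_nonneg] at hpw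
  have hmono := hp.inner_sub_sub_nonneg h.isFoot
  rw [add_sub_cancel_left, real_inner_smul_right] at hmono
  have hp₀ : p = p₀ := by
    by_contra hne
    exact h.inner_tangent_ne_zero _ hz p hp hne (hpw.antisymm (nonneg_of_mul_nonneg_right hmono hx))
  obtain ⟨r, -, hr⟩ := h.exists_eq_add_smul _ hz (hp₀ ▸ hp)
  have hzero : x * ‖w‖ ^ 2 = 0 := by
    rw [← real_inner_self_eq_norm_sq, ← real_inner_smul_right, add_left_cancel hr,
      real_inner_smul_right, h.inner_eq_zero, mul_zero]
  exact (mul_pos hx (pow_pos (norm_pos_iff.2 h.ne_zero) 2)).ne' hzero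

theorem eventually_add_smul_notMem_footSide_neg (h : IsCuspChart S X c p₀ w n ε) {x : ℝ}
    (hx : 0 < x) (hz : c + x • w ∈ ball c ε) :
    ∀ᶠ y : ℝ in 𝓝 0, c + (x • w + y • n) ∉ footSide S p₀ (-w) := by
  have hcont : Tendsto (fun y : ℝ => c + (x • w + y • n)) (𝓝 0) (𝓝 (c + x • w)) :=
    Continuous.tendsto' (by fun_prop) _ _ (by rw [zero_smul, add_zero])
  exact hcont.eventually ((isClosed_footSide S p₀ (-w)).isOpen_compl.mem_nhds
    (h.add_smul_notMem_footSide_neg hx hz))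

theorem exists_add_smul_mem (h : IsCuspChart S X c p₀ w n ε) {x y : ℝ} (hx : 0 ≤ x) (hy : 0 ≤ y)
    (hball : ∀ r ∈ Icc (-x) x, c + (r • w + y • n) ∈ ball c ε)
    (hr : c + (x • w + y • n) ∉ footSide S p₀ (-w))
    (hl : c + ((-x) • w + y • n) ∉ footSide S p₀ w) :
    ∃ r ∈ Icc (-x) x, c + (r • w + y • n) ∈ X := by
  have hxx : -x ≤ x := neg_le_self hx
  obtain ⟨_, ⟨r, hrx, rfl⟩, hright, hleft⟩ := exists_isFoot_and_isFoot
    (isPreconnected_Icc.image (fun r : ℝ => c + (r • w + y • n)) (by fun_prop))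
    (isClosed_setOf_inner_sub_nonneg p₀ w) (isClosed_setOf_inner_sub_nonneg p₀ (-w))
    (fun p _ => inner_sub_nonneg_or_neg p₀ w p)
    ⟨_, mem_image_of_mem _ (right_mem_Icc.2 hxx),
      (mem_footSide_or_mem_footSide_neg h.nonempty p₀ w _).resolve_right hr⟩
    ⟨_, mem_image_of_mem _ (left_mem_Icc.2 hxx),
      (mem_footSide_or_mem_footSide_neg h.nonempty p₀ w _).resolve_left hl⟩
  refine ⟨r, hrx, (h.mem_iff_mem_footSide (hball r hrx)).2 ⟨hright, hleft, ?_⟩⟩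
  rwa [add_sub_cancel_left, h.inner_smul_add_smul]

theorem eventually_exists_inner_sub_eq (h : IsCuspChart S X c p₀ w n ε) {δ : ℝ} (hδ : 0 < δ)
    (hδε : δ ≤ ε) :
    ∀ᶠ y : ℝ in 𝓝 0, 0 ≤ y → ∃ z ∈ X ∩ ball c δ, inner ℝ (z - c) n = y := by
  have hlim : Tendsto (fun r : ℝ × ℝ => c + (r.1 • w + r.2 • n)) (𝓝 (0, 0)) (𝓝 c) :=
    Continuous.tendsto' (by fun_prop) _ _ (by simp)
  have hball := hlim.eventually (ball_mem_nhds c hδ)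
  rw [nhds_prod_eq, eventually_prod_iff] at hball
  obtain ⟨P, hP, Q, hQ, hPQ⟩ := hball
  obtain ⟨x, hx, hxP⟩ := exists_Icc_subset_of_eventually hP
  rw [zero_sub, zero_add] at hxP
  have hzero : ∀ r ∈ Icc (-x) x, c + r • w ∈ ball c ε := fun r hr => by
    simpa only [zero_smul, add_zero] using ball_subset_ball hδε (hPQ (hxP r hr) hQ.self_of_nhds)
  have hxx : -x ≤ x := neg_le_self hx.le
  have hr := h.eventually_add_smul_notMem_footSide_neg hx (hzero x (right_mem_Icc.2 hxx))
  have hl := h.neg.eventually_add_smul_notMem_footSide_neg hx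
    (by simpa only [smul_neg, neg_smul] using hzero (-x) (left_mem_Icc.2 hxx))
  filter_upwards [hQ, hr, hl] with y hyQ hyr hyl hy
  rw [neg_neg, smul_neg, ← neg_smul] at hyl
  have hballδ : ∀ r ∈ Icc (-x) x, c + (r • w + y • n) ∈ ball c δ := fun r hr => hPQ (hxP r hr) hyQ
  obtain ⟨r, hrx, hX⟩ := h.exists_add_smul_mem hx.le hy
    (fun r hr => ball_subset_ball hδε (hballδ r hr)) hyr hyl
  exact ⟨_, ⟨hX, hballδ r hrx⟩, by rw [add_sub_cancel_left, h.inner_smul_add_smul]⟩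

theorem isCompact_inter_closedBall (h : IsCuspChart S X c p₀ w n ε) {δ : ℝ} (hδ : δ < ε) :
    IsCompact (X ∩ closedBall c δ) := by
  have heq : X ∩ closedBall c δ = closedBall c δ ∩
      (footSide S p₀ w ∩ (footSide S p₀ (-w) ∩ {z | 0 ≤ inner ℝ (z - c) n})) := by
    rw [inter_comm]
    ext z
    exact and_congr_right fun hz => h.mem_iff_mem_footSide (closedBall_subset_ball hδ hz)
  rw [heq]
  exact (isCompact_closedBall c δ).inter_right ((isClosed_footSide S p₀ w).inter
    ((isClosed_footSide S p₀ (-w)).inter (isClosed_le continuous_const (by fun_prop))))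

end IsCuspChart

theorem isEndPoint_of_injOn_isCompact {U C : Set Plane} {f : Plane → ℝ} (hU : IsOpen U)
    (hcU : c ∈ X ∩ U) (hf : Continuous f) (hC : IsCompact C) (hUC : X ∩ U ⊆ C) (hinj : InjOn f C)
    (himage : f '' (X ∩ U) = Ico 0 1) (hc : f c = 0) : IsEndPoint X c := by
  have : CompactSpace C := isCompact_iff_compactSpace.1 hC
  have hemb : IsEmbedding (C.domRestrict f) :=
    ((hf.comp continuous_subtype_val).isClosedEmbedding
      (injOn_iff_injective.1 hinj)).isEmbedding
  have hmem : ∀ z : ↥(X ∩ U), f z ∈ Ico (0 : ℝ) 1 := fun z => himage.subset ⟨z, z.2, rfl⟩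
  have hembI : IsEmbedding (Set.codRestrict ((X ∩ U).domRestrict f) (Ico (0 : ℝ) 1) hmem) :=
    (hemb.comp (IsEmbedding.inclusion hUC)).codRestrict _ hmem
  refine ⟨U, hcU, hU, hembI.toHomeomorphOfSurjective ?_, hc⟩
  rintro ⟨r, hr⟩
  obtain ⟨z, hz, rfl⟩ := himage.superset hr
  exact ⟨⟨z, hz⟩, rfl⟩

theorem IsCuspChart.isEndPoint (h : IsCuspChart S X c p₀ w n ε) (hε : 0 < ε) :
    IsEndPoint X c := by
  obtain ⟨y₁, hy₁, hsurj⟩ := exists_Icc_subset_of_eventually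
    (h.eventually_exists_inner_sub_eq (half_pos hε) (half_le_self hε.le))
  have hsub : closedBall c (ε / 2) ⊆ ball c ε := closedBall_subset_ball (half_lt_self hε)
  have hheight : Continuous fun z : Plane => inner ℝ (z - c) n := by fun_prop
  have hU : IsOpen (ball c (ε / 2) ∩ {z | inner ℝ (z - c) n < y₁}) :=
    isOpen_ball.inter (isOpen_lt hheight continuous_const)
  have hc : inner ℝ (c - c) n = 0 := by rw [sub_self, inner_zero_left]
  have hUC : X ∩ (ball c (ε / 2) ∩ {z | inner ℝ (z - c) n < y₁}) ⊆ X ∩ closedBall c (ε / 2) :=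
    inter_subset_inter_right _ (inter_subset_left.trans ball_subset_closedBall)
  refine isEndPoint_of_injOn_isCompact hU
    ⟨(h.mem_iff c (mem_ball_self hε)).2 (Or.inl rfl), mem_ball_self (half_pos hε), hc.trans_lt hy₁⟩
    (hheight.div_const y₁) (h.isCompact_inter_closedBall (half_lt_self hε)) hUC ?_ ?_
    (by rw [hc, zero_div])
  · intro z hz z' hz' heq
    exact h.injOn_inner_sub ⟨hz.1, hsub hz.2⟩ ⟨hz'.1, hsub hz'.2⟩ ((div_left_inj' hy₁.ne').1 heq)
  · refine Subset.antisymm ?_ fun r hr => ?_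
    · rintro _ ⟨z, hz, rfl⟩
      have hnonneg := ((h.mem_iff_mem_footSide (hsub (hUC hz).2)).1 hz.1).2.2
      exact ⟨div_nonneg hnonneg hy₁.le, (div_lt_one hy₁).2 hz.2.2⟩
    · have hry : r * y₁ < y₁ := mul_lt_of_lt_one_left hy₁ hr.2
      have hr₀ : 0 ≤ r * y₁ := mul_nonneg hr.1 hy₁.le
      obtain ⟨z, ⟨hX, hz⟩, hzr⟩ := hsurj (r * y₁) ⟨by linarith, by linarith⟩ hr₀
      refine ⟨z, ⟨hX, hz, hzr.trans_lt hry⟩, ?_⟩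
      beta_reduce
      rw [hzr, mul_div_cancel_right₀ _ hy₁.ne']

end CuspChart

section Vertex

variable {γ : ℝ → Plane} {a b s t t₀ : ℝ} {z q : Plane}

namespace IsC2OpenArc

theorem eq_add_smul_unitNormal_of_isFoot (hγ : IsC2OpenArc γ) (ht : t ∈ Ioo (0 : ℝ) 1)
    (hk : curvature γ t ≠ 0) (hz : IsFoot (trace γ) z (γ t)) :
    z = γ t + inner ℝ (z - γ t) (unitNormal γ t) • unitNormal γ t :=
  hγ.smul_unitNormal_of_inner_eq_zero ht hk
    (hγ.inner_eq_zero_of_isLocalExtr ht (Or.inl (isLocalMin_dist_of_isFoot ht hz)))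

theorem inner_unitNormal_le_inv_of_isFoot (hγ : IsC2OpenArc γ) (ht : t ∈ Ioo (0 : ℝ) 1)
    (hk : curvature γ t ≠ 0) (hz : IsFoot (trace γ) z (γ t)) :
    inner ℝ (z - γ t) (unitNormal γ t) ≤ (curvature γ t)⁻¹ := by
  have hform := hγ.secondForm_nonneg_of_isLocalMin ht (isLocalMin_dist_of_isFoot ht hz)
  rw [hγ.eq_add_smul_unitNormal_of_isFoot ht hk hz, hγ.secondForm_normal ht] at hform
  have hle := nonneg_of_mul_nonneg_right hform (pow_pos (hγ.norm_deriv_pos ht) 2)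
  rw [← one_div, le_div_iff₀ (curvature_pos_of_ne_zero hk)]
  exact sub_nonneg.1 hle

theorem mem_closedBall_evolute_of_isFoot (hγ : IsC2OpenArc γ) (ht : t ∈ Ioo (0 : ℝ) 1)
    (hk : curvature γ t ≠ 0) (hz : IsFoot (trace γ) z (γ t))
    (hpos : 0 < inner ℝ (z - γ t) (unitNormal γ t)) (hq : IsFoot (trace γ) z q) :
    q ∈ closedBall (evolute γ t) (curvature γ t)⁻¹ := by
  have hle := hγ.inner_unitNormal_le_inv_of_isFoot ht hk hz
  have hzt := hγ.eq_add_smul_unitNormal_of_isFoot ht hk hz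
  set d := inner ℝ (z - γ t) (unitNormal γ t)
  have hzq : dist q z ≤ d := by
    rw [dist_comm, hq.dist_eq, ← hz.dist_eq, hzt, hγ.dist_normal ht hk, abs_of_pos hpos]
  refine closedBall_subset_closedBall' ?_ hzq
  rw [hzt, hγ.evolute_eq ht hk, dist_add_left, dist_eq_norm, ← sub_smul, norm_smul,
    hγ.norm_unitNormal ht hk, Real.norm_of_nonpos (sub_nonpos.2 hle)]
  linarith

theorem notMem_ball_evolute_of_isFoot (hγ : IsC2OpenArc γ) (ht : t ∈ Ioo (0 : ℝ) 1)
    (hk : curvature γ t ≠ 0) (h : IsFoot (trace γ) (evolute γ t) (γ t))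
    (hs : s ∈ Ioo (0 : ℝ) 1) : γ s ∉ ball (evolute γ t) (curvature γ t)⁻¹ := by
  rw [mem_ball, not_lt, dist_comm, ← hγ.dist_evolute ht hk]
  exact h.dist_le (subset_closure (mem_trace hs))

theorem eq_of_isFoot_evolute (hγ : IsC2OpenArc γ)
    (huniq : ∀ s ∈ Ioo (0 : ℝ) 1, IsLocalMax (curvature γ) s → s = t₀) (ht : t ∈ Ioo (0 : ℝ) 1)
    (hk : curvature γ t ≠ 0) (h : IsFoot (trace γ) (evolute γ t) (γ t)) : t = t₀ := by
  by_contra hne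
  obtain ⟨s, hs, hmem⟩ := hγ.exists_mem_ball_evolute ht hk (fun hloc => hne (huniq t ht hloc))
    (eventually_not_isLocalMax_of_forall_eq ht huniq)
  exact hγ.notMem_ball_evolute_of_isFoot ht hk h hs hmem

theorem eventually_sign_inner_deriv_eq (hγ : IsC2OpenArc γ) (ht : t ∈ Ioo (0 : ℝ) 1) :
    ∀ᶠ s in 𝓝 t,
      SignType.sign (inner ℝ (γ s - γ t) (deriv γ t)) = SignType.sign (s - t) := by
  have hderiv : HasDerivAt (fun s => inner ℝ (γ s - γ t) (deriv γ t)) (‖deriv γ t‖ ^ 2) t := by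
    simpa only [inner_zero_right, zero_add, real_inner_self_eq_norm_sq]
      using ((hγ.hasDerivAt ht).sub_const (γ t)).inner ℝ (hasDerivAt_const t (deriv γ t))
  refine eventually_nhdsWithin_sign_eq_of_deriv_pos ?_ (by rw [sub_self, inner_zero_left])
  rw [hderiv.deriv]
  exact pow_pos (hγ.norm_deriv_pos ht) 2

theorem eventually_inner_unitNormal_pos (hγ : IsC2OpenArc γ) (ht : t ∈ Ioo (0 : ℝ) 1)
    (hk : curvature γ t ≠ 0) :
    ∀ᶠ s in 𝓝 t, s ≠ t → 0 < inner ℝ (γ s - γ t) (unitNormal γ t) := by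
  have hpos : ∀ᶠ s in 𝓝 t, 0 < inner ℝ (deriv (deriv γ) s) (unitNormal γ t) := by
    refine ((hγ.continuousAt_deriv2 ht).inner continuousAt_const).eventually (Ioi_mem_nhds ?_)
    beta_reduce
    rw [real_inner_comm, hγ.inner_unitNormal_deriv2 ht]
    exact mul_pos (curvature_pos_of_ne_zero hk) (pow_pos (hγ.norm_deriv_pos ht) 2)
  obtain ⟨η, hη, hs⟩ := exists_Icc_subset_of_eventually (hpos.and (isOpen_Ioo.eventually_mem ht))
  have hIcc : Icc (t - η) (t + η) ∈ 𝓝 t :=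
    Icc_mem_nhds (sub_lt_self t hη) (lt_add_of_pos_right t hη)
  have hderiv : ∀ s ∈ Icc (t - η) (t + η),
      HasDerivAt (fun s => inner ℝ (γ s - γ t) (unitNormal γ t))
        (inner ℝ (deriv γ s) (unitNormal γ t)) s := fun s hs' => by
    simpa only [inner_zero_right, zero_add]
      using ((hγ.hasDerivAt (hs s hs').2).sub_const (γ t)).inner ℝ
        (hasDerivAt_const s (unitNormal γ t))
  have hderiv2 : ∀ s ∈ Icc (t - η) (t + η),
      HasDerivAt (fun s => inner ℝ (deriv γ s) (unitNormal γ t))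
        (inner ℝ (deriv (deriv γ) s) (unitNormal γ t)) s := fun s hs' => by
    simpa only [inner_zero_right, zero_add]
      using (hγ.hasDerivAt_deriv (hs s hs').2).inner ℝ (hasDerivAt_const s (unitNormal γ t))
  filter_upwards [hIcc] with s hs' hne
  simpa only [sub_self, inner_zero_left] using lt_of_hasDerivAt2_pos (convex_Icc _ _) hderiv
    hderiv2 (fun r hr => (hs r hr).1) (mem_of_mem_nhds hIcc) (inner_deriv_unitNormal γ t) hs' hne

theorem eventually_inner_unitNormal_pos_prod (hγ : IsC2OpenArc γ) (ht : t ∈ Ioo (0 : ℝ) 1)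
    (hk : curvature γ t ≠ 0) :
    ∀ᶠ x in 𝓝 (evolute γ t, t), 0 < inner ℝ (x.1 - γ x.2) (unitNormal γ x.2) := by
  have hγc : ContinuousAt (fun x : Plane × ℝ => γ x.2) (evolute γ t, t) :=
    ContinuousAt.comp (f := Prod.snd) (hγ.hasDerivAt ht).continuousAt continuousAt_snd
  have hNc : ContinuousAt (fun x : Plane × ℝ => unitNormal γ x.2) (evolute γ t, t) :=
    ContinuousAt.comp (f := Prod.snd) (g := unitNormal γ)
      (hγ.hasDerivAt_unitNormal ht hk).continuousAt continuousAt_snd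
  have hpos : 0 < inner ℝ (evolute γ t - γ t) (unitNormal γ t) := by
    rw [hγ.evolute_eq ht hk, add_sub_cancel_left, real_inner_smul_left,
      real_inner_self_eq_norm_sq, hγ.norm_unitNormal ht hk, one_pow, mul_one]
    exact inv_pos.2 (curvature_pos_of_ne_zero hk)
  exact ((continuousAt_fst.sub hγc).inner hNc).eventually (Ioi_mem_nhds hpos)

end IsC2OpenArc

/-- The curvature increases strictly up to the parameter `t₀` and decreases strictly from there. -/
structure HasVertex (γ : ℝ → Plane) (t₀ : ℝ) : Prop where
  mem : t₀ ∈ Ioo (0 : ℝ) 1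
  strictMonoOn : StrictMonoOn (curvature γ) (Ioc 0 t₀)
  strictAntiOn : StrictAntiOn (curvature γ) (Ico t₀ 1)

namespace HasVertex

theorem curvature_ne_zero (h : HasVertex γ t₀) (ht : t ∈ Ioo (0 : ℝ) 1) : curvature γ t ≠ 0 := by
  rcases le_total t t₀ with hle | hle
  · exact curvature_ne_zero_of_strictMonoOn h.strictMonoOn ⟨ht.1, hle⟩
  · exact curvature_ne_zero_of_strictAntiOn h.strictAntiOn ⟨hle, ht.2⟩

theorem closedBall_evolute_subset_ball_right (h : HasVertex γ t₀) (hγ : IsC2OpenArc γ)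
    (ha : t₀ ≤ a) (hab : a < b) (hb : b < 1) :
    closedBall (evolute γ a) (curvature γ a)⁻¹ ⊆ ball (evolute γ b) (curvature γ b)⁻¹ :=
  hγ.closedBall_evolute_subset_ball_of_strictAntiOn (h.mem.1.trans_le ha) hab hb
    (h.strictAntiOn.mono fun _ hx => ⟨ha.trans hx.1, hx.2.trans_lt hb⟩)
    (h.curvature_ne_zero ⟨(h.mem.1.trans_le ha).trans hab, hb⟩)

theorem closedBall_evolute_subset_ball_left (h : HasVertex γ t₀) (hγ : IsC2OpenArc γ)
    (ha : 0 < a) (hab : a < b) (hb : b ≤ t₀) :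
    closedBall (evolute γ b) (curvature γ b)⁻¹ ⊆ ball (evolute γ a) (curvature γ a)⁻¹ :=
  hγ.closedBall_evolute_subset_ball_of_strictMonoOn ha hab (hb.trans_lt h.mem.2)
    (h.strictMonoOn.mono fun _ hx => ⟨ha.trans_le hx.1, hx.2.trans hb⟩)
    (h.curvature_ne_zero ⟨ha, hab.trans (hb.trans_lt h.mem.2)⟩)

theorem notMem_closedBall_evolute_right (h : HasVertex γ t₀) (hγ : IsC2OpenArc γ)
    (ha : t₀ ≤ a) (hab : a < b) (hb : b < 1) :
    γ b ∉ closedBall (evolute γ a) (curvature γ a)⁻¹ := fun hmem =>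
  have hb' : b ∈ Ioo (0 : ℝ) 1 := ⟨(h.mem.1.trans_le ha).trans hab, hb⟩
  hγ.notMem_ball_evolute hb' (h.curvature_ne_zero hb')
    (h.closedBall_evolute_subset_ball_right hγ ha hab hb hmem)

theorem notMem_closedBall_evolute_left (h : HasVertex γ t₀) (hγ : IsC2OpenArc γ)
    (ha : 0 < a) (hab : a < b) (hb : b ≤ t₀) :
    γ a ∉ closedBall (evolute γ b) (curvature γ b)⁻¹ := fun hmem =>
  have ha' : a ∈ Ioo (0 : ℝ) 1 := ⟨ha, hab.trans (hb.trans_lt h.mem.2)⟩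
  hγ.notMem_ball_evolute ha' (h.curvature_ne_zero ha')
    (h.closedBall_evolute_subset_ball_left hγ ha hab hb hmem)

theorem not_isLocalMax_dist_evolute (h : HasVertex γ t₀) (hγ : IsC2OpenArc γ)
    (ht : t ∈ Ioo (0 : ℝ) 1) : ¬ IsLocalMax (fun s => dist (evolute γ t) (γ s)) t := by
  intro hmax
  have hclosed : ∀ᶠ s in 𝓝 t, γ s ∈ closedBall (evolute γ t) (curvature γ t)⁻¹ :=
    hmax.mono fun s hs => by
      rw [mem_closedBall, dist_comm, ← hγ.dist_evolute ht (h.curvature_ne_zero ht)]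
      exact hs
  rcases le_total t₀ t with hle | hle
  · obtain ⟨s, hs, hts, hs₁⟩ :=
      ((hclosed.filter_mono nhdsWithin_le_nhds).and (Ioo_mem_nhdsGT ht.2)).exists
    exact h.notMem_closedBall_evolute_right hγ hle hts hs₁ hs
  · obtain ⟨s, hs, hs₀, hst⟩ :=
      ((hclosed.filter_mono nhdsWithin_le_nhds).and (Ioo_mem_nhdsLT ht.1)).exists
    exact h.notMem_closedBall_evolute_left hγ hs₀ hst hle hs

theorem piSet_subset_convexSide (h : HasVertex γ t₀) (hγ : IsC2OpenArc γ) :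
    piSet (trace γ) ⊆ convexSide γ := by
  intro p hp
  obtain ⟨m, hm, hmax⟩ := hγ.exists_isLocalMax_of_mem_piSet hp
  obtain ⟨hk, d, hd, rfl⟩ := hγ.exists_normal_of_isLocalMax hm hmax
  rcases hd.eq_or_lt with rfl | hlt
  · rw [← hγ.evolute_eq hm hk] at hmax
    exact absurd hmax (h.not_isLocalMax_dist_evolute hγ hm)
  · exact hγ.normal_mem_convexSide hm hk hlt

theorem isFoot_evolute (h : HasVertex γ t₀) (hγ : IsC2OpenArc γ) :
    IsFoot (trace γ) (evolute γ t₀) (γ t₀) := by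
  refine isFoot_of_dist_le (subset_closure (mem_trace h.mem)) ?_
  rw [hγ.dist_evolute h.mem (h.curvature_ne_zero h.mem), le_infDist ⟨_, mem_trace h.mem⟩]
  rintro _ ⟨s, hs, rfl⟩
  rw [dist_comm]
  rcases lt_trichotomy s t₀ with hlt | rfl | hlt
  · exact (not_le.1 (h.notMem_closedBall_evolute_left hγ hs.1 hlt le_rfl)).le
  · exact not_lt.1 (hγ.notMem_ball_evolute hs (h.curvature_ne_zero hs))
  · exact (not_le.1 (h.notMem_closedBall_evolute_right hγ le_rfl hlt hs.2)).le

theorem eq_of_isFoot_evolute (h : HasVertex γ t₀) (hγ : IsC2OpenArc γ) (ht : t ∈ Ioo (0 : ℝ) 1)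
    (hf : IsFoot (trace γ) (evolute γ t) (γ t)) : t = t₀ := by
  have hmem := hγ.mem_closedBall_evolute h.mem (h.curvature_ne_zero h.mem)
  by_contra hne
  refine hγ.notMem_ball_evolute_of_isFoot ht (h.curvature_ne_zero ht) hf h.mem ?_
  rcases lt_or_gt_of_ne hne with hlt | hlt
  · exact h.closedBall_evolute_subset_ball_left hγ ht.1 hlt le_rfl hmem
  · exact h.closedBall_evolute_subset_ball_right hγ le_rfl hlt ht.2 hmem

theorem evolute_mem_divider (h : HasVertex γ t₀) (hγ : IsC2OpenArc γ) :
    evolute γ t₀ ∈ divider (trace γ) := by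
  have hk := h.curvature_ne_zero h.mem
  have hkpos := inv_pos.2 (curvature_pos_of_ne_zero hk)
  have hN := hγ.norm_unitNormal h.mem hk
  refine ⟨γ t₀, mem_trace h.mem, unitNormal γ t₀, hN, (curvature γ t₀)⁻¹,
    isLUB_contactRadii (mem_trace h.mem) hN hkpos ?_ fun r hr => ?_, hγ.evolute_eq h.mem hk⟩
  · rw [← hγ.evolute_eq h.mem hk, ← (h.isFoot_evolute hγ).dist_eq, hγ.dist_evolute h.mem hk]
  · by_contra! hlt
    obtain ⟨s, ⟨hdist, hs⟩, hne⟩ := (((hγ.eventually_dist_lt_of_inv_lt h.mem hk hlt).and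
      (isOpen_Ioo.eventually_mem h.mem)).filter_mono nhdsWithin_le_nhds |>.and
        (self_mem_nhdsWithin (s := {t₀}ᶜ))).exists
    have hlt' := hdist hne
    rw [hγ.dist_normal h.mem hk, abs_of_pos hr.1, dist_comm] at hlt'
    have hmem : γ s ∈ closedBall (γ t₀ + r • unitNormal γ t₀) r ∩ trace γ :=
      ⟨hlt'.le, mem_trace hs⟩
    rw [hr.2] at hmem
    exact hne (hγ.injOn hs h.mem hmem)

theorem not_isFoot_evolute_of_mem_closure (h : HasVertex γ t₀) (hγ : IsC2OpenArc γ) (ha : 0 < a)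
    (hat : a < t₀) (htb : t₀ < b) (hb : b < 1) (hq : q ∈ closure (γ '' (Ioc 0 a ∪ Ico b 1))) :
    ¬ IsFoot (trace γ) (evolute γ t₀) q := by
  intro hfoot
  have hmem : q ∈ closedBall (evolute γ t₀) (curvature γ t₀)⁻¹ := by
    rw [mem_closedBall, dist_comm, ← hγ.dist_evolute h.mem (h.curvature_ne_zero h.mem)]
    exact hfoot.dist_le (subset_closure (mem_trace h.mem))
  obtain ⟨_, ⟨hleft, hright⟩, s, hs, rfl⟩ := mem_closure_iff.1 hq _
    (isOpen_ball.inter isOpen_ball)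
    ⟨h.closedBall_evolute_subset_ball_left hγ ha hat le_rfl hmem,
      h.closedBall_evolute_subset_ball_right hγ le_rfl htb hb hmem⟩
  rcases hs with ⟨hs₀, hsa⟩ | ⟨hbs, hs₁⟩
  · rcases hsa.eq_or_lt with rfl | hlt
    · exact hγ.notMem_ball_evolute ⟨ha, hat.trans h.mem.2⟩
        (h.curvature_ne_zero ⟨ha, hat.trans h.mem.2⟩) hleft
    · exact h.notMem_closedBall_evolute_left hγ hs₀ hlt hat.le (ball_subset_closedBall hleft)
  · rcases hbs.eq_or_lt with rfl | hlt
    · exact hγ.notMem_ball_evolute ⟨h.mem.1.trans htb, hb⟩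
        (h.curvature_ne_zero ⟨h.mem.1.trans htb, hb⟩) hright
    · exact h.notMem_closedBall_evolute_right hγ htb.le hlt hs₁ (ball_subset_closedBall hright)

theorem eventually_forall_isFoot (h : HasVertex γ t₀) (hγ : IsC2OpenArc γ)
    {P : Plane → ℝ → Prop} (hP : ∀ᶠ x in 𝓝 (evolute γ t₀, t₀), P x.1 x.2) :
    ∀ᶠ z in 𝓝 (evolute γ t₀), ∀ p, IsFoot (trace γ) z p →
      ∃ s ∈ Ioo (0 : ℝ) 1, γ s = p ∧ P z s := by
  rw [nhds_prod_eq, eventually_prod_iff] at hP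
  obtain ⟨P₁, hP₁, P₂, hP₂, hP⟩ := hP
  obtain ⟨η, hη, hs⟩ := exists_Icc_subset_of_eventually
    (hP₂.and (isOpen_Ioo.eventually_mem h.mem))
  have hlt : t₀ - η < t₀ := sub_lt_self t₀ hη
  have hgt : t₀ < t₀ + η := lt_add_of_pos_right t₀ hη
  have ha := (hs (t₀ - η) ⟨le_rfl, (hlt.trans hgt).le⟩).2.1
  have hb := (hs (t₀ + η) ⟨(hlt.trans hgt).le, le_rfl⟩).2.2
  have hsub : closure (γ '' (Ioc 0 (t₀ - η) ∪ Ico (t₀ + η) 1)) ⊆ closure (trace γ) :=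
    closure_mono (image_mono (union_subset (fun s hs' => ⟨hs'.1, hs'.2.trans_lt
      (hlt.trans h.mem.2)⟩) fun s hs' => ⟨(h.mem.1.trans hgt).trans_le hs'.1, hs'.2⟩))
  filter_upwards [hP₁, (h.isFoot_evolute hγ).eventually_forall_dist_lt isClosed_closure hsub
    fun q hq => h.not_isFoot_evolute_of_mem_closure hγ ha hlt hgt hb hq] with z hz hfar p hp
  rcases hγ.closure_trace_subset ha hb hp.mem_closure with ⟨s, hsη, rfl⟩ | hpfar
  · exact ⟨s, (hs s hsη).2, rfl, hP hz (hs s hsη).1⟩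
  · exact absurd (hp.dist_le (subset_closure (mem_trace h.mem))) (not_le.2 (hfar p hpfar))

theorem lt_and_lt_of_isFoot (h : HasVertex γ t₀) (hγ : IsC2OpenArc γ) (hs : s ∈ Ioo (0 : ℝ) 1)
    (ht : t ∈ Ioo (0 : ℝ) 1) (hst : s < t) (hzs : IsFoot (trace γ) z (γ s))
    (hzt : IsFoot (trace γ) z (γ t)) (hspos : 0 < inner ℝ (z - γ s) (unitNormal γ s))
    (htpos : 0 < inner ℝ (z - γ t) (unitNormal γ t)) : s < t₀ ∧ t₀ < t := by
  refine ⟨?_, ?_⟩ <;> by_contra! hle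
  · exact h.notMem_closedBall_evolute_right hγ hle hst ht.2
      (hγ.mem_closedBall_evolute_of_isFoot hs (h.curvature_ne_zero hs) hzs hspos hzt)
  · exact h.notMem_closedBall_evolute_left hγ hs.1 hst hle
      (hγ.mem_closedBall_evolute_of_isFoot ht (h.curvature_ne_zero ht) hzt htpos hzs)

theorem eventually_forall_isFoot_normal (h : HasVertex γ t₀) (hγ : IsC2OpenArc γ) :
    ∀ᶠ z in 𝓝 (evolute γ t₀), ∀ p, IsFoot (trace γ) z p → ∃ s ∈ Ioo (0 : ℝ) 1, γ s = p ∧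
      0 < inner ℝ (z - γ s) (unitNormal γ s) ∧
      SignType.sign (inner ℝ (γ s - γ t₀) (deriv γ t₀)) = SignType.sign (s - t₀) ∧
      (s ≠ t₀ → 0 < inner ℝ (γ s - γ t₀) (unitNormal γ t₀)) := by
  have hk := h.curvature_ne_zero h.mem
  have hgraph := (hγ.eventually_sign_inner_deriv_eq h.mem).and
    (hγ.eventually_inner_unitNormal_pos h.mem hk)
  exact h.eventually_forall_isFoot hγ
    ((hγ.eventually_inner_unitNormal_pos_prod h.mem hk).and (hgraph.prod_inr_nhds _))

theorem mem_divider_iff (h : HasVertex γ t₀) (hγ : IsC2OpenArc γ)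
    (hz : 0 < infDist z (trace γ)) (hfoot : ∀ p, IsFoot (trace γ) z p → p ∈ trace γ) :
    z ∈ divider (trace γ) ↔
      z = evolute γ t₀ ∨ ∃ p q, IsFoot (trace γ) z p ∧ IsFoot (trace γ) z q ∧ p ≠ q := by
  constructor
  · intro hmem
    obtain ⟨-, t, ht, hp, ⟨q, hq, hqt⟩ | ⟨-, rfl⟩⟩ := hγ.exists_isFoot_ne_or_eq_evolute hmem
    · exact Or.inr ⟨_, q, hp, hq, hqt.symm⟩
    · exact Or.inl (congrArg (evolute γ) (h.eq_of_isFoot_evolute hγ ht hp))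
  · rintro (rfl | ⟨p, q, hp, hq, hpq⟩)
    · exact h.evolute_mem_divider hγ
    · exact mem_divider_of_isFoot (hfoot p hp) hp hq hpq.symm hz

theorem exists_isCuspChart (h : HasVertex γ t₀) (hγ : IsC2OpenArc γ) :
    ∃ ε > 0, IsCuspChart (trace γ) (divider (trace γ)) (evolute γ t₀) (γ t₀) (deriv γ t₀)
      (unitNormal γ t₀) ε := by
  have hk := h.curvature_ne_zero h.mem
  have hfoot := h.isFoot_evolute hγ
  have hpos : 0 < infDist (evolute γ t₀) (trace γ) := by
    rw [← hfoot.dist_eq, hγ.dist_evolute h.mem hk]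
    exact inv_pos.2 (curvature_pos_of_ne_zero hk)
  obtain ⟨ε, hε, hball⟩ := Metric.eventually_nhds_iff_ball.1
    ((h.eventually_forall_isFoot_normal hγ).and
      ((continuous_infDist_pt (trace γ)).continuousAt.eventually (Ioi_mem_nhds hpos)))
  refine ⟨ε, hε, hγ.deriv_ne_zero t₀ h.mem, hγ.norm_unitNormal h.mem hk,
    inner_deriv_unitNormal γ t₀, hfoot, ?_, ?_, ?_, ?_, ?_⟩
  · intro z hz p hp hne
    obtain ⟨s, -, rfl, -, -, hnormal⟩ := (hball z hz).1 p hp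
    exact hnormal fun hs => hne (congrArg γ hs)
  · intro z hz p hp hne
    obtain ⟨s, -, rfl, -, hsign, -⟩ := (hball z hz).1 p hp
    rw [← sign_ne_zero, hsign, sign_ne_zero, sub_ne_zero]
    exact fun hs => hne (congrArg γ hs)
  · intro z hz p hp q hq hpq
    obtain ⟨s, hs, rfl, hspos, hssign, -⟩ := (hball z hz).1 p hp
    obtain ⟨t, ht, rfl, htpos, htsign, -⟩ := (hball z hz).1 q hq
    rw [← sign_eq_neg_one_iff, sign_mul, hssign, htsign, ← sign_mul, sign_eq_neg_one_iff]
    rcases lt_or_gt_of_ne fun hst : s = t => hpq (congrArg γ hst) with hst | hst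
    · obtain ⟨hs₀, ht₀⟩ := h.lt_and_lt_of_isFoot hγ hs ht hst hp hq hspos htpos
      exact mul_neg_of_neg_of_pos (sub_neg.2 hs₀) (sub_pos.2 ht₀)
    · obtain ⟨ht₀, hs₀⟩ := h.lt_and_lt_of_isFoot hγ ht hs hst hq hp htpos hspos
      exact mul_neg_of_pos_of_neg (sub_pos.2 hs₀) (sub_neg.2 ht₀)
  · intro z _ hz
    refine ⟨_, sub_nonpos.2 (hγ.inner_unitNormal_le_inv_of_isFoot h.mem hk hz), ?_⟩
    rw [hγ.evolute_eq h.mem hk, sub_smul, add_assoc, add_sub_cancel]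
    exact hγ.eq_add_smul_unitNormal_of_isFoot h.mem hk hz
  · intro z hz
    refine h.mem_divider_iff hγ (hball z hz).2 fun p hp => ?_
    obtain ⟨s, hs, rfl, -⟩ := (hball z hz).1 p hp
    exact mem_trace hs

theorem isEndPoint_evolute (h : HasVertex γ t₀) (hγ : IsC2OpenArc γ) :
    IsEndPoint (divider (trace γ)) (evolute γ t₀) := by
  obtain ⟨ε, hε, hchart⟩ := h.exists_isCuspChart hγ
  exact hchart.isEndPoint hε

end HasVertex

theorem IsC2OpenArc.eq_evolute_of_isEndPoint (hγ : IsC2OpenArc γ)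
    (hconst : NoConstantCurvatureArc γ)
    (huniq : ∀ t ∈ Ioo (0 : ℝ) 1, IsLocalMax (curvature γ) t → t = t₀) {e : Plane}
    (he : IsEndPoint (divider (trace γ)) e) : e = evolute γ t₀ := by
  have hmem : e ∈ divider (trace γ) := let ⟨_, heU, _⟩ := he; heU.1
  obtain ⟨hpos, t, ht, hp, ⟨q, hq, hqt⟩ | ⟨hk, rfl⟩⟩ := hγ.exists_isFoot_ne_or_eq_evolute hmem
  · exact absurd he (hγ.not_isEndPoint_of_isFoot hconst ht hpos hp hq hqt)
  · exact congrArg (evolute γ) (hγ.eq_of_isFoot_evolute huniq ht hk hp)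

theorem IsC2OpenArc.hasVertex (hγ : IsC2OpenArc γ) (ht₀ : t₀ ∈ Ioo (0 : ℝ) 1)
    (huniq : ∀ t ∈ Ioo (0 : ℝ) 1, IsLocalMax (curvature γ) t → t = t₀)
    (hunb : BothEndsUnbounded γ) : HasVertex γ t₀ where
  mem := ht₀
  strictMonoOn := hγ.strictMonoOn_curvature ht₀.2
    (fun t ht hloc => ht.2.ne (huniq t ⟨ht.1, ht.2.trans ht₀.2⟩ hloc))
    fun t ht => (hunb t ⟨ht.1, ht.2.trans ht₀.2⟩).1
  strictAntiOn := hγ.strictAntiOn_curvature ht₀.1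
    (fun t ht hloc => ht.1.ne' (huniq t ⟨ht₀.1.trans ht.1, ht.2⟩ hloc))
    fun t ht => (hunb t ⟨ht₀.1.trans ht.1, ht.2⟩).2

end Vertex

end DividerSet

open DividerSet in
theorem mainTheorem1_general (γ : ℝ → Plane) (hγ : IsC2OpenArc γ)
    (hconst : NoConstantCurvatureArc γ)
    (hmax : ∃! t : ℝ, t ∈ Ioo (0 : ℝ) 1 ∧ IsLocalMax (curvature γ) t) :
    divider (trace γ) ⊆ closure (piSet (trace γ)) ∩ closure (convexSide γ) ∧
    {e | IsEndPoint (divider (trace γ)) e} ⊆ maxCurvatureCusps γ ∧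
    (∃ c, maxCurvatureCusps γ = {c}) ∧
    (BothEndsUnbounded γ →
      piSet (trace γ) = convexSide γ ∧
      {e | IsEndPoint (divider (trace γ)) e} = maxCurvatureCusps γ) := by
  obtain ⟨t₀, ⟨ht₀, hloc⟩, hunique⟩ := hmax
  have huniq : ∀ t ∈ Ioo (0 : ℝ) 1, IsLocalMax (curvature γ) t → t = t₀ :=
    fun t ht h => hunique t ⟨ht, h⟩
  have hpi := hγ.divider_subset_closure_piSet hconst
  have hconvex := closure_minimal hγ.piSet_subset_closure_convexSide isClosed_closure
  have hcusps := hγ.maxCurvatureCusps_eq_singleton ht₀ hloc huniq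
  have hends : {e | IsEndPoint (divider (trace γ)) e} ⊆ {evolute γ t₀} :=
    fun _ he => hγ.eq_evolute_of_isEndPoint hconst huniq he
  rw [hcusps]
  refine ⟨subset_inter hpi (hpi.trans hconvex), hends, ⟨_, rfl⟩, fun hunb => ?_⟩
  have hvertex := hγ.hasVertex ht₀ huniq hunb
  exact ⟨(hvertex.piSet_subset_convexSide hγ).antisymm hγ.convexSide_subset_piSet,
    hends.antisymm (singleton_subset_iff.2 (hvertex.isEndPoint_evolute hγ))⟩

theorem mainTheorem1 (γ : ℝ → DividerSet.Plane) (hγ : DividerSet.IsC2OpenArc γ)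
    (hunb : ¬ Bornology.IsBounded (DividerSet.trace γ))
    (hconst : DividerSet.NoConstantCurvatureArc γ)
    (hmax : ∃! t : ℝ, t ∈ Set.Ioo (0 : ℝ) 1 ∧ IsLocalMax (DividerSet.curvature γ) t) :
    DividerSet.divider (DividerSet.trace γ)
        ⊆ closure (DividerSet.piSet (DividerSet.trace γ)) ∩ closure (DividerSet.convexSide γ) ∧
    {e | DividerSet.IsEndPoint (DividerSet.divider (DividerSet.trace γ)) e}
        ⊆ DividerSet.maxCurvatureCusps γ ∧
    (∃ c, DividerSet.maxCurvatureCusps γ = {c}) ∧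
    (DividerSet.BothEndsUnbounded γ →
      DividerSet.piSet (DividerSet.trace γ) = DividerSet.convexSide γ ∧
      {e | DividerSet.IsEndPoint (DividerSet.divider (DividerSet.trace γ)) e}
        = DividerSet.maxCurvatureCusps γ) :=
  mainTheorem1_general γ hγ hconst hmax
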